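/- For a sequence $\boldsymbol{k}=(k_1,\dots,k_n)$ of nonnegative integers, let $G(\boldsymbol{k})$ be the set of simple graphs on $n$ labelled vertices in which vertex $j$ has degree $k_j$ for every $j$, and let $M=k_1+\cdots+k_n$. The sequence $\boldsymbol{k}$ is *graphical* if $G(\boldsymbol{k})\neq\emptyset$. For $\gamma>1$ and $C>0$, it is *power-law distribution-bounded with parameter $\gamma$ and constant $C$* if every $k_j\ge 1$ and, for every integer $i\ge 1$, at most $C\,n\,i^{1-\gamma}$ entries of $\boldsymbol{k}$ are at least $i$. A *configuration* for $\boldsymbol{k}$ is a partition into pairs of $M$ points, of which $k_j$ lie in cell $j$; shrinking cells to vertices and replacing each pair by an edge turns a configuration $P$ into a multigraph $G(P)$. The *configuration model* is the algorithm: repeat, choose a configuration $P$ uniformly at random, until $G(P)$ is simple; then output $G(P)$. It is implemented by a fixed word RAM program, which numbers the points cell by cell; in each round chooses $P$ by repeatedly taking an unmatched point and pairing it with a uniformly random other unmatched point, and then tests whether $G(P)$ is simple by scanning the points of each cell and marking the neighbouring vertices already seen; and finally lists the edges of $G(P)$. On inputs with $n$ vertices the words have $4(\lfloor\log_2 n\rfloor+1)$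 bits. Each elementary operation on words, including drawing a uniformly random element of $\{0,\dots,N-1\}$ for a given word $N\geq 1$, takes unit time. The *expected runtime* on input $\boldsymbol{k}$ is the expected number of time units until the program halts. **Lemma.** Let $\gamma>3$ and $C>0$, and consider all $n\ge 1$ and all graphical sequences $\boldsymbol{k}=(k_1,\dots,k_n)$ that are power-law distribution-bounded with parameter $\gamma$ and constant $C$. 1. For each such $\boldsymbol{k}$, a round (run from the input) chooses a uniformly random configuration and correctly decides whether its multigraph is simple; and the configuration model is a uniform sampler for $G(\boldsymbol{k})$: it halts with each $G\in G(\boldsymbol{k})$ as output with probability exactly $1/|G(\boldsymbol{k})|$. 2. The expected runtime is $O(M)$: there is a constant $K$, depending only on $\gamma$ and $C$, such that for all such $n$ and $\boldsymbol{k}$ the expected runtime is at most $K M$. 3. The sampler is polynomial-time: there is a real polynomial $Q$, depending only on $\gamma$ and $C$, such that for all such $n$ and $\boldsymbol{k}$ the expected runtime is at most $Q(\log|G(\boldsymbol{k})|)$. -/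

import Mathlib

/-! ## Degree sequences and graphs -/

/-- `G(k)`: the set of all (simple, labelled) graphs on `n` vertices in which vertex `j` has
degree `k j`. -/
def graphsWithDegrees {n : ℕ} (k : Fin n → ℕ) : Set (SimpleGraph (Fin n)) :=
  {G | ∀ j, (G.neighborSet j).ncard = k j}

/-- The sequence `k` is graphical: it is the degree sequence of some graph. -/
def IsGraphical {n : ℕ} (k : Fin n → ℕ) : Prop := (graphsWithDegrees k).Nonempty

/-- `M = k_1 + ... + k_n`. -/
def degreeSum {n : ℕ} (k : Fin n → ℕ) : ℕ := ∑ j, k j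

/-- `k` is power-law distribution-bounded with parameter `γ` and constant `C`: all entries are at
least `1`, and for every `i ≥ 1` at most `C n i^(1-γ)` entries are at least `i`. -/
def PowerLawDistributionBounded (γ C : ℝ) {n : ℕ} (k : Fin n → ℕ) : Prop :=
  (∀ j, 1 ≤ k j) ∧
    ∀ i : ℕ, 1 ≤ i → ({j | i ≤ k j}.ncard : ℝ) ≤ C * n * (i : ℝ) ^ (1 - γ)

/-! ## Configurations -/

/-- The `M` points; cell `j` contains the `k j` points `⟨j, 0⟩, ..., ⟨j, k j - 1⟩`. -/
abbrev Point {n : ℕ} (k : Fin n → ℕ) : Type := Σ j : Fin n, Fin (k j)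

/-- A configuration: a partition of the points into pairs, given by the map that sends each
point to the other point of its pair. -/
def Configuration {n : ℕ} (k : Fin n → ℕ) : Type :=
  {f : Point k → Point k // ∀ x, f (f x) = x ∧ f x ≠ x}

/-- The set of pairs of a configuration. -/
def Configuration.pairs {n : ℕ} {k : Fin n → ℕ} (P : Configuration k) :
    Finset (Sym2 (Point k)) :=
  Finset.univ.image fun x => s(x, P.1 x)

/-- The multiset of edges of the multigraph `G(P)`: cells are shrunk to vertices, and each pair
becomes an edge. -/
def Configuration.multigraph {n : ℕ} {k : Fin n → ℕ} (P : Configuration k) :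
    Multiset (Sym2 (Fin n)) :=
  P.pairs.val.map (Sym2.map Sigma.fst)

/-- `G(P)` has no loops and no repeated edges. -/
def Configuration.IsSimple {n : ℕ} {k : Fin n → ℕ} (P : Configuration k) : Prop :=
  (∀ e ∈ P.multigraph, ¬ e.IsDiag) ∧ P.multigraph.Nodup

/-! ## A randomised word RAM

The machine has finitely many registers and finitely many arrays of words, all with addresses
that are words. With word length `w`, sums are computed modulo `2 ^ w`. Every elementary
operation (arithmetic on two registers, reading or writing one array cell, comparing two
registers, drawing a uniformly random integer below a given word) takes one unit of time. -/

/-- The registers. -/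
inductive Reg : Type
  | zero | one | n | M | p | q | i | r | d | t | u | v | bad | m
  deriving DecidableEq

/-- The arrays. -/
inductive Arr : Type
  | deg | cell | pool | mate | mark | src | dst
  deriving DecidableEq

/-- Comparisons of two registers. -/
inductive Test : Type
  | lt (x y : Reg)
  | eq (x y : Reg)

/-- Programs. -/
inductive Cmd : Type
  /-- do nothing -/
  | skip
  /-- `x := c` -/
  | const (x : Reg) (c : ℕ)
  /-- `x := y` -/
  | move (x y : Reg)
  /-- `x := y + z` -/
  | plus (x y z : Reg)
  /-- `x := y - z`, or `0` if `y < z` -/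
  | minus (x y z : Reg)
  /-- `x := a[y]` -/
  | load (x : Reg) (a : Arr) (y : Reg)
  /-- `a[y] := z` -/
  | store (a : Arr) (y z : Reg)
  /-- `x :=` a uniformly random element of `{0, ..., y - 1}` -/
  | rand (x y : Reg)
  /-- first `c`, then `d` -/
  | seq (c d : Cmd)
  /-- if `b` then `c` else `d` -/
  | ite (b : Test) (c d : Cmd)
  /-- while `b` do `c` -/
  | while (b : Test) (c : Cmd)

/-- The contents of registers and arrays. -/
structure Mem : Type where
  reg : Reg → ℕ
  arr : Arr → ℕ → ℕ

/-- Overwrite one register. -/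
def Mem.setReg (s : Mem) (x : Reg) (c : ℕ) : Mem :=
  ⟨Function.update s.reg x c, s.arr⟩

/-- Overwrite one array cell. -/
def Mem.setArr (s : Mem) (a : Arr) (j c : ℕ) : Mem :=
  ⟨s.reg, Function.update s.arr a (Function.update (s.arr a) j c)⟩

/-- Evaluation of a comparison. -/
def Test.eval (s : Mem) : Test → Bool
  | .lt x y => decide (s.reg x < s.reg y)
  | .eq x y => decide (s.reg x = s.reg y)

/-- A state of the machine: the stack of commands that remain to be executed, and the memory.
The machine has halted when no command remains. -/
abbrev MachineState : Type := List Cmd × Mem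

/-- The uniform distribution on `{0, ..., N - 1}` (by convention, the constant `0` if `N = 0`). -/
noncomputable def uniformBelow (N : ℕ) : PMF ℕ :=
  if h : (Finset.range N).Nonempty then PMF.uniformOfFinset (Finset.range N) h else PMF.pure 0

/-- One unit of time of the machine with word length `w`. -/
noncomputable def step (w : ℕ) : MachineState → PMF MachineState
  | ([], s) => PMF.pure ([], s)
  | (.skip :: K, s) => PMF.pure (K, s)
  | (.const x c :: K, s) => PMF.pure (K, s.setReg x (c % 2 ^ w))
  | (.move x y :: K, s) => PMF.pure (K, s.setReg x (s.reg y))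
  | (.plus x y z :: K, s) => PMF.pure (K, s.setReg x ((s.reg y + s.reg z) % 2 ^ w))
  | (.minus x y z :: K, s) => PMF.pure (K, s.setReg x (s.reg y - s.reg z))
  | (.load x a y :: K, s) => PMF.pure (K, s.setReg x (s.arr a (s.reg y)))
  | (.store a y z :: K, s) => PMF.pure (K, s.setArr a (s.reg y) (s.reg z))
  | (.rand x y :: K, s) => (uniformBelow (s.reg y)).map fun c => (K, s.setReg x c)
  | (.seq c d :: K, s) => PMF.pure (c :: d :: K, s)
  | (.ite b c d :: K, s) => PMF.pure (if b.eval s then c :: K else d :: K, s)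
  | (.while b c :: K, s) => PMF.pure (if b.eval s then c :: .while b c :: K else K, s)

/-- The distribution of the state after `t` units of time. -/
noncomputable def runFor (w : ℕ) : ℕ → MachineState → PMF MachineState
  | 0, σ => PMF.pure σ
  | t + 1, σ => (step w σ).bind (runFor w t)

/-- The probability that `c`, started with memory `s`, halts with a final memory in `A`. -/
noncomputable def haltProb (w : ℕ) (c : Cmd) (s : Mem) (A : Set Mem) : ENNReal :=
  ⨆ t, (runFor w t ([c], s)).toOuterMeasure {σ | σ.1 = [] ∧ σ.2 ∈ A}

/-- The expectation `∑_{t ≥ 0} Pr(T > t)` of the time `T` at which `c`, started with memory `s`,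
halts. -/
noncomputable def expectedTime (w : ℕ) (c : Cmd) (s : Mem) : ENNReal :=
  ∑' t, (runFor w t ([c], s)).toOuterMeasure {σ | σ.1 ≠ []}

/-! ## The configuration model sampling algorithm -/

/-- Execute a list of commands in order. -/
def block : List Cmd → Cmd
  | [] => .skip
  | [c] => c
  | c :: d :: cs => .seq c (block (d :: cs))

/-- Number the points `0, ..., M - 1`, cell by cell, and record in `cell` the cell of each. -/
def setupCells : Cmd := block [
  .const .zero 0,
  .const .one 1,
  .const .M 0,
  .const .v 0,
  .while (.lt .v .n) (block [
    .load .d .deg .v,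
    .const .i 0,
    .while (.lt .i .d) (block [
      .store .cell .M .v,
      .plus .M .M .one,
      .plus .i .i .one]),
    .plus .v .v .one])]

/-- Choose a configuration: starting with all points unmatched (`pool[0], ..., pool[r - 1]` are the
unmatched points), repeatedly take an unmatched point `p` and pair it with a point `q` chosen
uniformly at random from the remaining unmatched points. The pairing is recorded in `mate`. -/
def choosePairing : Cmd := block [
  .const .p 0,
  .while (.lt .p .M) (block [
    .store .pool .p .p,
    .plus .p .p .one]),
  .move .r .M,
  .while (.lt .zero .r) (block [
    .minus .r .r .one,
    .load .p .pool .r,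
    .rand .i .r,
    .load .q .pool .i,
    .minus .r .r .one,
    .load .t .pool .r,
    .store .pool .i .t,
    .store .mate .p .q,
    .store .mate .q .p])]

/-- Test whether the multigraph of the chosen configuration is simple; `bad` becomes `1` if it is
not, and `0` if it is. When the points of cell `v` are inspected, `mark[u] = v + 1` records that
an edge from `v` to `u` has been seen already. -/
def checkSimple : Cmd := block [
  .const .bad 0,
  .const .p 0,
  .while (.lt .p .M) (block [
    .load .v .cell .p,
    .store .mark .v .zero,
    .plus .p .p .one]),
  .const .p 0,
  .while (.lt .p .M) (block [
    .load .v .cell .p,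
    .load .q .mate .p,
    .load .u .cell .q,
    .ite (.eq .u .v) (.const .bad 1) .skip,
    .plus .d .v .one,
    .load .t .mark .u,
    .ite (.eq .t .d) (.const .bad 1) .skip,
    .store .mark .u .d,
    .plus .p .p .one])]

/-- One round of the algorithm: choose a configuration `P` and test whether `G(P)` is simple. -/
def trial : Cmd := .seq choosePairing checkSimple

/-- Output the edges `src[e] dst[e]`, for `0 ≤ e < m`, of `G(P)`, one for each pair of `P`. -/
def writeEdges : Cmd := block [
  .const .m 0,
  .const .p 0,
  .while (.lt .p .M) (block [
    .load .q .mate .p,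
    .ite (.lt .p .q)
      (block [
        .load .u .cell .p,
        .load .v .cell .q,
        .store .src .m .u,
        .store .dst .m .v,
        .plus .m .m .one])
      .skip,
    .plus .p .p .one])]

/-- The configuration model sampling algorithm: repeat, choose `P` uniformly at random, until
`G(P)` is simple; output `G(P)`. -/
def configurationModel : Cmd := block [
  setupCells,
  .const .bad 1,
  .while (.eq .bad .one) trial,
  writeEdges]

/-- The initial memory: register `n` holds `n`, the array `deg` holds `k`, the rest is `0`. -/
def inputMem {n : ℕ} (k : Fin n → ℕ) : Mem where
  reg x := if x = .n then n else 0
  arr a j := if h : a = .deg ∧ j < n then k ⟨j, h.2⟩ else 0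

/-- The word length, in bits, used for inputs with `n` vertices; it is `O(log n)`. -/
def wordLength (n : ℕ) : ℕ := 4 * (Nat.log 2 n + 1)

/-- The multiset of edges that is listed in the output arrays. -/
def outputEdges (s : Mem) : Multiset (Sym2 ℕ) :=
  (Multiset.range (s.reg .m)).map fun e => s(s.arr .src e, s.arr .dst e)

open Classical in
/-- The edges of a graph, each with multiplicity one. -/
noncomputable def graphEdges {n : ℕ} (G : SimpleGraph (Fin n)) : Multiset (Sym2 ℕ) :=
  G.edgeFinset.val.map (Sym2.map Fin.val)

/-- The number of a point: points are numbered from `0`, cell by cell. -/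
def pointIndex {n : ℕ} {k : Fin n → ℕ} (x : Point k) : ℕ :=
  ∑ j ∈ Finset.Iio x.1, k j + x.2

/-- The memory `s` represents the configuration `P` in `mate`, and the cells of the points in
`cell`. -/
def Represents {n : ℕ} {k : Fin n → ℕ} (s : Mem) (P : Configuration k) : Prop :=
  ∀ x : Point k, s.arr .cell (pointIndex x) = x.1 ∧
    s.arr .mate (pointIndex x) = pointIndex (P.1 x)

/-- On input `k`, one round chooses a uniformly random configuration, and decides correctly
whether its multigraph is simple. -/
def RoundIsUniform {n : ℕ} (k : Fin n → ℕ) : Prop :=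
  ∀ P : Configuration k,
    haltProb (wordLength n) (.seq setupCells trial) (inputMem k)
        {s | Represents s P ∧ (P.IsSimple → s.reg .bad = 0) ∧ (¬ P.IsSimple → s.reg .bad = 1)} =
      1 / (Nat.card (Configuration k) : ENNReal)

/-- On input `k`, the output of the configuration model is a uniformly random element of `G(k)`. -/
def IsUniformSampler {n : ℕ} (k : Fin n → ℕ) : Prop :=
  ∀ G ∈ graphsWithDegrees k,
    haltProb (wordLength n) configurationModel (inputMem k) {s | outputEdges s = graphEdges G} =
      1 / ((graphsWithDegrees k).ncard : ENNReal)

/-- The expected runtime of the configuration model on input `k`. -/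
noncomputable def expectedRuntime {n : ℕ} (k : Fin n → ℕ) : ENNReal :=
  expectedTime (wordLength n) configurationModel (inputMem k)

open scoped ENNReal Nat

/-! Uniformity. Whichever unmatched point is taken, its partner is uniform among the others. So, by
induction, every completion of a partial pairing with `r` unmatched points is equally likely, with
probability `1 / (r - 1)‼` (`CostBound.pairing_loop`). A graph `G` in `G(k)` arises from exactly `∏
j, (k j)!` configurations, one for each family of bijections from the points of a cell to the
neighbours of its vertex (`card_realizes`). This number does not depend on `G`, so conditioning on
simplicity leaves the uniform distribution on `G(k)`.

Expected time. A round costs `O(M)`, so a constant lower bound for the probability of simplicity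
suffices (`exists_card_le_mul_card_isSimple`). As `γ > 3`, the sum of the squared degrees is at most
`B * M`, and the maximum degree `Δ` satisfies `20 * Δ ^ 2 ≤ n` for large `n`; bounded `n` are
treated crudely. By first moments and Markov's inequality, at least half of the configurations have
a bounded number of points in loops or repeated edges and weight `O(M)`. A switching exchanges a bad
point with a suitable other point and removes bad points without creating any. At least `M / 2`
switchings lead out of each such non-simple configuration, and `O(M)` lead into each target
(`Configuration.card_switch_le`). Boundedly many levels of switchings reach the simple
configurations, at the loss of a constant factor.

Comparison with `log |G(k)|`. The same bound gives `(M - 1)‼ ≤ A * |G(k)| * ∏ j, (k j)!`. The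
product of factorials is at most `exp (B * M)`, while the double factorial eventually exceeds every
exponential in `M`. Hence `M ≤ log |G(k)| + c` (`exists_degreeSum_le_log`), and the linear bound in
`M` becomes a polynomial one.

The program is analysed through functions on states that satisfy `CostBound`. Halting probability
and its complement are such functions with cost `0` per step, truncated running time with cost `1`.
One symbolic execution therefore yields all estimates, and upper bounds for an event and for its
complement that add up to `1` are equalities. -/

/-! ## Cost bounds -/

/-- The value of `F` at a running state is at most `r` plus the expected value of `F` one unit of
time later. -/
def CostBound (w : ℕ) (r : ℝ≥0∞) (F : MachineState → ℝ≥0∞) : Prop :=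
  ∀ c K s, F (c :: K, s) ≤ r + ∑' σ, step w (c :: K, s) σ * F σ

theorem PMF.tsum_pure_mul {α : Type*} (a : α) (F : α → ℝ≥0∞) :
    ∑' x, PMF.pure a x * F x = F a := by
  classical
  rw [tsum_eq_single a]
  · simp
  · intro b hb
    simp [PMF.pure_apply, hb]

theorem PMF.toOuterMeasure_le_one {α : Type*} (p : PMF α) (S : Set α) :
    p.toOuterMeasure S ≤ 1 :=
  (MeasureTheory.measure_mono (Set.subset_univ S)).trans
    ((PMF.toOuterMeasure_apply_eq_one_iff p _).2 (Set.subset_univ _)).le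

theorem PMF.tsum_bind_mul {α β : Type*} (p : PMF α) (f : α → PMF β) (F : β → ℝ≥0∞) :
    ∑' x, p.bind f x * F x = ∑' a, p a * ∑' x, f a x * F x := by
  simp_rw [PMF.bind_apply, ← ENNReal.tsum_mul_right, ← ENNReal.tsum_mul_left]
  rw [ENNReal.tsum_comm]
  simp_rw [mul_assoc]

theorem PMF.tsum_map_mul {α β : Type*} (p : PMF α) (f : α → β) (F : β → ℝ≥0∞) :
    ∑' x, p.map f x * F x = ∑' a, p a * F (f a) := by
  rw [PMF.map, PMF.tsum_bind_mul]
  simp_rw [Function.comp_apply, PMF.tsum_pure_mul]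

theorem tsum_uniformBelow_mul {N : ℕ} (hN : 0 < N) (F : ℕ → ℝ≥0∞) :
    ∑' c, uniformBelow N c * F c = (∑ c ∈ Finset.range N, F c) / N := by
  have h : (Finset.range N).Nonempty := by simpa using hN.ne'
  rw [uniformBelow, dif_pos h, tsum_eq_sum (s := Finset.range N)]
  · rw [div_eq_mul_inv, Finset.sum_mul]
    refine Finset.sum_congr rfl fun c hc => ?_
    rw [PMF.uniformOfFinset_apply_of_mem h hc, Finset.card_range, mul_comm]
  · intro b hb
    rw [PMF.uniformOfFinset_apply_of_notMem h hb, zero_mul]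

theorem CostBound.of_step_eq_pure {w : ℕ} {r : ℝ≥0∞} {F : MachineState → ℝ≥0∞}
    (hF : CostBound w r F) {c : Cmd} {K : List Cmd} {s : Mem} {σ : MachineState}
    (h : step w (c :: K, s) = PMF.pure σ) : F (c :: K, s) ≤ r + F σ := by
  have := hF c K s
  rwa [h, PMF.tsum_pure_mul] at this

theorem CostBound.rand {w : ℕ} {r : ℝ≥0∞} {F : MachineState → ℝ≥0∞}
    (hF : CostBound w r F) {x y : Reg} {K : List Cmd} {s : Mem} (hy : 0 < s.reg y) :
    F (.rand x y :: K, s) ≤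
      r + (∑ c ∈ Finset.range (s.reg y), F (K, s.setReg x c)) / (s.reg y : ℝ≥0∞) := by
  have := hF (.rand x y) K s
  rwa [step, PMF.tsum_map_mul, tsum_uniformBelow_mul hy] at this

/-! ## Halting probabilities and expected times as cost bounds -/

/-- The probability of having halted in `A` after `t` units of time. -/
noncomputable def haltedBy (w : ℕ) (A : Set Mem) (t : ℕ) (σ : MachineState) : ℝ≥0∞ :=
  (runFor w t σ).toOuterMeasure {σ | σ.1 = [] ∧ σ.2 ∈ A}

theorem haltedBy_succ (w : ℕ) (A : Set Mem) (t : ℕ) (σ : MachineState) :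
    haltedBy w A (t + 1) σ = ∑' τ, step w σ τ * haltedBy w A t τ := by
  simp only [haltedBy]
  rw [runFor, PMF.toOuterMeasure_bind_apply]

/-- Halted states are absorbing. -/
theorem haltedBy_mono (w : ℕ) (A : Set Mem) (σ : MachineState) :
    Monotone fun t => haltedBy w A t σ := by
  refine monotone_nat_of_le_succ fun t => ?_
  induction t generalizing σ with
  | zero =>
    obtain ⟨_ | ⟨c, K⟩, s⟩ := σ
    · rw [haltedBy_succ, step, PMF.tsum_pure_mul]
    · simp [haltedBy, runFor, PMF.toOuterMeasure_pure_apply]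
  | succ t ih =>
    rw [haltedBy_succ, haltedBy_succ w A (t + 1)]
    gcongr with τ
    exact ih τ

/-- The probability of eventually halting in `A`. -/
noncomputable def haltsIn (w : ℕ) (A : Set Mem) (σ : MachineState) : ℝ≥0∞ :=
  ⨆ t, haltedBy w A t σ

theorem haltProb_eq_haltsIn (w : ℕ) (c : Cmd) (s : Mem) (A : Set Mem) :
    haltProb w c s A = haltsIn w A ([c], s) := rfl

/-- First-step analysis; monotonicity in time allows the supremum to be taken inside the sum. -/
theorem haltsIn_eq_tsum (w : ℕ) (A : Set Mem) (σ : MachineState) :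
    haltsIn w A σ = ∑' τ, step w σ τ * haltsIn w A τ := by
  have h1 : haltsIn w A σ = ⨆ t, haltedBy w A (t + 1) σ :=
    ((haltedBy_mono w A σ).iSup_nat_add 1).symm
  simp_rw [h1, haltedBy_succ, haltsIn, ENNReal.mul_iSup, ENNReal.tsum_eq_iSup_sum]
  rw [iSup_comm]
  refine iSup_congr fun S => ?_
  rw [ENNReal.finsetSum_iSup_of_monotone]
  intro τ t t' h
  exact mul_le_mul_right (haltedBy_mono w A τ h) _

theorem haltsIn_le_one (w : ℕ) (A : Set Mem) (σ : MachineState) : haltsIn w A σ ≤ 1 :=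
  iSup_le fun _ => PMF.toOuterMeasure_le_one _ _

open Classical in
theorem haltsIn_nil (w : ℕ) (A : Set Mem) (s : Mem) :
    haltsIn w A ([], s) = if s ∈ A then 1 else 0 := by
  have h : ∀ t, haltedBy w A t ([], s) = if s ∈ A then 1 else 0 := by
    intro t
    induction t with
    | zero => simp [haltedBy, runFor, PMF.toOuterMeasure_pure_apply]
    | succ t ih => rw [haltedBy_succ, step, PMF.tsum_pure_mul, ih]
  simp_rw [haltsIn, h, ciSup_const]

theorem costBound_haltsIn (w : ℕ) (A : Set Mem) : CostBound w 0 (haltsIn w A) := by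
  intro c K s
  rw [zero_add, ← haltsIn_eq_tsum]

/-- Cost bounds give upper bounds only. Applied to the complement, they supply the lower bound for
the halting probability. -/
theorem costBound_one_sub_haltsIn (w : ℕ) (A : Set Mem) :
    CostBound w 0 fun σ => 1 - haltsIn w A σ := by
  intro c K s
  simp only
  rw [zero_add, haltsIn_eq_tsum]
  refine tsub_le_iff_right.2 ?_
  rw [← ENNReal.tsum_add]
  simp_rw [← mul_add]
  have : ∀ τ, 1 - haltsIn w A τ + haltsIn w A τ = 1 := fun τ =>
    tsub_add_cancel_of_le (haltsIn_le_one w A τ)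
  simp [this, PMF.tsum_coe]

/-- The expected number of the first `N` units of time during which the machine runs. -/
noncomputable def timeUpTo (w : ℕ) (N : ℕ) (σ : MachineState) : ℝ≥0∞ :=
  ∑ t ∈ Finset.range N, (runFor w t σ).toOuterMeasure {σ | σ.1 ≠ []}

theorem expectedTime_eq_iSup (w : ℕ) (c : Cmd) (s : Mem) :
    expectedTime w c s = ⨆ N, timeUpTo w N ([c], s) :=
  ENNReal.tsum_eq_iSup_nat

/-- Time is truncated for the sake of this finite bound, without which the inequality for the
rejection loop could not be solved. -/
theorem timeUpTo_le (w : ℕ) (N : ℕ) (σ : MachineState) : timeUpTo w N σ ≤ N := by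
  refine (Finset.sum_le_sum fun t _ => PMF.toOuterMeasure_le_one _ _).trans ?_
  simp

theorem timeUpTo_nil (w : ℕ) (N : ℕ) (s : Mem) : timeUpTo w N ([], s) = 0 := by
  have h : ∀ t, runFor w t ([], s) = PMF.pure ([], s) := by
    intro t
    induction t with
    | zero => rfl
    | succ t ih => rw [runFor, step, PMF.pure_bind, ih]
  simp [timeUpTo, h, PMF.toOuterMeasure_pure_apply]

/-- The present step contributes at most `1`. Raising the horizon to `N + 1` first leaves exactly
`N` units for the remaining run. -/
theorem costBound_timeUpTo (w : ℕ) (N : ℕ) : CostBound w 1 (timeUpTo w N) := by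
  intro c K s
  have h1 : timeUpTo w N (c :: K, s) ≤ timeUpTo w (N + 1) (c :: K, s) :=
    Finset.sum_le_sum_of_subset (Finset.range_mono N.le_succ)
  refine h1.trans ?_
  rw [timeUpTo, Finset.sum_range_succ', add_comm]
  refine add_le_add (PMF.toOuterMeasure_le_one _ _) (le_of_eq ?_)
  simp_rw [timeUpTo, Finset.mul_sum]
  rw [Summable.tsum_finsetSum (fun _ _ => ENNReal.summable)]
  refine Finset.sum_congr rfl fun t _ => ?_
  rw [runFor, PMF.toOuterMeasure_bind_apply]

/-! ## Deterministic commands -/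

/-- Started in `s`, the command `c` halts within `t` units of time with memory `s'`. -/
def Exec (w : ℕ) (c : Cmd) (s : Mem) (t : ℕ) (s' : Mem) : Prop :=
  ∀ r F, CostBound w r F → ∀ K, F (c :: K, s) ≤ r * t + F (K, s')

theorem Exec.mono {w : ℕ} {c : Cmd} {s s' : Mem} {t t' : ℕ} (h : Exec w c s t s') (ht : t ≤ t') :
    Exec w c s t' s' := by
  intro r F hF K
  refine (h r F hF K).trans ?_
  gcongr

theorem Exec.of_step {w : ℕ} {c : Cmd} {s s' : Mem}
    (h : ∀ K, step w (c :: K, s) = PMF.pure (K, s')) : Exec w c s 1 s' := by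
  intro r F hF K
  simpa using hF.of_step_eq_pure (h K)

theorem Exec.seq {w : ℕ} {c d : Cmd} {s s' s'' : Mem} {t t' : ℕ} (h : Exec w c s t s')
    (h' : Exec w d s' t' s'') : Exec w (.seq c d) s (t + t' + 1) s'' := by
  intro r F hF K
  calc F (.seq c d :: K, s) ≤ r + F (c :: d :: K, s) := hF.of_step_eq_pure (by rw [step])
    _ ≤ r + (r * t + (r * t' + F (K, s''))) := by
      gcongr
      exact (h r F hF _).trans (by gcongr; exact h' r F hF _)
    _ = _ := by push_cast; ring

theorem Exec.ite {w : ℕ} {b : Test} {c d : Cmd} {s s' : Mem} {t : ℕ}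
    (h : Exec w (if b.eval s then c else d) s t s') : Exec w (.ite b c d) s (t + 1) s' := by
  intro r F hF K
  calc F (.ite b c d :: K, s) ≤ r + F (if b.eval s then c :: K else d :: K, s) :=
      hF.of_step_eq_pure (by rw [step])
    _ = r + F ((if b.eval s then c else d) :: K, s) := by split_ifs <;> rfl
    _ ≤ r + (r * t + F (K, s')) := by gcongr; exact h r F hF K
    _ = _ := by push_cast; ring

theorem Exec.while_false {w : ℕ} {b : Test} {c : Cmd} {s : Mem} (h : b.eval s = false) :
    Exec w (.while b c) s 1 s :=
  Exec.of_step fun K => by simp [step, h]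

theorem Exec.while_true {w : ℕ} {b : Test} {c : Cmd} {s s' s'' : Mem} {t t' : ℕ}
    (h : b.eval s = true) (hc : Exec w c s t s') (hw : Exec w (.while b c) s' t' s'') :
    Exec w (.while b c) s (t + t' + 1) s'' := by
  intro r F hF K
  calc F (.while b c :: K, s) ≤ r + F (c :: .while b c :: K, s) :=
      hF.of_step_eq_pure (by simp [step, h])
    _ ≤ r + (r * t + (r * t' + F (K, s''))) := by
      gcongr
      exact (hc r F hF _).trans (by gcongr; exact hw r F hF _)
    _ = _ := by push_cast; ring

/-- A counting loop: the invariant `I j` holds after `j` of the `m` iterations, and the iteration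
with number `j` takes time at most `τ j`. -/
theorem Exec.while_count {w : ℕ} {b : Test} {c : Cmd} (m : ℕ) (τ : ℕ → ℕ) (I : ℕ → Mem → Prop)
    (hstep : ∀ j < m, ∀ s, I j s → b.eval s = true ∧ ∃ s', Exec w c s (τ j) s' ∧ I (j + 1) s')
    (hend : ∀ s, I m s → b.eval s = false) {s : Mem} (h0 : I 0 s) :
    ∃ s', Exec w (.while b c) s (∑ j ∈ Finset.range m, (τ j + 1) + 1) s' ∧ I m s' := by
  have key : ∀ d j s, j + d = m → I j s →
      ∃ s', Exec w (.while b c) s (∑ i ∈ Finset.Ico j m, (τ i + 1) + 1) s' ∧ I m s' := by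
    intro d
    induction d with
    | zero =>
      intro j s hj hI
      obtain rfl : j = m := by omega
      exact ⟨s, (Exec.while_false (hend s hI)).mono (by omega), hI⟩
    | succ d ih =>
      intro j s hj hI
      obtain ⟨hb, s', hs', hI'⟩ := hstep j (by omega) s hI
      obtain ⟨s'', hs'', hI''⟩ := ih (j + 1) s' (by omega) hI'
      refine ⟨s'', (Exec.while_true hb hs' hs'').mono ?_, hI''⟩
      rw [Finset.sum_eq_sum_Ico_succ_bot (show j < m by omega)]
      omega
  obtain ⟨s', h1, h2⟩ := key m 0 s (by omega) h0
  refine ⟨s', ?_, h2⟩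
  rwa [Finset.range_eq_Ico]

/-- Commands without loops and without randomness. -/
def Cmd.Straight : Cmd → Prop
  | .rand _ _ => False
  | .while _ _ => False
  | .seq c d => c.Straight ∧ d.Straight
  | .ite _ c d => c.Straight ∧ d.Straight
  | _ => True

/-- The effect of a command without loops and without randomness. -/
def Cmd.eval (w : ℕ) : Cmd → Mem → Mem
  | .const x c, s => s.setReg x (c % 2 ^ w)
  | .move x y, s => s.setReg x (s.reg y)
  | .plus x y z, s => s.setReg x ((s.reg y + s.reg z) % 2 ^ w)
  | .minus x y z, s => s.setReg x (s.reg y - s.reg z)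
  | .load x a y, s => s.setReg x (s.arr a (s.reg y))
  | .store a y z, s => s.setArr a (s.reg y) (s.reg z)
  | .seq c d, s => d.eval w (c.eval w s)
  | .ite b c d, s => if b.eval s then c.eval w s else d.eval w s
  | _, s => s

/-- A bound on the running time of a command without loops. -/
def Cmd.cost : Cmd → ℕ
  | .seq c d => c.cost + d.cost + 1
  | .ite _ c d => c.cost + d.cost + 1
  | _ => 1

/-- Loop bodies are thereby run by symbolic evaluation, and preservation of an invariant becomes a
computation. -/
theorem Exec.of_straight (w : ℕ) {c : Cmd} (hc : c.Straight) (s : Mem) :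
    Exec w c s c.cost (c.eval w s) := by
  induction c generalizing s with
  | seq c d ihc ihd => exact (ihc hc.1 s).seq (ihd hc.2 _)
  | ite b c d ihc ihd =>
    refine (Exec.ite (t := c.cost + d.cost) (s' := (Cmd.ite b c d).eval w s) ?_)
    rw [Cmd.eval]
    split_ifs
    · exact (ihc hc.1 s).mono (by omega)
    · exact (ihd hc.2 s).mono (by omega)
  | _ =>
    first
    | exact (hc : False).elim
    | exact Exec.of_step fun K => by rw [step]; rfl

/-! ## The numbering of the points -/

section Numbering

variable {n : ℕ} {k : Fin n → ℕ}

/-- The number of points in the cells before `v`. -/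
def pointsBefore (k : Fin n → ℕ) (v : ℕ) : ℕ := ∑ j with j.val < v, k j

theorem pointsBefore_zero (k : Fin n → ℕ) : pointsBefore k 0 = 0 := by
  simp [pointsBefore]

theorem pointsBefore_succ (k : Fin n → ℕ) (v : Fin n) :
    pointsBefore k (v + 1) = pointsBefore k v + k v := by
  have h : (Finset.univ.filter fun j : Fin n => j.val < v.val + 1) =
      insert v (Finset.univ.filter fun j : Fin n => j.val < v.val) := by
    ext j
    simp only [Finset.mem_filter, Finset.mem_univ, true_and, Finset.mem_insert, Fin.ext_iff]
    omega
  rw [pointsBefore, h, Finset.sum_insert (by simp), add_comm, pointsBefore]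

theorem pointsBefore_mono (k : Fin n → ℕ) : Monotone (pointsBefore k) := by
  intro a b h
  refine Finset.sum_le_sum_of_subset fun j => ?_
  simp only [Finset.mem_filter, Finset.mem_univ, true_and]
  omega

theorem pointsBefore_eq_degreeSum (k : Fin n → ℕ) : pointsBefore k n = degreeSum k := by
  simp [pointsBefore, degreeSum]

theorem pointIndex_eq (x : Point k) : pointIndex x = pointsBefore k x.1 + x.2 := by
  rw [pointIndex, pointsBefore]
  congr 2
  ext j
  simp

theorem pointIndex_lt_pointsBefore_succ (x : Point k) :
    pointIndex x < pointsBefore k (x.1 + 1) := by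
  rw [pointIndex_eq, pointsBefore_succ]
  have := x.2.2
  omega

theorem pointsBefore_le_pointIndex (x : Point k) : pointsBefore k x.1 ≤ pointIndex x := by
  rw [pointIndex_eq]
  omega

theorem pointIndex_lt (x : Point k) : pointIndex x < degreeSum k := by
  rw [← pointsBefore_eq_degreeSum]
  exact (pointIndex_lt_pointsBefore_succ x).trans_le (pointsBefore_mono k x.1.2)

theorem fst_le_of_pointIndex_le {x y : Point k} (h : pointIndex x ≤ pointIndex y) :
    x.1 ≤ y.1 := by
  by_contra! hlt
  have h1 := pointIndex_lt_pointsBefore_succ y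
  have h2 := pointsBefore_le_pointIndex x
  have h3 : pointsBefore k (y.1 + 1) ≤ pointsBefore k x.1 := pointsBefore_mono k hlt
  omega

theorem pointIndex_injective : Function.Injective (pointIndex (k := k)) := by
  intro x y h
  have h1 : x.1 = y.1 := le_antisymm (fst_le_of_pointIndex_le h.le) (fst_le_of_pointIndex_le h.ge)
  obtain ⟨u, i⟩ := x
  obtain ⟨v, j⟩ := y
  obtain rfl : u = v := h1
  rw [pointIndex_eq, pointIndex_eq] at h
  simp only [add_right_inj] at h
  rw [Fin.ext h]

theorem card_point (k : Fin n → ℕ) : Fintype.card (Point k) = degreeSum k := by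
  simp [degreeSum]

theorem exists_pointIndex_eq {p : ℕ} (hp : p < degreeSum k) : ∃ x : Point k, pointIndex x = p := by
  have hb : Function.Bijective fun x : Point k => (⟨pointIndex x, pointIndex_lt x⟩ :
      Fin (degreeSum k)) := by
    rw [Fintype.bijective_iff_injective_and_card]
    refine ⟨fun x y h => pointIndex_injective (Fin.ext_iff.1 h), ?_⟩
    rw [card_point, Fintype.card_fin]
  obtain ⟨x, hx⟩ := hb.2 ⟨p, hp⟩
  exact ⟨x, Fin.ext_iff.1 hx⟩

theorem pointIndex_inj {x y : Point k} : pointIndex x = pointIndex y ↔ x = y :=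
  pointIndex_injective.eq_iff

/-! ## Numbering the points by the machine -/

/-- The points have been numbered. -/
structure Ready (k : Fin n → ℕ) (s : Mem) : Prop where
  zero : s.reg .zero = 0
  one : s.reg .one = 1
  sum : s.reg .M = degreeSum k
  cell : ∀ x : Point k, s.arr .cell (pointIndex x) = x.1

/-- The invariant of the loops of `setupCells`. -/
structure SetupInv (k : Fin n → ℕ) (v m : ℕ) (s : Mem) : Prop where
  zero : s.reg .zero = 0
  one : s.reg .one = 1
  size : s.reg .n = n
  v : s.reg .v = v
  sum : s.reg .M = m
  deg : ∀ j : Fin n, s.arr .deg j = k j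
  cell : ∀ x : Point k, pointIndex x < m → s.arr .cell (pointIndex x) = x.1

theorem exec_setupCells_body {w : ℕ} (hn : n < 2 ^ w) (hM : degreeSum k < 2 ^ w)
    (v : Fin n) {s : Mem} (hs : SetupInv k v (pointsBefore k v) s) :
    ∃ s', Exec w (block [.load .d .deg .v, .const .i 0, .while (.lt .i .d) (block [
      .store .cell .M .v, .plus .M .M .one, .plus .i .i .one]), .plus .v .v .one]) s
      (6 * k v + 7) s' ∧
      SetupInv k (v + 1) (pointsBefore k (v + 1)) s' := by
  -- Together with `hM`, this keeps the sums of the inner loop from wrapping around.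
  have hkM : pointsBefore k v + k v ≤ degreeSum k := by
    rw [← pointsBefore_succ, ← pointsBefore_eq_degreeSum]
    exact pointsBefore_mono k v.2
  let s₁ := (Cmd.const .i 0).eval w ((Cmd.load .d .deg .v).eval w s)
  obtain ⟨s₂, h₂, hs₂, hd, hi⟩ := Exec.while_count (w := w) (b := .lt .i .d)
    (c := block [.store .cell .M .v, .plus .M .M .one, .plus .i .i .one]) (k v) (fun _ => 5)
    (fun i s => SetupInv k v (pointsBefore k v + i) s ∧ s.reg .d = k v ∧ s.reg .i = i)
    (fun i hi s ⟨hs, hd, hsi⟩ => by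
      refine ⟨by simpa [Test.eval, hd, hsi] using hi, _,
        Exec.of_straight w (by simp [block, Cmd.Straight]) s, ⟨?_, ?_, ?_, ?_, ?_, ?_, ?_⟩, ?_, ?_⟩
      · simp [block, Cmd.eval, Mem.setReg, Mem.setArr, hs.zero]
      · simp [block, Cmd.eval, Mem.setReg, Mem.setArr, hs.one]
      · simp [block, Cmd.eval, Mem.setReg, Mem.setArr, hs.size]
      · simp [block, Cmd.eval, Mem.setReg, Mem.setArr, hs.v]
      · simp [block, Cmd.eval, Mem.setReg, Mem.setArr, hs.sum, hs.one]
        rw [Nat.mod_eq_of_lt (by omega), add_assoc]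
      · simp [block, Cmd.eval, Mem.setReg, Mem.setArr, hs.deg]
      · intro x hx
        simp only [block, Cmd.eval, Mem.setReg, Mem.setArr, hs.sum, hs.v, Function.update_self]
        rw [Function.update_apply]
        split_ifs with h
        · have : x = ⟨v, ⟨i, hi⟩⟩ := by
            rw [← pointIndex_inj, h, pointIndex_eq]
          rw [this]
        · exact hs.cell x (by omega)
      · simp [block, Cmd.eval, Mem.setReg, Mem.setArr, hd]
      · simp [block, Cmd.eval, Mem.setReg, Mem.setArr, hsi, hs.one]
        rw [Nat.mod_eq_of_lt (by omega)])
    (fun s ⟨_, hd, hsi⟩ => by simp [Test.eval, hd, hsi])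
    (s := s₁)
    (by
      refine ⟨⟨?_, ?_, ?_, ?_, ?_, ?_, ?_⟩, ?_, ?_⟩
      · simp [s₁, Cmd.eval, Mem.setReg, hs.zero]
      · simp [s₁, Cmd.eval, Mem.setReg, hs.one]
      · simp [s₁, Cmd.eval, Mem.setReg, hs.size]
      · simp [s₁, Cmd.eval, Mem.setReg, hs.v]
      · simp [s₁, Cmd.eval, Mem.setReg, hs.sum]
      · simp [s₁, Cmd.eval, Mem.setReg, hs.deg]
      · intro x hx
        simpa [s₁, Cmd.eval, Mem.setReg] using hs.cell x hx
      · simp [s₁, Cmd.eval, Mem.setReg, hs.v, hs.deg]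
      · simp [s₁, Cmd.eval, Mem.setReg])
  refine ⟨_, ((Exec.of_straight w (by simp [Cmd.Straight]) s).seq
    ((Exec.of_straight w (by simp [Cmd.Straight]) _).seq
    (h₂.seq (Exec.of_straight w (by simp [block, Cmd.Straight]) s₂)))).mono ?_, ?_⟩
  · simp [block, Cmd.cost]
    omega
  · rw [pointsBefore_succ]
    refine ⟨?_, ?_, ?_, ?_, ?_, ?_, ?_⟩
    · simp [block, Cmd.eval, Mem.setReg, hs₂.zero]
    · simp [block, Cmd.eval, Mem.setReg, hs₂.one]
    · simp [block, Cmd.eval, Mem.setReg, hs₂.size]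
    · simp [block, Cmd.eval, Mem.setReg, hs₂.v, hs₂.one]
      exact Nat.mod_eq_of_lt (by omega)
    · simp [block, Cmd.eval, Mem.setReg, hs₂.sum]
    · simp [block, Cmd.eval, Mem.setReg, hs₂.deg]
    · intro x hx
      simpa [block, Cmd.eval, Mem.setReg] using hs₂.cell x hx

theorem exec_setupCells {w : ℕ} (hw : 1 < 2 ^ w) (hn : n < 2 ^ w) (hM : degreeSum k < 2 ^ w) :
    ∃ s', Exec w setupCells (inputMem k) (8 * n + 6 * degreeSum k + 9) s' ∧ Ready k s' := by
  let c : Cmd := .seq (.const .zero 0) (.seq (.const .one 1) (.seq (.const .M 0) (.const .v 0)))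
  obtain ⟨s₂, h₂, hs₂⟩ := Exec.while_count (w := w) (b := .lt .v .n)
    (c := block [.load .d .deg .v, .const .i 0, .while (.lt .i .d) (block [
      .store .cell .M .v, .plus .M .M .one, .plus .i .i .one]), .plus .v .v .one])
    n (fun v => if h : v < n then 6 * k ⟨v, h⟩ + 7 else 0)
    (fun v s => SetupInv k v (pointsBefore k v) s)
    (fun v hv s hs => by
      refine ⟨by simpa [Test.eval, hs.v, hs.size] using hv, ?_⟩
      simp only [hv, dif_pos]
      exact exec_setupCells_body hn hM ⟨v, hv⟩ hs)
    (fun s hs => by simp [Test.eval, hs.v, hs.size]) (s := c.eval w (inputMem k))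
    (by
      rw [pointsBefore_zero]
      refine ⟨?_, ?_, ?_, ?_, ?_, ?_, ?_⟩
      · simp [c, Cmd.eval, Mem.setReg]
      · simp [c, Cmd.eval, Mem.setReg, Nat.mod_eq_of_lt hw]
      · simp [c, Cmd.eval, Mem.setReg, inputMem]
      · simp [c, Cmd.eval, Mem.setReg]
      · simp [c, Cmd.eval, Mem.setReg]
      · simp [c, Cmd.eval, Mem.setReg, inputMem]
      · intro x hx
        omega)
  rw [pointsBefore_eq_degreeSum] at hs₂
  refine ⟨s₂, ((Exec.of_straight w (by simp [Cmd.Straight]) _).seq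
    ((Exec.of_straight w (by simp [Cmd.Straight]) _).seq
    ((Exec.of_straight w (by simp [Cmd.Straight]) _).seq
    ((Exec.of_straight w (by simp [Cmd.Straight]) _).seq h₂)))).mono ?_,
    ⟨hs₂.zero, hs₂.one, hs₂.sum, fun x => hs₂.cell x (pointIndex_lt x)⟩⟩
  have : ∑ v ∈ Finset.range n, ((if h : v < n then 6 * k ⟨v, h⟩ + 7 else 0) + 1) =
      8 * n + 6 * degreeSum k := by
    rw [Finset.sum_range]
    simp only [Fin.is_lt, dif_pos]
    rw [degreeSum, Finset.mul_sum]
    simp [Finset.sum_add_distrib]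
    ring
  rw [this]
  simp [Cmd.cost]
  omega

end Numbering

/-! ### Random pairing: completions of a partial pairing are equally likely -/

section Pairing

variable {n : ℕ} {k : Fin n → ℕ}

/-! ## Configurations that extend a partial pairing -/

instance : Finite (Configuration k) := Subtype.finite

noncomputable instance : Fintype (Configuration k) := Fintype.ofFinite _

namespace Configuration

theorem apply_apply (P : Configuration k) (x : Point k) : P.1 (P.1 x) = x := (P.2 x).1

theorem apply_ne (P : Configuration k) (x : Point k) : P.1 x ≠ x := (P.2 x).2

theorem apply_eq_iff (P : Configuration k) {x y : Point k} : P.1 x = y ↔ x = P.1 y :=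
  ⟨fun h => by rw [← h, P.apply_apply], fun h => by rw [h, P.apply_apply]⟩

theorem apply_injective (P : Configuration k) : Function.Injective P.1 := fun x y h => by
  rw [← P.apply_apply x, h, P.apply_apply]

theorem ext {P Q : Configuration k} (h : ∀ x, P.1 x = Q.1 x) : P = Q :=
  Subtype.ext (funext h)

/-- Exchange the points `b` and `c` in a configuration. -/
def exchange (b c : Point k) (P : Configuration k) : Configuration k :=
  ⟨fun x => Equiv.swap b c (P.1 (Equiv.swap b c x)), fun x => by
    refine ⟨by simp [P.apply_apply], fun h => P.apply_ne (Equiv.swap b c x) ?_⟩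
    simpa using congrArg (Equiv.swap b c) h⟩

theorem exchange_apply (b c : Point k) (P : Configuration k) (x : Point k) :
    (P.exchange b c).1 x = Equiv.swap b c (P.1 (Equiv.swap b c x)) := rfl

theorem exchange_exchange (b c : Point k) (P : Configuration k) :
    (P.exchange b c).exchange b c = P :=
  ext fun x => by simp [exchange_apply]

end Configuration

open Classical in
/-- The configurations that agree with `Q` outside `U`. -/
noncomputable def agreeOutside (U : Finset (Point k)) (Q : Configuration k) :
    Finset (Configuration k) :=
  {P | ∀ x ∉ U, P.1 x = Q.1 x}

theorem mem_agreeOutside {U : Finset (Point k)} {P Q : Configuration k} :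
    P ∈ agreeOutside U Q ↔ ∀ x ∉ U, P.1 x = Q.1 x := by
  simp [agreeOutside]

theorem exchange_apply_left {Q : Configuration k} {p q : Point k} (h : q ≠ p) :
    (Q.exchange (Q.1 p) q).1 p = q := by
  rw [Configuration.exchange_apply,
    Equiv.swap_apply_of_ne_of_ne (Q.apply_ne p).symm h.symm, Equiv.swap_apply_left]

theorem exchange_apply_right {Q : Configuration k} {p q : Point k} (h : q ≠ p) :
    (Q.exchange (Q.1 p) q).1 q = p := by
  rw [Configuration.apply_eq_iff, exchange_apply_left h]

/-- As `U` is closed under `Q`, the only points whose partners can change, namely `p`, `Q p`, `q`,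
`Q q`, all lie in `U`. -/
theorem exchange_apply_of_notMem {U : Finset (Point k)} {Q : Configuration k}
    (hQ : ∀ x ∈ U, Q.1 x ∈ U) {p q x : Point k} (hp : p ∈ U) (hq : q ∈ U) (hx : x ∉ U) :
    (Q.exchange (Q.1 p) q).1 x = Q.1 x := by
  have hx' : Q.1 x ∉ U := fun h => hx (by simpa [Q.apply_apply] using hQ _ h)
  have h1 : x ≠ Q.1 p := fun h => hx (h ▸ hQ p hp)
  have h2 : x ≠ q := fun h => hx (h ▸ hq)
  have h3 : Q.1 x ≠ Q.1 p := fun h => hx' (h ▸ hQ p hp)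
  have h4 : Q.1 x ≠ q := fun h => hx' (h ▸ hq)
  rw [Configuration.exchange_apply, Equiv.swap_apply_of_ne_of_ne h1 h2,
    Equiv.swap_apply_of_ne_of_ne h3 h4]

theorem exchange_mapsTo {U : Finset (Point k)} {Q : Configuration k}
    (hQ : ∀ x ∈ U, Q.1 x ∈ U) {p q : Point k} (hp : p ∈ U) (hq : q ∈ U) (hpq : q ≠ p) :
    ∀ x ∈ (U.erase p).erase q,
      (Q.exchange (Q.1 p) q).1 x ∈ (U.erase p).erase q := by
  intro x hx
  simp only [Finset.mem_erase] at hx ⊢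
  refine ⟨fun h => ?_, fun h => ?_, ?_⟩
  · rw [Configuration.apply_eq_iff, exchange_apply_right hpq] at h
    exact hx.2.1 h
  · rw [Configuration.apply_eq_iff, exchange_apply_left hpq] at h
    exact hx.1 h
  · by_contra hU
    have h := exchange_apply_of_notMem hQ hp hq hU
    rw [Configuration.apply_apply] at h
    exact hU (Q.apply_eq_iff.2 h ▸ hQ x hx.2.2)

/-- Completions are classified by the partner `q` of `p`. A partial pairing is stored as a full
configuration `Q` whose values on `U` are placeholders; fixing the pair `{p, q}` amounts to
exchanging `q` with the placeholder partner of `p`. -/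
theorem agreeOutside_eq_biUnion [DecidableEq (Configuration k)] {U : Finset (Point k)}
    {Q : Configuration k} (hQ : ∀ x ∈ U, Q.1 x ∈ U) {p : Point k} (hp : p ∈ U) :
    agreeOutside U Q = (U.erase p).biUnion fun q =>
      agreeOutside ((U.erase p).erase q) (Q.exchange (Q.1 p) q) := by
  ext P
  simp only [Finset.mem_biUnion, mem_agreeOutside]
  constructor
  · intro h
    have hPU : ∀ x ∈ U, P.1 x ∈ U := by
      intro x hx
      by_contra hU
      have h' := h _ hU
      rw [P.apply_apply, eq_comm, Configuration.apply_eq_iff] at h'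
      exact hU (h' ▸ hQ x hx)
    have hqp := P.apply_ne p
    refine ⟨P.1 p, Finset.mem_erase.2 ⟨hqp, hPU p hp⟩, fun x hx => ?_⟩
    by_cases hxU : x ∈ U
    · obtain rfl | rfl : x = P.1 p ∨ x = p := by
        simp only [Finset.mem_erase] at hx
        tauto
      · rw [P.apply_apply, exchange_apply_right hqp]
      · rw [exchange_apply_left hqp]
    · rw [exchange_apply_of_notMem hQ hp (hPU p hp) hxU, h x hxU]
  · rintro ⟨q, hq, h⟩ x hx
    rw [h x (by simp [hx]), exchange_apply_of_notMem hQ hp (Finset.mem_of_mem_erase hq) hx]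

theorem agreeOutside_disjoint {U : Finset (Point k)} {Q : Configuration k} {p : Point k} :
    Set.PairwiseDisjoint (U.erase p : Set (Point k)) fun q =>
      agreeOutside ((U.erase p).erase q) (Q.exchange (Q.1 p) q) := by
  intro q hq q' hq' hne
  refine Finset.disjoint_left.2 fun P hP hP' => hne ?_
  have h1 := mem_agreeOutside.1 hP p (by simp)
  have h2 := mem_agreeOutside.1 hP' p (by simp)
  rw [exchange_apply_left (Finset.ne_of_mem_erase hq)] at h1
  rw [exchange_apply_left (Finset.ne_of_mem_erase hq')] at h2
  rw [← h1, h2]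

/-- Rules out a pool with a single point, from which no partner could be drawn. -/
theorem two_le_card {U : Finset (Point k)} {Q : Configuration k}
    (hQ : ∀ x ∈ U, Q.1 x ∈ U) {p : Point k} (hp : p ∈ U) : 2 ≤ U.card :=
  Finset.one_lt_card.2 ⟨p, hp, Q.1 p, hQ p hp, (Q.apply_ne p).symm⟩

theorem sum_agreeOutside {A : Type*} [AddCommMonoid A] {U : Finset (Point k)}
    {Q : Configuration k} (hQ : ∀ x ∈ U, Q.1 x ∈ U) {p : Point k} (hp : p ∈ U)
    (Φ : Configuration k → A) :
    ∑ P ∈ agreeOutside U Q, Φ P = ∑ q ∈ U.erase p,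
      ∑ P ∈ agreeOutside ((U.erase p).erase q) (Q.exchange (Q.1 p) q), Φ P := by
  classical
  rw [agreeOutside_eq_biUnion hQ hp, Finset.sum_biUnion agreeOutside_disjoint]

theorem doubleFactorial_sub_one {m : ℕ} (hm : 2 ≤ m) :
    (m - 1)‼ = (m - 1) * (m - 2 - 1)‼ := by
  obtain ⟨m, rfl⟩ := Nat.exists_eq_add_of_le hm
  cases m with
  | zero => rfl
  | succ m => rw [show 2 + (m + 1) - 1 = m + 2 by omega, Nat.doubleFactorial_add_two,
      show 2 + (m + 1) - 2 - 1 = m by omega]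

theorem agreeOutside_empty (Q : Configuration k) : agreeOutside ∅ Q = {Q} := by
  ext P
  simp only [mem_agreeOutside, Finset.mem_singleton]
  exact ⟨fun h => Configuration.ext fun x => h x (by simp), fun h x _ => by rw [h]⟩

theorem card_agreeOutside (m : ℕ) {U : Finset (Point k)} {Q : Configuration k}
    (hQ : ∀ x ∈ U, Q.1 x ∈ U) (hm : U.card = m) :
    (agreeOutside U Q).card = (m - 1)‼ := by
  induction m using Nat.strong_induction_on generalizing U Q with
  | _ m ih =>
    rcases U.eq_empty_or_nonempty with rfl | ⟨p, hp⟩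
    · obtain rfl : m = 0 := by simpa using hm.symm
      simp [agreeOutside_empty]
    · have h2 := two_le_card hQ hp
      rw [Finset.card_eq_sum_ones, sum_agreeOutside hQ hp]
      simp_rw [← Finset.card_eq_sum_ones]
      rw [Finset.sum_congr rfl fun q hq => ih (m - 2) (by omega)
        (exchange_mapsTo hQ hp (Finset.mem_of_mem_erase hq) (Finset.ne_of_mem_erase hq))
        (by rw [Finset.card_erase_of_mem hq, Finset.card_erase_of_mem hp]; omega)]
      rw [Finset.sum_const, Finset.card_erase_of_mem hp, hm, smul_eq_mul,
        ← doubleFactorial_sub_one (hm ▸ h2)]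

theorem agreeOutside_univ (Q : Configuration k) : agreeOutside Finset.univ Q = Finset.univ := by
  ext P
  simp [mem_agreeOutside]

theorem card_configuration (Q : Configuration k) :
    Fintype.card (Configuration k) = (degreeSum k - 1)‼ := by
  rw [← card_agreeOutside (degreeSum k) (U := Finset.univ) (Q := Q) (by simp)
    (by rw [Finset.card_univ, card_point]), agreeOutside_univ, Finset.card_univ]

/-! ## Choosing a random configuration -/

/-- The invariant of the main loop of `choosePairing`: the unmatched points are
`l 0, ..., l (r - 1)`, and the other points are matched as in `Q`. -/
structure PoolInv (k : Fin n → ℕ) (l : ℕ → Point k) (r : ℕ) (Q : Configuration k) (s : Mem) :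
    Prop where
  ready : Ready k s
  size : s.reg .r = r
  pool : ∀ i < r, s.arr .pool i = pointIndex (l i)
  injOn : Set.InjOn l (Finset.range r)
  mapsTo : ∀ x ∈ (Finset.range r).image l, Q.1 x ∈ (Finset.range r).image l
  mate : ∀ x ∉ (Finset.range r).image l, s.arr .mate (pointIndex x) = pointIndex (Q.1 x)

/-- The body of the main loop of `choosePairing`, after the random choice. -/
def pairChosen : Cmd := block [
  .load .q .pool .i,
  .minus .r .r .one,
  .load .t .pool .r,
  .store .pool .i .t,
  .store .mate .p .q,
  .store .mate .q .p]

theorem image_range_sub_one {r : ℕ} {l : ℕ → Point k} (hl : Set.InjOn l (Finset.range r))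
    (hr : 1 ≤ r) :
    ((Finset.range r).image l).erase (l (r - 1)) = (Finset.range (r - 1)).image l := by
  ext x
  simp only [Finset.mem_erase, Finset.mem_image, Finset.mem_range]
  constructor
  · rintro ⟨hne, i, hi, rfl⟩
    refine ⟨i, ?_, rfl⟩
    by_contra h
    exact hne (by rw [show i = r - 1 by omega])
  · rintro ⟨i, hi, rfl⟩
    refine ⟨fun h => ?_, i, by omega, rfl⟩
    have := hl (by simp; omega) (by simp; omega) h
    omega

/-- Deletion by moving the last entry into the free slot. For `i = r - 2` the update changes nothing
and the entry drops out of the range. -/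
theorem image_range_update {r i : ℕ} {l : ℕ → Point k} (hl : Set.InjOn l (Finset.range r))
    (hr : 2 ≤ r) (hi : i < r - 1) :
    (Finset.range (r - 2)).image (Function.update l i (l (r - 2))) =
      ((Finset.range (r - 1)).image l).erase (l i) := by
  ext x
  simp only [Finset.mem_erase, Finset.mem_image, Finset.mem_range, Function.update_apply]
  constructor
  · rintro ⟨j, hj, rfl⟩
    split_ifs with h
    · refine ⟨fun h' => ?_, r - 2, by omega, rfl⟩
      have := hl (by simp; omega) (by simp; omega) h'
      omega
    · refine ⟨fun h' => ?_, j, by omega, rfl⟩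
      have := hl (by simp; omega) (by simp; omega) h'
      omega
  · rintro ⟨hne, j, hj, rfl⟩
    by_cases h : j = r - 2
    · refine ⟨i, ?_, by simp [h]⟩
      by_contra h'
      exact hne (by rw [show i = j by omega])
    · refine ⟨j, by omega, ?_⟩
      rw [if_neg fun h' => hne (by rw [h'])]

/-- The placeholder configuration follows the machine: the exchange installs the pair just written
to `mate` and keeps the older pairs. -/
theorem PoolInv.pairChosen {w : ℕ} {l : ℕ → Point k} {r : ℕ} {Q : Configuration k} {s : Mem}
    (hs : PoolInv k l r Q s) (hr : 2 ≤ r) {i : ℕ} (hi : i < r - 1) {s' : Mem}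
    (hs' : s' = (Cmd.load .p .pool .r).eval w ((Cmd.minus .r .r .one).eval w s)) :
    PoolInv k (Function.update l i (l (r - 2))) (r - 2)
      (Q.exchange (Q.1 (l (r - 1))) (l i)) (pairChosen.eval w (s'.setReg .i i)) := by
  subst hs'
  have hp : l (r - 1) ∈ (Finset.range r).image l :=
    Finset.mem_image_of_mem _ (by simp; omega)
  have hq : l i ∈ (Finset.range r).image l := Finset.mem_image_of_mem _ (by simp; omega)
  have hqp : l i ≠ l (r - 1) := fun h => by
    have := hs.injOn (by simp; omega) (by simp; omega) h
    omega
  have hU : (Finset.range (r - 2)).image (Function.update l i (l (r - 2))) =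
      (((Finset.range r).image l).erase (l (r - 1))).erase (l i) := by
    rw [image_range_update hs.injOn hr hi, image_range_sub_one hs.injOn (by omega)]
  have e1 := hs.pool (r - 1) (by omega)
  have e2 := hs.pool (r - 2) (by omega)
  have e3 := hs.pool i (by omega)
  have e4 : r - 1 - 1 = r - 2 := by omega
  refine ⟨⟨?_, ?_, ?_, ?_⟩, ?_, ?_, ?_, ?_, ?_⟩
  · simp [_root_.pairChosen, block, Cmd.eval, Mem.setReg, Mem.setArr, hs.ready.zero]
  · simp [_root_.pairChosen, block, Cmd.eval, Mem.setReg, Mem.setArr, hs.ready.one]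
  · simp [_root_.pairChosen, block, Cmd.eval, Mem.setReg, Mem.setArr, hs.ready.sum]
  · simp [_root_.pairChosen, block, Cmd.eval, Mem.setReg, Mem.setArr, hs.ready.cell]
  · simp [_root_.pairChosen, block, Cmd.eval, Mem.setReg, Mem.setArr, hs.size, hs.ready.one, e4]
  · intro j hj
    simp [_root_.pairChosen, block, Cmd.eval, Mem.setReg, Mem.setArr, hs.size, hs.ready.one, e4,
      e2, Function.update_apply]
    split_ifs
    · rfl
    · exact hs.pool j (by omega)
  · intro a ha b hb h
    simp only [Finset.coe_range, Set.mem_Iio] at ha hb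
    simp only [Function.update_apply] at h
    split_ifs at h with h1 h2 h2
    · omega
    · have := hs.injOn (by simp; omega) (by simp; omega) h
      omega
    · have := hs.injOn (by simp; omega) (by simp; omega) h
      omega
    · exact hs.injOn (by simp; omega) (by simp; omega) h
  · rw [hU]
    exact exchange_mapsTo hs.mapsTo hp hq hqp
  · rw [hU]
    intro x hx
    simp [_root_.pairChosen, block, Cmd.eval, Mem.setReg, Mem.setArr, hs.size, hs.ready.one,
      e1, e3, Function.update_apply, pointIndex_inj]
    split_ifs with h1 h2
    · rw [h1, exchange_apply_right hqp]
    · rw [h2, exchange_apply_left hqp]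
    · have hx' : x ∉ (Finset.range r).image l := by
        simp only [Finset.mem_erase] at hx
        tauto
      rw [hs.mate x hx', exchange_apply_of_notMem hs.mapsTo hp hq hx']

theorem ENNReal.sum_const_add_div {ι : Type*} {S : Finset ι} (hS : S.Nonempty) (a : ℝ≥0∞)
    (f : ι → ℝ≥0∞) {c : ℝ≥0∞} (hc : c = S.card) :
    (∑ i ∈ S, (a + f i)) / c = a + (∑ i ∈ S, f i) / c := by
  have h0 : c ≠ 0 := by simpa [hc] using hS.ne_empty
  have h1 : c ≠ ⊤ := by simp [hc]
  rw [Finset.sum_add_distrib, ENNReal.add_div, Finset.sum_const, nsmul_eq_mul, ← hc,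
    mul_comm, ENNReal.mul_div_cancel_right h0 h1]

/-- Induction on `r` in steps of two. Conditioning on the partner of the last pool point splits the
average over completions into `r - 1` averages over `(r - 3)‼` completions each, matching `(r - 1)‼
= (r - 1) * (r - 3)‼`. -/
theorem CostBound.pairing_loop {w : ℕ} {ρ : ℝ≥0∞} {F : MachineState → ℝ≥0∞}
    (hF : CostBound w ρ F) (K : List Cmd) (Φ : Configuration k → ℝ≥0∞)
    (hΦ : ∀ P s, Ready k s → Represents s P → F (K, s) ≤ Φ P) (r : ℕ) {l : ℕ → Point k}
    {Q : Configuration k} {s : Mem} (hs : PoolInv k l r Q s) :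
    F (.while (.lt .zero .r) (.seq (.minus .r .r .one) (.seq (.load .p .pool .r)
      (.seq (.rand .i .r) pairChosen))) :: K, s) ≤
      ρ * (18 * r + 1 : ℕ) +
        (∑ P ∈ agreeOutside ((Finset.range r).image l) Q, Φ P) / ((r - 1)‼ : ℕ) := by
  induction r using Nat.strong_induction_on generalizing l Q s with
  | _ r ih =>
  rcases Nat.eq_zero_or_pos r with rfl | hr
  · have h1 : F (K, s) ≤ Φ Q :=
      hΦ Q s hs.ready fun x => ⟨hs.ready.cell x, hs.mate x (by simp)⟩
    rw [Finset.range_zero, Finset.image_empty, agreeOutside_empty]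
    refine (hF.of_step_eq_pure (σ := (K, s)) ?_).trans ?_
    · simp [step, Test.eval, hs.size, hs.ready.zero]
    · simpa using add_le_add_right h1 ρ
  · set U := (Finset.range r).image l with hU
    have hp : l (r - 1) ∈ U := Finset.mem_image_of_mem _ (by simp; omega)
    have hr2 : 2 ≤ r := by
      have := two_le_card hs.mapsTo hp
      rwa [Finset.card_image_of_injOn hs.injOn, Finset.card_range] at this
    set W : Cmd := .while (.lt .zero .r) (.seq (.minus .r .r .one) (.seq (.load .p .pool .r)
      (.seq (.rand .i .r) pairChosen))) with hW
    set s₁ := (Cmd.minus .r .r .one).eval w s with hs₁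
    set s₂ := (Cmd.load .p .pool .r).eval w s₁ with hs₂
    have hreg : s₂.reg .r = r - 1 := by
      simp [hs₂, hs₁, Cmd.eval, Mem.setReg, hs.size, hs.ready.one]
    let S : Point k → ℝ≥0∞ := fun q =>
      ∑ P ∈ agreeOutside ((U.erase (l (r - 1))).erase q) (Q.exchange (Q.1 (l (r - 1))) q), Φ P
    have hbody : ∀ i ∈ Finset.range (r - 1), F (pairChosen :: W :: K, s₂.setReg .i i) ≤
        ρ * (11 + (18 * (r - 2) + 1) : ℕ) + S (l i) / ((r - 2 - 1)‼ : ℕ) := by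
      intro i hi
      have hinv := hs.pairChosen (w := w) hr2 (Finset.mem_range.1 hi) hs₂
      have h1 := Exec.of_straight w (c := pairChosen) (by simp [_root_.pairChosen, block,
        Cmd.Straight]) (s₂.setReg .i i) ρ F hF (W :: K)
      have h2 := ih (r - 2) (by omega) hinv
      rw [image_range_update hs.injOn hr2 (Finset.mem_range.1 hi),
        ← image_range_sub_one hs.injOn (by omega)] at h2
      refine h1.trans ((add_le_add_right h2 _).trans (le_of_eq ?_))
      rw [show Cmd.cost pairChosen = 11 from rfl, ← add_assoc, ← mul_add, ← Nat.cast_add]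
    have hrand := hF.rand (x := .i) (y := .r) (K := pairChosen :: W :: K) (s := s₂)
      (by omega)
    rw [hreg] at hrand
    have hsum : (∑ i ∈ Finset.range (r - 1), F (pairChosen :: W :: K, s₂.setReg .i i)) /
        ((r - 1 : ℕ) : ℝ≥0∞) ≤ ρ * (11 + (18 * (r - 2) + 1) : ℕ) +
          (∑ P ∈ agreeOutside U Q, Φ P) / ((r - 1)‼ : ℕ) := by
      refine (ENNReal.div_le_div_right (Finset.sum_le_sum hbody) _).trans (le_of_eq ?_)
      -- Positions in the pool correspond bijectively to the possible partners, since `l` is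
      -- injective on the range.
      rw [ENNReal.sum_const_add_div (by simp; omega) _ _ (by simp),
        sum_agreeOutside hs.mapsTo hp, image_range_sub_one hs.injOn (by omega),
        Finset.sum_image (fun a ha b hb => hs.injOn
          (by simp only [Finset.coe_range, Set.mem_Iio] at ha ⊢; omega)
          (by simp only [Finset.coe_range, Set.mem_Iio] at hb ⊢; omega)),
        doubleFactorial_sub_one hr2, Nat.cast_mul]
      simp_rw [div_eq_mul_inv]
      rw [← Finset.sum_mul, ENNReal.mul_inv (by simp) (by simp), mul_assoc,
        mul_comm (((r - 2 - 1)‼ : ℕ) : ℝ≥0∞)⁻¹]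
      simp only [S]
      rw [← image_range_sub_one hs.injOn (by omega)]
    have hA := Exec.of_straight w (c := .minus .r .r .one) trivial s ρ F hF
    have hB := Exec.of_straight w (c := .load .p .pool .r) trivial s₁ ρ F hF
    simp only [Cmd.cost, Nat.cast_one, mul_one] at hA hB
    have hlt : (Test.lt .zero .r).eval s = true := by
      simpa [Test.eval, hs.size, hs.ready.zero] using hr
    calc F (W :: K, s)
        ≤ ρ + F (.seq (.minus .r .r .one) (.seq (.load .p .pool .r)
            (.seq (.rand .i .r) pairChosen)) :: W :: K, s) :=
          hF.of_step_eq_pure (by simp only [hW]; rw [step]; simp [hlt])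
      _ ≤ ρ + (ρ + (ρ + (ρ + (ρ + (ρ + (ρ + (ρ * (11 + (18 * (r - 2) + 1) : ℕ) +
          (∑ P ∈ agreeOutside U Q, Φ P) / ((r - 1)‼ : ℕ)))))))) := by
          gcongr
          refine (hF.of_step_eq_pure (by rw [step])).trans (add_le_add_right ?_ _)
          refine (hA _).trans (add_le_add_right ?_ _)
          refine (hF.of_step_eq_pure (by rw [step])).trans (add_le_add_right ?_ _)
          refine (hB _).trans (add_le_add_right ?_ _)
          refine (hF.of_step_eq_pure (by rw [step])).trans (add_le_add_right ?_ _)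
          exact hrand.trans (add_le_add_right hsum _)
      _ = ρ * (7 + (11 + (18 * (r - 2) + 1)) : ℕ) +
          (∑ P ∈ agreeOutside U Q, Φ P) / ((r - 1)‼ : ℕ) := by
          push_cast
          ring
      _ ≤ _ := add_le_add_left (mul_le_mul_right (Nat.cast_le.2 (by omega)) _) _

theorem CostBound.choosePairing {w : ℕ} {ρ : ℝ≥0∞} {F : MachineState → ℝ≥0∞}
    (hF : CostBound w ρ F) (hM : 0 < degreeSum k) (hw : degreeSum k < 2 ^ w)
    (K : List Cmd) (Φ : Configuration k → ℝ≥0∞)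
    (hΦ : ∀ P s, Ready k s → Represents s P → F (K, s) ≤ Φ P) (Q : Configuration k)
    {s : Mem} (hs : Ready k s) :
    F (choosePairing :: K, s) ≤ ρ * (23 * degreeSum k + 7 : ℕ) +
      (∑ P, Φ P) / (Fintype.card (Configuration k) : ℝ≥0∞) := by
  have hfill : ∃ s', Exec w (.while (.lt .p .M) (block [
      .store .pool .p .p, .plus .p .p .one])) ((Cmd.const .p 0).eval w s) (4 * degreeSum k + 1) s' ∧
      (Ready k s' ∧ ∀ i < degreeSum k, s'.arr .pool i = i) := by
    obtain ⟨s₂, h₂, hs₂, -, hp₂⟩ := Exec.while_count (w := w) (b := .lt .p .M)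
      (c := block [.store .pool .p .p, .plus .p .p .one]) (degreeSum k) (fun _ => 3)
      (fun p s => Ready k s ∧ s.reg .p = p ∧ ∀ i < p, s.arr .pool i = i)
      (fun p hp s ⟨hs, hsp, hpool⟩ => by
        refine ⟨by simpa [Test.eval, hsp, hs.sum] using hp, _,
          Exec.of_straight w (by simp [block, Cmd.Straight]) s, ⟨?_, ?_, ?_, ?_⟩, ?_, ?_⟩
        · simp [block, Cmd.eval, Mem.setReg, Mem.setArr, hs.zero]
        · simp [block, Cmd.eval, Mem.setReg, Mem.setArr, hs.one]
        · simp [block, Cmd.eval, Mem.setReg, Mem.setArr, hs.sum]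
        · simp [block, Cmd.eval, Mem.setReg, Mem.setArr, hs.cell]
        · simp [block, Cmd.eval, Mem.setReg, Mem.setArr, hsp, hs.one]
          exact Nat.mod_eq_of_lt (by omega)
        · intro i hi
          simp [block, Cmd.eval, Mem.setReg, Mem.setArr, hsp, Function.update_apply]
          split_ifs with h
          · exact h.symm
          · exact hpool i (by omega))
      (fun s ⟨hs, hsp, _⟩ => by simp [Test.eval, hsp, hs.sum])
      (s := (Cmd.const .p 0).eval w s)
      (by
        refine ⟨⟨?_, ?_, ?_, ?_⟩, ?_, ?_⟩
        · simp [Cmd.eval, Mem.setReg, hs.zero]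
        · simp [Cmd.eval, Mem.setReg, hs.one]
        · simp [Cmd.eval, Mem.setReg, hs.sum]
        · simp [Cmd.eval, Mem.setReg, hs.cell]
        · simp [Cmd.eval, Mem.setReg]
        · simp)
    refine ⟨s₂, h₂.mono ?_, hs₂, hp₂⟩
    simp
    omega
  obtain ⟨s₂, hfill, hs₂, hpool⟩ := hfill
  obtain ⟨x₀, -⟩ := exists_pointIndex_eq hM
  -- The point with number `i`; the default `x₀` is used only beyond the pool.
  let l : ℕ → Point k := fun i =>
    if h : i < degreeSum k then (exists_pointIndex_eq h).choose else x₀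
  have hl : ∀ i < degreeSum k, pointIndex (l i) = i := by
    intro i hi
    simp only [l, hi, dif_pos]
    exact (exists_pointIndex_eq hi).choose_spec
  have himage : (Finset.range (degreeSum k)).image l = Finset.univ := by
    ext x
    simp only [Finset.mem_image, Finset.mem_range, Finset.mem_univ, iff_true]
    exact ⟨pointIndex x, pointIndex_lt x, pointIndex_injective (hl _ (pointIndex_lt x))⟩
  have hinv : PoolInv k l (degreeSum k) Q ((Cmd.move .r .M).eval w s₂) := by
    refine ⟨⟨?_, ?_, ?_, ?_⟩, ?_, ?_, ?_, ?_, ?_⟩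
    · simp [Cmd.eval, Mem.setReg, hs₂.zero]
    · simp [Cmd.eval, Mem.setReg, hs₂.one]
    · simp [Cmd.eval, Mem.setReg, hs₂.sum]
    · simp [Cmd.eval, Mem.setReg, hs₂.cell]
    · simp [Cmd.eval, Mem.setReg, hs₂.sum]
    · intro i hi
      rw [hl i hi]
      exact hpool i hi
    · intro a ha b hb h
      simp only [Finset.coe_range, Set.mem_Iio] at ha hb
      rw [← hl a ha, ← hl b hb, h]
    · simp [himage]
    · simp [himage]
  have hloop := hF.pairing_loop K Φ hΦ (degreeSum k) hinv
  rw [himage, agreeOutside_univ, ← card_configuration Q] at hloop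
  have hA := Exec.of_straight w (c := .const .p 0) trivial s ρ F hF
  have hB := hfill ρ F hF
  have hC := Exec.of_straight w (c := .move .r .M) trivial s₂ ρ F hF
  simp only [Cmd.cost, Nat.cast_one, mul_one] at hA hB hC
  have hdef : _root_.choosePairing = .seq (.const .p 0) (.seq (.while (.lt .p .M) (block [
      .store .pool .p .p, .plus .p .p .one])) (.seq (.move .r .M)
      (.while (.lt .zero .r) (.seq (.minus .r .r .one) (.seq (.load .p .pool .r)
      (.seq (.rand .i .r) pairChosen)))))) := rfl
  rw [hdef]
  refine (hF.of_step_eq_pure (by rw [step])).trans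
    ((add_le_add_right ((hA _).trans (add_le_add_right ((hF.of_step_eq_pure (by rw [step])).trans
      (add_le_add_right ((hB _).trans (add_le_add_right ((hF.of_step_eq_pure (by rw [step])).trans
      (add_le_add_right ((hC _).trans (add_le_add_right hloop _)) _)) _)) _)) _)) _).trans ?_)
  refine (le_of_eq ?_ : _ ≤ ρ * (22 * degreeSum k + 7 : ℕ) +
    (∑ P, Φ P) / (Fintype.card (Configuration k) : ℝ≥0∞)).trans
    (add_le_add_left (mul_le_mul_right (Nat.cast_le.2 (by omega)) _) _)
  push_cast
  ring

end Pairing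

/-! ### Correctness of the simplicity test and of the edge list -/

section Deciding

variable {n : ℕ} {k : Fin n → ℕ}

/-! ## Loops and repeated edges -/

/-- The point `x` lies in a pair that becomes a loop or a repeated edge of the multigraph. -/
def Configuration.BadAt (P : Configuration k) (x : Point k) : Prop :=
  (P.1 x).1 = x.1 ∨ ∃ y ≠ x, y.1 = x.1 ∧ (P.1 y).1 = (P.1 x).1

theorem Configuration.mem_pairs (P : Configuration k) (e : Sym2 (Point k)) :
    e ∈ P.pairs ↔ ∃ x, s(x, P.1 x) = e := by
  simp [Configuration.pairs]

theorem Configuration.mk_eq_mk_iff (P : Configuration k) {x y : Point k} :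
    s(x, P.1 x) = s(y, P.1 y) ↔ y = x ∨ y = P.1 x := by
  rw [Sym2.eq_iff]
  constructor
  · rintro (⟨h, -⟩ | ⟨-, h⟩)
    · exact .inl h.symm
    · exact .inr h.symm
  · rintro (rfl | rfl)
    · simp
    · simp [P.apply_apply]

/-- Two pairs give the same edge either in parallel or crosswise; reversing one pair reduces the
second case to the first. -/
theorem Configuration.isSimple_iff (P : Configuration k) :
    P.IsSimple ↔ ∀ x, ¬ P.BadAt x := by
  have hnodup : P.multigraph.Nodup ↔ ∀ x y : Point k,
      Sym2.map Sigma.fst s(x, P.1 x) = Sym2.map Sigma.fst s(y, P.1 y) →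
        s(x, P.1 x) = s(y, P.1 y) := by
    rw [Configuration.multigraph, Multiset.nodup_map_iff_inj_on P.pairs.nodup]
    simp only [Finset.mem_val, P.mem_pairs]
    constructor
    · intro h x y
      exact h _ ⟨x, rfl⟩ _ ⟨y, rfl⟩
    · rintro h _ ⟨x, rfl⟩ _ ⟨y, rfl⟩
      exact h x y
  have hdiag : (∀ e ∈ P.multigraph, ¬ e.IsDiag) ↔ ∀ x : Point k, (P.1 x).1 ≠ x.1 := by
    simp only [Configuration.multigraph, Multiset.mem_map, Finset.mem_val, P.mem_pairs]
    constructor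
    · intro h x hx
      exact h _ ⟨_, ⟨x, rfl⟩, rfl⟩ (by simpa using hx.symm)
    · rintro h _ ⟨_, ⟨x, rfl⟩, rfl⟩
      simpa using (h x).symm
  rw [Configuration.IsSimple, hdiag, hnodup]
  constructor
  · rintro ⟨h1, h2⟩ x (hx | ⟨y, hyx, hy, hPy⟩)
    · exact h1 x hx
    · have := h2 x y (by simp [hy, hPy])
      rcases (P.mk_eq_mk_iff).1 this with h | h
      · exact hyx h
      · exact h1 x (by rw [← h, hy])
  · intro h
    refine ⟨fun x hx => h x (.inl hx), fun x y hxy => ?_⟩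
    rw [P.mk_eq_mk_iff]
    by_contra! hne
    simp only [Sym2.map_mk, Sym2.eq_iff] at hxy
    rcases hxy with ⟨h1, h2⟩ | ⟨h1, h2⟩
    · exact h x (.inr ⟨y, hne.1, h1.symm, h2.symm⟩)
    -- In the crosswise case it is the other end `P y` that shares the cell of `x`.
    · refine h x (.inr ⟨P.1 y, fun h' => hne.2 ?_, h1.symm, ?_⟩)
      · rw [← h', P.apply_apply]
      · rw [P.apply_apply, h2]

/-! ## The test by the machine -/

theorem Ready.of_eq {s s' : Mem} (h : Ready k s) (h0 : s'.reg .zero = s.reg .zero)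
    (h1 : s'.reg .one = s.reg .one) (hM : s'.reg .M = s.reg .M)
    (hc : s'.arr .cell = s.arr .cell) : Ready k s' :=
  ⟨h0.trans h.zero, h1.trans h.one, hM.trans h.sum, fun x => by rw [hc, h.cell]⟩

/-- A loop or a repeated edge is visible among the points with numbers below `p`. -/
def Configuration.BadBelow (P : Configuration k) (p : ℕ) : Prop :=
  ∃ x, pointIndex x < p ∧ ((P.1 x).1 = x.1 ∨
    ∃ y, pointIndex y < pointIndex x ∧ y.1 = x.1 ∧ (P.1 y).1 = (P.1 x).1)

/-- Of two points that witness a repeated edge, the one with the larger number detects the other. -/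
theorem Configuration.badBelow_degreeSum (P : Configuration k) :
    P.BadBelow (degreeSum k) ↔ ¬ P.IsSimple := by
  rw [P.isSimple_iff]
  push Not
  constructor
  · rintro ⟨x, -, h | ⟨y, hyx, h⟩⟩
    · exact ⟨x, .inl h⟩
    · exact ⟨x, .inr ⟨y, fun h' => by simp [h'] at hyx, h⟩⟩
  · rintro ⟨x, h | ⟨y, hyx, h1, h2⟩⟩
    · exact ⟨x, pointIndex_lt x, .inl h⟩
    · rcases lt_or_gt_of_ne (pointIndex_injective.ne hyx) with h | h
      · exact ⟨x, pointIndex_lt x, .inr ⟨y, h, h1, h2⟩⟩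
      · exact ⟨y, pointIndex_lt y, .inr ⟨x, h, h1.symm, h2.symm⟩⟩

theorem Configuration.badBelow_succ (P : Configuration k) (x : Point k) :
    P.BadBelow (pointIndex x + 1) ↔ ((P.1 x).1 = x.1 ∨
      ∃ y, pointIndex y < pointIndex x ∧ y.1 = x.1 ∧ (P.1 y).1 = (P.1 x).1) ∨
      P.BadBelow (pointIndex x) := by
  constructor
  · rintro ⟨z, hz, h⟩
    rcases (Nat.lt_succ_iff.1 hz).lt_or_eq with hz | hz
    · exact .inr ⟨z, hz, h⟩
    · obtain rfl := pointIndex_injective hz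
      exact .inl h
  · rintro (h | ⟨z, hz, h⟩)
    · exact ⟨x, by omega, h⟩
    · exact ⟨z, by omega, h⟩

open Classical in
/-- The invariant of the main loop of `checkSimple`. -/
structure CheckInv (P : Configuration k) (p : ℕ) (s : Mem) : Prop where
  ready : Ready k s
  represents : Represents s P
  pos : s.reg .p = p
  bad : s.reg .bad = if P.BadBelow p then 1 else 0
  of_mark : ∀ (x : Point k) (v : ℕ), s.arr .mark x.1 = v + 1 →
    ∃ y, pointIndex y < p ∧ y.1 = v ∧ (P.1 y).1 = x.1
  le_mark : ∀ y, pointIndex y < p → (y.1 : ℕ) + 1 ≤ s.arr .mark (P.1 y).1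

/-- The body of the main loop of `checkSimple`. -/
def checkPoint : Cmd := block [
  .load .v .cell .p,
  .load .q .mate .p,
  .load .u .cell .q,
  .ite (.eq .u .v) (.const .bad 1) .skip,
  .plus .d .v .one,
  .load .t .mark .u,
  .ite (.eq .t .d) (.const .bad 1) .skip,
  .store .mark .u .d,
  .plus .p .p .one]

/-- Turns a conditional assignment into a single register write, so that evaluating the body does
not branch. -/
theorem eval_ite_const (w : ℕ) (b : Test) (x : Reg) (c : ℕ) (s : Mem) :
    (Cmd.ite b (.const x c) .skip).eval w s =
      s.setReg x (if b.eval s then c % 2 ^ w else s.reg x) := by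
  rw [Cmd.eval]
  split_ifs
  · rfl
  · simp [Cmd.eval, Mem.setReg]

/-- Points are scanned in the order of their cells, so marks from former cells are smaller than the
mark of the current cell. Equality of marks thus means that the neighbour was met earlier in this
very cell. -/
theorem CheckInv.step {w : ℕ} (hw : 1 < 2 ^ w) (hn : n < 2 ^ w) (hM : degreeSum k < 2 ^ w)
    {P : Configuration k} {x : Point k} {s : Mem} (hs : CheckInv P (pointIndex x) s) :
    CheckInv P (pointIndex x + 1) (checkPoint.eval w s) := by
  have e1 := (hs.represents x).1
  have e2 := (hs.represents x).2
  have e3 := (hs.represents (P.1 x)).1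
  have e4 : ((x.1 : ℕ) + 1) % 2 ^ w = x.1 + 1 := Nat.mod_eq_of_lt (by omega)
  have e5 : 1 % 2 ^ w = 1 := Nat.mod_eq_of_lt hw
  have hx := pointIndex_lt x
  have e6 : (pointIndex x + 1) % 2 ^ w = pointIndex x + 1 := Nat.mod_eq_of_lt (by omega)
  have hcheck : checkPoint.eval w s = (Cmd.plus .p .p .one).eval w
      ((Cmd.store .mark .u .d).eval w ((Cmd.ite (.eq .t .d) (.const .bad 1) .skip).eval w
      ((Cmd.load .t .mark .u).eval w ((Cmd.plus .d .v .one).eval w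
      ((Cmd.ite (.eq .u .v) (.const .bad 1) .skip).eval w ((Cmd.load .u .cell .q).eval w
      ((Cmd.load .q .mate .p).eval w ((Cmd.load .v .cell .p).eval w s)))))))) := rfl
  rw [eval_ite_const, eval_ite_const] at hcheck
  have hreg : ∀ y, y = .zero ∨ y = .one ∨ y = .M → (checkPoint.eval w s).reg y = s.reg y := by
    rintro y (rfl | rfl | rfl) <;>
      simp [hcheck, Cmd.eval, Mem.setReg, Mem.setArr]
  have harr : ∀ a, a = .cell ∨ a = .mate → (checkPoint.eval w s).arr a = s.arr a := by
    rintro a (rfl | rfl) <;>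
      simp [hcheck, Cmd.eval, Mem.setReg, Mem.setArr]
  have hmark : (checkPoint.eval w s).arr .mark =
      Function.update (s.arr .mark) (P.1 x).1 (x.1 + 1) := by
    simp [hcheck, Cmd.eval, Mem.setReg, Mem.setArr, hs.pos, e1, e2, e3,
      e4, hs.ready.one]
  have hp : (checkPoint.eval w s).reg .p = pointIndex x + 1 := by
    simp [hcheck, Cmd.eval, Mem.setReg, Mem.setArr, hs.pos,
      hs.ready.one, e6]
  have hbad : (checkPoint.eval w s).reg .bad =
      if (P.1 x).1 = x.1 ∨ s.arr .mark (P.1 x).1 = x.1 + 1 then 1 else s.reg .bad := by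
    have h1 : ((P.1 x).1 : ℕ) = x.1 ↔ (P.1 x).1 = x.1 := Fin.ext_iff.symm
    simp only [hcheck, Cmd.eval, Test.eval, Mem.setReg, Mem.setArr]
    simp only [Function.update_self, Function.update_of_ne, ne_eq, reduceCtorEq,
      not_false_eq_true, hs.pos, hs.ready.one, e1, e2, e3, e4, e5, h1, decide_eq_true_eq]
    split_ifs <;> tauto
  have htest : s.arr .mark (P.1 x).1 = x.1 + 1 ↔
      ∃ y, pointIndex y < pointIndex x ∧ y.1 = x.1 ∧ (P.1 y).1 = (P.1 x).1 := by
    constructor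
    · intro h
      obtain ⟨y, h1, h2, h3⟩ := hs.of_mark _ _ h
      exact ⟨y, h1, Fin.ext h2, h3⟩
    -- The mark is at least `x.1 + 1` because of `y`. Whichever scanned point produced it lies in a
    -- cell not after that of `x`, so it is also at most `x.1 + 1`.
    · rintro ⟨y, h1, h2, h3⟩
      have h4 := hs.le_mark y h1
      rw [h3, h2] at h4
      obtain ⟨v, hv⟩ := Nat.exists_eq_add_of_le' (Nat.le_of_add_left_le h4)
      obtain ⟨z, hz, hz1, -⟩ := hs.of_mark _ _ hv
      have := Fin.le_def.1 (fst_le_of_pointIndex_le hz.le)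
      omega
  refine ⟨hs.ready.of_eq (hreg _ (by simp)) (hreg _ (by simp)) (hreg _ (by simp))
    (harr _ (by simp)), fun y => ?_, hp, ?_, ?_, ?_⟩
  · rw [harr _ (by simp), harr _ (by simp)]
    exact hs.represents y
  · rw [hbad, hs.bad, if_congr (or_congr_right htest) rfl rfl]
    have hb := P.badBelow_succ x
    split_ifs with h1 h2 h2 h3 h3
    · rfl
    · exact absurd (hb.2 (.inl h1)) h2
    · rfl
    · exact absurd (hb.2 (.inr h2)) h3
    · exact absurd (hb.1 h3) (not_or_intro h1 h2)
    · rfl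
  · intro u v h
    rw [hmark, Function.update_apply] at h
    split_ifs at h with hu
    · exact ⟨x, by omega, by omega, (Fin.ext hu).symm⟩
    · obtain ⟨y, hy, h⟩ := hs.of_mark u v h
      exact ⟨y, by omega, h⟩
  · intro y hy
    rw [hmark, Function.update_apply]
    -- Overwriting never lowers the bound, as earlier points lie in cells with numbers at most
    -- `x.1`.
    rcases (Nat.lt_succ_iff.1 hy).lt_or_eq with hy | hy
    · split_ifs
      · have := Fin.le_def.1 (fst_le_of_pointIndex_le hy.le)
        omega
      · exact hs.le_mark y hy
    · obtain rfl := pointIndex_injective hy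
      simp

open Classical in
theorem exec_checkSimple {w : ℕ} (hw : 1 < 2 ^ w) (hn : n < 2 ^ w) (hM : degreeSum k < 2 ^ w)
    {P : Configuration k} {s : Mem} (hs : Ready k s) (hP : Represents s P) :
    ∃ s', Exec w checkSimple s (28 * degreeSum k + 20) s' ∧ Ready k s' ∧ Represents s' P ∧
      s'.reg .bad = if P.IsSimple then 0 else 1 := by
  let s₁ := (Cmd.const .p 0).eval w ((Cmd.const .bad 0).eval w s)
  -- Marks from the previous round are cleared. Only cells that contain points are reached, and the
  -- invariant of the scan refers only to these.
  obtain ⟨s₂, h₂, hr₂, hP₂, hp₂, hb₂, hm₂⟩ := Exec.while_count (w := w) (b := .lt .p .M)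
    (c := block [.load .v .cell .p, .store .mark .v .zero, .plus .p .p .one])
    (degreeSum k) (fun _ => 5)
    (fun p s => Ready k s ∧ Represents s P ∧ s.reg .p = p ∧ s.reg .bad = 0 ∧
      ∀ x : Point k, pointIndex x < p → s.arr .mark x.1 = 0)
    (fun p hp s ⟨hs, hP, hsp, hsb, hm⟩ => by
      refine ⟨by simpa [Test.eval, hsp, hs.sum] using hp, _,
        Exec.of_straight w (by simp [block, Cmd.Straight]) s, hs.of_eq ?_ ?_ ?_ ?_, ?_, ?_, ?_, ?_⟩
      · simp [block, Cmd.eval, Mem.setReg, Mem.setArr]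
      · simp [block, Cmd.eval, Mem.setReg, Mem.setArr]
      · simp [block, Cmd.eval, Mem.setReg, Mem.setArr]
      · simp [block, Cmd.eval, Mem.setReg, Mem.setArr]
      · intro x
        simpa [block, Cmd.eval, Mem.setReg, Mem.setArr] using hP x
      · simp [block, Cmd.eval, Mem.setReg, Mem.setArr, hsp, hs.one]
        exact Nat.mod_eq_of_lt (by omega)
      · simpa [block, Cmd.eval, Mem.setReg, Mem.setArr] using hsb
      · obtain ⟨y, rfl⟩ := exists_pointIndex_eq hp
        intro x hx
        simp [block, Cmd.eval, Mem.setReg, Mem.setArr, hsp, hs.cell, hs.zero,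
          Function.update_apply]
        intro hne
        refine hm x ((Nat.lt_succ_iff.1 hx).lt_of_ne fun h => hne ?_)
        rw [pointIndex_injective h])
    (fun s ⟨hs, _, hsp, _⟩ => by simp [Test.eval, hsp, hs.sum]) (s := s₁)
    (by
      refine ⟨hs.of_eq ?_ ?_ ?_ ?_, fun x => ?_, ?_, ?_, fun x hx => ?_⟩
      · simp [s₁, Cmd.eval, Mem.setReg]
      · simp [s₁, Cmd.eval, Mem.setReg]
      · simp [s₁, Cmd.eval, Mem.setReg]
      · simp [s₁, Cmd.eval, Mem.setReg]
      · simpa [s₁, Cmd.eval, Mem.setReg] using hP x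
      · simp [s₁, Cmd.eval, Mem.setReg]
      · simp [s₁, Cmd.eval, Mem.setReg]
      · omega)
  obtain ⟨s₃, h₃, hs₃⟩ := Exec.while_count (w := w) (b := .lt .p .M) (c := checkPoint)
    (degreeSum k) (fun _ => checkPoint.cost) (CheckInv P)
    (fun p hp s hs => by
      obtain ⟨x, rfl⟩ := exists_pointIndex_eq hp
      exact ⟨by simpa [Test.eval, hs.pos, hs.ready.sum] using hp, _,
        Exec.of_straight w (by simp [checkPoint, block, Cmd.Straight]) s, hs.step hw hn hM⟩)
    (fun s hs => by simp [Test.eval, hs.pos, hs.ready.sum])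
    (s := (Cmd.const .p 0).eval w s₂)
    (by
      have hmark : ∀ x : Point k, s₂.arr .mark x.1 = 0 := fun x => hm₂ x (pointIndex_lt x)
      refine ⟨hr₂.of_eq ?_ ?_ ?_ ?_, fun x => ?_, ?_, ?_, fun u v h => ?_, fun y hy => ?_⟩
      · simp [Cmd.eval, Mem.setReg]
      · simp [Cmd.eval, Mem.setReg]
      · simp [Cmd.eval, Mem.setReg]
      · simp [Cmd.eval, Mem.setReg]
      · simpa [Cmd.eval, Mem.setReg] using hP₂ x
      · simp [Cmd.eval, Mem.setReg]
      · simp [Cmd.eval, Mem.setReg, hb₂, Configuration.BadBelow]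
      · have h' : s₂.arr .mark u.1 = v + 1 := by simpa [Cmd.eval, Mem.setReg] using h
        rw [hmark] at h'
        omega
      · omega)
  refine ⟨s₃, ((Exec.of_straight w (by simp [Cmd.Straight]) _).seq
    ((Exec.of_straight w (by simp [Cmd.Straight]) _).seq
    (h₂.seq ((Exec.of_straight w (by simp [Cmd.Straight]) _).seq h₃)))).mono ?_,
    hs₃.ready, hs₃.represents, ?_⟩
  · simp [Cmd.cost, checkPoint, block]
    omega
  · rw [hs₃.bad, if_congr P.badBelow_degreeSum rfl rfl]
    split_ifs <;> rfl

/-! ## Listing the edges -/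

/-- The invariant of the loop of `writeEdges`. -/
structure WriteInv (P : Configuration k) (p : ℕ) (s : Mem) : Prop where
  ready : Ready k s
  represents : Represents s P
  pos : s.reg .p = p
  count : s.reg .m ≤ p
  edges : outputEdges s = (Finset.univ.filter fun x : Point k =>
    pointIndex x < p ∧ pointIndex x < pointIndex (P.1 x)).val.map
      fun x => s((x.1 : ℕ), ((P.1 x).1 : ℕ))

/-- The body of the loop of `writeEdges`. -/
def writePoint : Cmd := block [
    .load .q .mate .p,
    .ite (.lt .p .q)
      (block [
        .load .u .cell .p,
        .load .v .cell .q,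
        .store .src .m .u,
        .store .dst .m .v,
        .plus .m .m .one])
      .skip,
    .plus .p .p .one]

theorem WriteInv.step {w : ℕ} (hM : degreeSum k < 2 ^ w)
    {P : Configuration k} {x : Point k} {s : Mem} (hs : WriteInv P (pointIndex x) s) :
    WriteInv P (pointIndex x + 1) (writePoint.eval w s) := by
  have e1 := (hs.represents x).1
  have e2 := (hs.represents x).2
  have e3 := (hs.represents (P.1 x)).1
  have hx := pointIndex_lt x
  have e6 : (pointIndex x + 1) % 2 ^ w = pointIndex x + 1 := Nat.mod_eq_of_lt (by omega)
  have hcount := hs.count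
  -- At most one edge is written per scanned point, so the edge counter cannot overflow before the
  -- point counter.
  have e7 : (s.reg .m + 1) % 2 ^ w = s.reg .m + 1 := Nat.mod_eq_of_lt (by omega)
  have hinsert : ∀ y : Point k, pointIndex y < pointIndex x + 1 ↔ y = x ∨ pointIndex y < pointIndex x := by
    intro y
    rw [← pointIndex_inj]
    omega
  have hw : writePoint.eval w s = (Cmd.plus .p .p .one).eval w
      (if pointIndex x < pointIndex (P.1 x) then
        (Cmd.plus .m .m .one).eval w ((Cmd.store .dst .m .v).eval w
          ((Cmd.store .src .m .u).eval w ((Cmd.load .v .cell .q).eval w ((Cmd.load .u .cell .p).eval w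
          ((Cmd.load .q .mate .p).eval w s)))))
      else (Cmd.load .q .mate .p).eval w s) := by
    simp only [writePoint, block, Cmd.eval, Test.eval]
    simp [Mem.setReg, hs.pos, e2]
  by_cases h : pointIndex x < pointIndex (P.1 x)
  · rw [if_pos h] at hw
    have hset : (Finset.univ.filter fun y : Point k => pointIndex y < pointIndex x + 1 ∧
        pointIndex y < pointIndex (P.1 y)) = insert x (Finset.univ.filter fun y : Point k =>
        pointIndex y < pointIndex x ∧ pointIndex y < pointIndex (P.1 y)) := by
      ext y
      simp only [Finset.mem_filter, Finset.mem_univ, true_and, Finset.mem_insert, hinsert]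
      constructor
      · tauto
      · rintro (rfl | h') <;> tauto
    refine ⟨hs.ready.of_eq ?_ ?_ ?_ ?_, fun y => ?_, ?_, ?_, ?_⟩
    · simp [hw, Cmd.eval, Mem.setReg, Mem.setArr]
    · simp [hw, Cmd.eval, Mem.setReg, Mem.setArr]
    · simp [hw, Cmd.eval, Mem.setReg, Mem.setArr]
    · simp [hw, Cmd.eval, Mem.setReg, Mem.setArr]
    · simpa [hw, Cmd.eval, Mem.setReg, Mem.setArr] using hs.represents y
    · simp [hw, Cmd.eval, Mem.setReg, Mem.setArr, hs.pos, hs.ready.one, e6]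
    · simpa [hw, Cmd.eval, Mem.setReg, Mem.setArr, hs.pos, hs.ready.one, e7] using hs.count
    · rw [hset, Finset.insert_val_of_notMem (by simp), Multiset.map_cons, ← hs.edges]
      have hm : (writePoint.eval w s).reg .m = s.reg .m + 1 := by
        simp [hw, Cmd.eval, Mem.setReg, Mem.setArr, hs.ready.one, e7]
      have hsrc : (writePoint.eval w s).arr .src =
          Function.update (s.arr .src) (s.reg .m) x.1 := by
        simp [hw, Cmd.eval, Mem.setReg, Mem.setArr, hs.pos, e1]
      have hdst : (writePoint.eval w s).arr .dst =
          Function.update (s.arr .dst) (s.reg .m) (P.1 x).1 := by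
        simp [hw, Cmd.eval, Mem.setReg, Mem.setArr, hs.pos, e2, e3]
      rw [outputEdges, hm, Multiset.range_succ, Multiset.map_cons, hsrc, hdst, outputEdges]
      congr 1
      · simp
      · refine Multiset.map_congr rfl fun e he => ?_
        have := (Multiset.mem_range.1 he).ne
        rw [Function.update_of_ne this, Function.update_of_ne this]
  · rw [if_neg h] at hw
    have hset : (Finset.univ.filter fun y : Point k => pointIndex y < pointIndex x + 1 ∧
        pointIndex y < pointIndex (P.1 y)) = Finset.univ.filter fun y : Point k =>
        pointIndex y < pointIndex x ∧ pointIndex y < pointIndex (P.1 y) := by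
      ext y
      simp only [Finset.mem_filter, Finset.mem_univ, true_and, hinsert]
      constructor
      · rintro ⟨rfl | h1, h2⟩
        · exact absurd h2 h
        · exact ⟨h1, h2⟩
      · tauto
    refine ⟨hs.ready.of_eq ?_ ?_ ?_ ?_, fun y => ?_, ?_, ?_, ?_⟩
    · simp [hw, Cmd.eval, Mem.setReg]
    · simp [hw, Cmd.eval, Mem.setReg]
    · simp [hw, Cmd.eval, Mem.setReg]
    · simp [hw, Cmd.eval, Mem.setReg]
    · simpa [hw, Cmd.eval, Mem.setReg] using hs.represents y
    · simp [hw, Cmd.eval, Mem.setReg, hs.pos, hs.ready.one, e6]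
    · simp [hw, Cmd.eval, Mem.setReg]
      omega
    · rw [hset, ← hs.edges]
      simp [outputEdges, hw, Cmd.eval, Mem.setReg]

/-- Every pair is listed once, at its end with the smaller number. -/
theorem Configuration.multigraph_map_val (P : Configuration k) :
    P.multigraph.map (Sym2.map Fin.val) = (Finset.univ.filter fun x : Point k =>
      pointIndex x < degreeSum k ∧ pointIndex x < pointIndex (P.1 x)).val.map
        fun x => s((x.1 : ℕ), ((P.1 x).1 : ℕ)) := by
  have hpairs : P.pairs = (Finset.univ.filter fun x : Point k =>
      pointIndex x < degreeSum k ∧ pointIndex x < pointIndex (P.1 x)).image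
        fun x => s(x, P.1 x) := by
    ext e
    simp only [P.mem_pairs, Finset.mem_image, Finset.mem_filter, Finset.mem_univ, true_and]
    constructor
    · rintro ⟨x, rfl⟩
      rcases lt_or_gt_of_ne (pointIndex_injective.ne (P.apply_ne x)) with h | h
      · exact ⟨P.1 x, ⟨pointIndex_lt _, by rwa [P.apply_apply]⟩, by
          rw [P.apply_apply, Sym2.eq_swap]⟩
      · exact ⟨x, ⟨pointIndex_lt _, h⟩, rfl⟩
    · rintro ⟨x, -, rfl⟩
      exact ⟨x, rfl⟩
  rw [Configuration.multigraph, hpairs, Finset.image_val_of_injOn, Multiset.map_map,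
    Multiset.map_map]
  · rfl
  · intro x hx y hy h
    simp only [Finset.coe_filter, Finset.mem_univ, true_and, Set.mem_ofPred_eq] at hx hy
    rcases P.mk_eq_mk_iff.1 h with h' | rfl
    · exact h'.symm
    · rw [P.apply_apply] at hy
      omega

theorem exec_writeEdges {w : ℕ} (hM : degreeSum k < 2 ^ w)
    {P : Configuration k} {s : Mem} (hs : Ready k s) (hP : Represents s P) :
    ∃ s', Exec w writeEdges s (18 * degreeSum k + 5) s' ∧
      outputEdges s' = P.multigraph.map (Sym2.map Fin.val) := by
  obtain ⟨s₂, h₂, hs₂⟩ := Exec.while_count (w := w) (b := .lt .p .M) (c := writePoint)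
    (degreeSum k) (fun _ => writePoint.cost) (WriteInv P)
    (fun p hp s hs => by
      obtain ⟨x, rfl⟩ := exists_pointIndex_eq hp
      exact ⟨by simpa [Test.eval, hs.pos, hs.ready.sum] using hp, _,
        Exec.of_straight w (by simp [writePoint, block, Cmd.Straight]) s, hs.step hM⟩)
    (fun s hs => by simp [Test.eval, hs.pos, hs.ready.sum])
    (s := (Cmd.const .p 0).eval w ((Cmd.const .m 0).eval w s))
    (by
      refine ⟨hs.of_eq ?_ ?_ ?_ ?_, fun x => ?_, ?_, ?_, ?_⟩
      · simp [Cmd.eval, Mem.setReg]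
      · simp [Cmd.eval, Mem.setReg]
      · simp [Cmd.eval, Mem.setReg]
      · simp [Cmd.eval, Mem.setReg]
      · simpa [Cmd.eval, Mem.setReg] using hP x
      · simp [Cmd.eval, Mem.setReg]
      · simp [Cmd.eval, Mem.setReg]
      · simp [Cmd.eval, Mem.setReg, outputEdges])
  refine ⟨s₂, ((Exec.of_straight w (by simp [Cmd.Straight]) _).seq
    ((Exec.of_straight w (by simp [Cmd.Straight]) _).seq h₂)).mono ?_, ?_⟩
  · simp [Cmd.cost, writePoint, block]
    omega
  · rw [hs₂.edges, P.multigraph_map_val]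

end Deciding

/-! ### Analysis of the rejection loop -/

section Sampler

variable {n : ℕ} {k : Fin n → ℕ}

/-! ## Rounds and the whole algorithm -/

open Classical in
theorem CostBound.trial {w : ℕ} {ρ : ℝ≥0∞} {F : MachineState → ℝ≥0∞}
    (hF : CostBound w ρ F) (hw : 1 < 2 ^ w) (hn : n < 2 ^ w) (hM0 : 0 < degreeSum k)
    (hM : degreeSum k < 2 ^ w) (K : List Cmd) (Φ : Configuration k → ℝ≥0∞)
    (hΦ : ∀ P s, Ready k s → Represents s P → s.reg .bad = (if P.IsSimple then 0 else 1) →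
      F (K, s) ≤ Φ P) (Q : Configuration k) {s : Mem} (hs : Ready k s) :
    F (trial :: K, s) ≤ ρ * (51 * degreeSum k + 28 : ℕ) +
      (∑ P, Φ P) / (Fintype.card (Configuration k) : ℝ≥0∞) := by
  have h1 := hF.choosePairing hM0 hM (checkSimple :: K)
    (fun P => ρ * (28 * degreeSum k + 20 : ℕ) + Φ P) (fun P s hs hP => by
      obtain ⟨s', hs', hr', hP', hb'⟩ := exec_checkSimple hw hn hM hs hP
      exact (hs' ρ F hF K).trans (add_le_add_right (hΦ P s' hr' hP' hb') _)) Q hs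
  rw [ENNReal.sum_const_add_div (⟨Q, Finset.mem_univ _⟩) _ _ (by rw [Finset.card_univ])] at h1
  refine (hF.of_step_eq_pure (by rw [_root_.trial, step])).trans
    ((add_le_add_right h1 _).trans (le_of_eq ?_))
  push_cast
  ring

/-- If `x ≤ a + (b + c x) / N`, where `N = c + d` and `x` is finite, then `x ≤ (N a + b) / d`. -/
theorem ENNReal.le_div_of_le_add_div {x a b : ℝ≥0∞} {N c d : ℕ} (hx : x ≠ ⊤) (hN : N = c + d)
    (hd : 0 < d) (h : x ≤ a + (b + c * x) / N) : x ≤ (N * a + b) / d := by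
  have hN0 : (N : ℝ≥0∞) ≠ 0 := by
    simp
    omega
  rw [ENNReal.le_div_iff_mul_le (.inl (by simp; omega)) (.inl (by simp))]
  have h1 : N * x ≤ N * a + (b + c * x) := by
    calc N * x ≤ N * (a + (b + c * x) / N) := by gcongr
      _ = N * a + (b + c * x) := by
        rw [mul_add, ENNReal.mul_div_cancel hN0 (by simp)]
  have h2 : c * x + x * d ≤ c * x + (N * a + b) := by
    calc c * x + x * d = N * x := by rw [hN]; push_cast; ring
      _ ≤ _ := h1
      _ = _ := by ring
  exact (ENNReal.add_le_add_iff_left (ENNReal.mul_ne_top (by simp) hx)).1 h2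

open Classical in
-- Rejection sampling without a geometric series: the worst value `x` at the start of a round bounds
-- itself through one round, `x ≤ a + (b + c * x) / N` with `c` the number of rejected
-- configurations, and this inequality is solved for `x`.
theorem CostBound.configurationModel {w : ℕ} {ρ : ℝ≥0∞} {F : MachineState → ℝ≥0∞}
    (hF : CostBound w ρ F) {B : ℝ≥0∞} (hB : B ≠ ⊤) (hFB : ∀ σ, F σ ≤ B)
    (hw : 1 < 2 ^ w) (hn : n < 2 ^ w) (hM0 : 0 < degreeSum k) (hM : degreeSum k < 2 ^ w)
    (ψ : Configuration k → ℝ≥0∞)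
    (hψ : ∀ P : Configuration k, ∀ s, P.IsSimple →
      outputEdges s = P.multigraph.map (Sym2.map Fin.val) → F ([], s) ≤ ψ P)
    (hsimple : ∃ P : Configuration k, P.IsSimple) :
    F ([configurationModel], inputMem k) ≤
      ρ * (8 * n + 6 * degreeSum k + 13 : ℕ) +
      (Fintype.card (Configuration k) * (ρ * (69 * degreeSum k + 35 : ℕ)) +
        ∑ P : Configuration k with P.IsSimple, ψ P) /
        ((Finset.univ.filter fun P : Configuration k => P.IsSimple).card : ℝ≥0∞) := by
  obtain ⟨Q, hQ⟩ := hsimple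
  set W : Cmd := .while (.eq .bad .one) _root_.trial with hW
  -- The supremum ranges over all scratch contents, so a rejected round returns to a state that `x`
  -- already covers.
  set x : ℝ≥0∞ := ⨆ s : {s : Mem // Ready k s ∧ s.reg .bad = 1}, F ([W, writeEdges], s.1) with hx
  have hle : ∀ s, Ready k s → s.reg .bad = 1 → F ([W, writeEdges], s) ≤ x := fun s h1 h2 =>
    le_iSup (fun s : {s : Mem // Ready k s ∧ s.reg .bad = 1} => F ([W, writeEdges], s.1))
      ⟨s, h1, h2⟩
  have hround : x ≤ ρ * (69 * degreeSum k + 35 : ℕ) +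
      (∑ P : Configuration k with P.IsSimple, ψ P +
        ((Finset.univ.filter fun P : Configuration k => ¬ P.IsSimple).card : ℕ) * x) /
        (Fintype.card (Configuration k) : ℝ≥0∞) := by
    refine iSup_le fun ⟨s, hs, hsb⟩ => ?_
    have h1 := hF.trial hw hn hM0 hM [W, writeEdges]
      (fun P => ρ * (18 * degreeSum k + 6 : ℕ) + if P.IsSimple then ψ P else x)
      (fun P s hs hP hb => by
        split_ifs at hb ⊢ with hsimple
        · obtain ⟨s', hs', he⟩ := exec_writeEdges hM hs hP
          calc F ([W, writeEdges], s) ≤ ρ + F ([writeEdges], s) :=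
              hF.of_step_eq_pure (by simp [hW, step, Test.eval, hb, hs.one])
            _ ≤ ρ + (ρ * (18 * degreeSum k + 5 : ℕ) + ψ P) := by
              refine add_le_add_right ((hs' ρ F hF []).trans ?_) _
              exact add_le_add_right (hψ P s' hsimple he) _
            _ = _ := by push_cast; ring
        · exact (hle s hs hb).trans le_add_self) Q hs
    rw [ENNReal.sum_const_add_div (⟨Q, Finset.mem_univ _⟩) _ _ (by rw [Finset.card_univ]),
      Finset.sum_ite, Finset.sum_const, nsmul_eq_mul] at h1
    calc F ([W, writeEdges], s) ≤ ρ + F ([_root_.trial, W, writeEdges], s) :=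
          hF.of_step_eq_pure (by simp [hW, step, Test.eval, hsb, hs.one])
      _ ≤ _ := add_le_add_right h1 _
      _ = _ := by push_cast; ring
  -- The term `c * x` may be cancelled only because `x` is finite; the uniform bound `B` serves this
  -- purpose.
  have hxtop : x ≠ ⊤ := ne_top_of_le_ne_top hB (iSup_le fun s => hFB _)
  have hcard : Fintype.card (Configuration k) =
      (Finset.univ.filter fun P : Configuration k => ¬ P.IsSimple).card +
      (Finset.univ.filter fun P : Configuration k => P.IsSimple).card := by
    rw [add_comm, Finset.card_filter_add_card_filter_not, Finset.card_univ]
  have hfinal := ENNReal.le_div_of_le_add_div hxtop hcard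
    (Finset.card_pos.2 ⟨Q, by simpa using hQ⟩) hround
  obtain ⟨s₁, h₁, hs₁⟩ := exec_setupCells hw hn hM
  have hready : Ready k ((Cmd.const .bad 1).eval w s₁) :=
    hs₁.of_eq (by simp [Cmd.eval, Mem.setReg]) (by simp [Cmd.eval, Mem.setReg])
      (by simp [Cmd.eval, Mem.setReg]) (by simp [Cmd.eval, Mem.setReg])
  have hbad : ((Cmd.const .bad 1).eval w s₁).reg .bad = 1 := by
    simp [Cmd.eval, Mem.setReg, Nat.mod_eq_of_lt hw]
  have hA := Exec.of_straight w (c := .const .bad 1) trivial s₁ ρ F hF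
  simp only [Cmd.cost, Nat.cast_one, mul_one] at hA
  have hdef : _root_.configurationModel =
    .seq setupCells (.seq (.const .bad 1) (.seq W writeEdges)) := rfl
  rw [hdef]
  refine (hF.of_step_eq_pure (by rw [step])).trans ((add_le_add_right ((h₁ ρ F hF _).trans
    (add_le_add_right ((hF.of_step_eq_pure (by rw [step])).trans (add_le_add_right
    ((hA _).trans (add_le_add_right ((hF.of_step_eq_pure (by rw [step])).trans
    (add_le_add_right ((hle _ hready hbad).trans hfinal) _)) _)) _)) _)) _).trans
    (le_of_eq ?_))
  push_cast
  ring

open Classical in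
theorem CostBound.round {w : ℕ} {F : MachineState → ℝ≥0∞}
    (hF : CostBound w 0 F) (hw : 1 < 2 ^ w) (hn : n < 2 ^ w) (hM0 : 0 < degreeSum k)
    (hM : degreeSum k < 2 ^ w) (χ : Configuration k → ℝ≥0∞)
    (hχ : ∀ P s, Represents s P → s.reg .bad = (if P.IsSimple then 0 else 1) →
      F ([], s) ≤ χ P) (Q : Configuration k) :
    F ([.seq setupCells _root_.trial], inputMem k) ≤
      (∑ P, χ P) / (Fintype.card (Configuration k) : ℝ≥0∞) := by
  obtain ⟨s₁, h₁, hs₁⟩ := exec_setupCells hw hn hM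
  have h2 := hF.trial hw hn hM0 hM [] χ (fun P s _ hP hb => hχ P s hP hb) Q hs₁
  refine (hF.of_step_eq_pure (by rw [step])).trans
    ((add_le_add_right ((h₁ 0 F hF _).trans (add_le_add_right h2 _)) _).trans (le_of_eq ?_))
  simp

theorem represents_unique {s : Mem} {P P' : Configuration k} (h : Represents s P)
    (h' : Represents s P') : P = P' :=
  Configuration.ext fun x => pointIndex_injective ((h x).2.symm.trans (h' x).2)

theorem ENNReal.eq_div_of_le_of_one_sub_le {a : ℝ≥0∞} {c N : ℕ} (ha1 : a ≤ 1) (hN : 0 < N)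
    (hcN : c ≤ N) (h : a ≤ c / N) (h' : 1 - a ≤ ((N - c : ℕ) : ℝ≥0∞) / N) : a = c / N := by
  refine le_antisymm h ?_
  have hN0 : (N : ℝ≥0∞) ≠ 0 := by
    simp
    omega
  have hsum : (c : ℝ≥0∞) / N + ((N - c : ℕ) : ℝ≥0∞) / N = 1 := by
    rw [← ENNReal.add_div, ← Nat.cast_add, Nat.add_sub_cancel' hcN,
      ENNReal.div_self hN0 (by simp)]
  have hne : ((N - c : ℕ) : ℝ≥0∞) / N ≠ ⊤ := (ENNReal.div_lt_top (by simp) hN0).ne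
  refine (ENNReal.add_le_add_iff_right hne).1 ?_
  rw [hsum]
  calc (1 : ℝ≥0∞) = a + (1 - a) := (add_tsub_cancel_of_le ha1).symm
    _ ≤ _ := add_le_add_right h' _

/-- Averaging the indicator of `P` and its complement bounds the probability from above and below.
The final memory represents only one configuration, so success means precisely that `P` was drawn.
-/
theorem roundIsUniform (hw : 1 < 2 ^ wordLength n) (hn : n < 2 ^ wordLength n)
    (hM0 : 0 < degreeSum k) (hM : degreeSum k < 2 ^ wordLength n) : RoundIsUniform k := by
  classical
  intro P
  set A : Set Mem := {s | Represents s P ∧ (P.IsSimple → s.reg .bad = 0) ∧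
    (¬ P.IsSimple → s.reg .bad = 1)} with hA
  have hmem : ∀ P' s, Represents s P' → s.reg .bad = (if P'.IsSimple then 0 else 1) →
      (s ∈ A ↔ P' = P) := by
    intro P' s hP' hb
    constructor
    · rintro ⟨h, -⟩
      exact represents_unique hP' h
    · rintro rfl
      refine ⟨hP', fun h => ?_, fun h => ?_⟩
      · rw [hb, if_pos h]
      · rw [hb, if_neg h]
  have hN : 0 < Fintype.card (Configuration k) := Fintype.card_pos_iff.2 ⟨P⟩
  have h1 := (costBound_haltsIn (wordLength n) A).round hw hn hM0 hM
    (fun P' => if P' = P then 1 else 0) (fun P' s hP' hb => by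
      rw [haltsIn_nil]
      have := hmem P' s hP' hb
      split_ifs <;> simp_all) P
  have h2 := (costBound_one_sub_haltsIn (wordLength n) A).round hw hn hM0 hM
    (fun P' => if P' = P then 0 else 1) (fun P' s hP' hb => by
      rw [haltsIn_nil]
      have := hmem P' s hP' hb
      split_ifs <;> simp_all) P
  rw [haltProb_eq_haltsIn, Nat.card_eq_fintype_card]
  have := ENNReal.eq_div_of_le_of_one_sub_le (c := 1) (haltsIn_le_one _ _ _) hN hN
    (h1.trans (le_of_eq (by simp))) (h2.trans (le_of_eq (by
      congr 1
      rw [Finset.sum_ite, Finset.sum_const_zero, zero_add, Finset.sum_const, nsmul_eq_mul, mul_one,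
        Finset.filter_ne', Finset.card_erase_of_mem (Finset.mem_univ P), Finset.card_univ])))
  rw [this, Nat.cast_one]

open Classical in
theorem expectedRuntime_le (hw : 1 < 2 ^ wordLength n) (hn : n < 2 ^ wordLength n)
    (hM0 : 0 < degreeSum k) (hM : degreeSum k < 2 ^ wordLength n)
    (hsimple : ∃ P : Configuration k, P.IsSimple) :
    expectedRuntime k ≤ (8 * n + 6 * degreeSum k + 13 : ℕ) +
      (Fintype.card (Configuration k) * (69 * degreeSum k + 35 : ℕ)) /
        ((Finset.univ.filter fun P : Configuration k => P.IsSimple).card : ℝ≥0∞) := by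
  rw [expectedRuntime, expectedTime_eq_iSup]
  refine iSup_le fun N => ?_
  have := (costBound_timeUpTo (wordLength n) N).configurationModel (B := N) (by simp)
    (timeUpTo_le _ _) hw hn hM0 hM (fun _ => 0) (fun P s _ _ => (timeUpTo_nil _ _ _).le) hsimple
  simpa using this

/-- The output has the distribution of the multigraph of a uniformly random simple configuration. -/
theorem haltProb_configurationModel (hw : 1 < 2 ^ wordLength n) (hn : n < 2 ^ wordLength n)
    (hM0 : 0 < degreeSum k) (hM : degreeSum k < 2 ^ wordLength n)
    (hsimple : ∃ P : Configuration k, P.IsSimple) (E : Multiset (Sym2 ℕ)) [DecidablePred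
      fun P : Configuration k => P.IsSimple] [DecidablePred fun P : Configuration k =>
      P.IsSimple ∧ P.multigraph.map (Sym2.map Fin.val) = E] :
    haltProb (wordLength n) configurationModel (inputMem k) {s | outputEdges s = E} =
      ((Finset.univ.filter fun P : Configuration k =>
        P.IsSimple ∧ P.multigraph.map (Sym2.map Fin.val) = E).card : ℝ≥0∞) /
      ((Finset.univ.filter fun P : Configuration k => P.IsSimple).card : ℝ≥0∞) := by
  classical
  have hN : 0 < (Finset.univ.filter fun P : Configuration k => P.IsSimple).card := by
    obtain ⟨P, hP⟩ := hsimple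
    exact Finset.card_pos.2 ⟨P, by simpa using hP⟩
  have hfilter : (Finset.univ.filter fun P : Configuration k =>
        P.IsSimple ∧ P.multigraph.map (Sym2.map Fin.val) = E) =
      (Finset.univ.filter fun P : Configuration k => P.IsSimple).filter fun P =>
        P.multigraph.map (Sym2.map Fin.val) = E := by
    ext P
    simp
  have h1 := (costBound_haltsIn (wordLength n) {s | outputEdges s = E}).configurationModel
    (B := 1) (by simp) (haltsIn_le_one _ _) hw hn hM0 hM
    (fun P => if P.multigraph.map (Sym2.map Fin.val) = E then 1 else 0) (fun P s hP he => by
      rw [haltsIn_nil, ← he]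
      simp only [Set.mem_ofPred_eq]
      split_ifs <;> simp) hsimple
  -- The complementary indicator gives the matching lower bound. Almost sure termination is not
  -- needed separately.
  have h2 := (costBound_one_sub_haltsIn (wordLength n) {s | outputEdges s = E}).configurationModel
    (B := 1) (by simp) (fun σ => tsub_le_self) hw hn hM0 hM
    (fun P => if P.multigraph.map (Sym2.map Fin.val) = E then 0 else 1) (fun P s hP he => by
      rw [haltsIn_nil, ← he]
      simp only [Set.mem_ofPred_eq]
      split_ifs <;> simp) hsimple
  rw [haltProb_eq_haltsIn, hfilter]
  refine ENNReal.eq_div_of_le_of_one_sub_le (haltsIn_le_one _ _ _) hN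
    (Finset.card_filter_le _ _) (h1.trans (le_of_eq ?_)) (h2.trans (le_of_eq ?_))
  · simp only [zero_mul, mul_zero, zero_add]
    congr! 1
    · rw [Finset.sum_boole]
      congr!
    · congr!
  · simp only [zero_mul, mul_zero, zero_add]
    congr! 1
    · rw [Finset.sum_ite, Finset.sum_const_zero, zero_add, Finset.sum_const, nsmul_eq_mul, mul_one]
      rw [← Finset.card_filter_add_card_filter_not (s := Finset.univ.filter fun P :
        Configuration k => P.IsSimple) (p := fun P => P.multigraph.map (Sym2.map Fin.val) = E),
        Nat.add_sub_cancel_left]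
      congr!
    · congr!

end Sampler

/-! ### Each graph comes from the same number of configurations -/

section Counting

variable {n : ℕ} {k : Fin n → ℕ}

/-! ## The number of configurations of a graph -/

/-- The configuration `P` is simple, and `G` is its graph. -/
structure Configuration.Realizes (P : Configuration k) (G : SimpleGraph (Fin n)) : Prop where
  adj_iff : ∀ u v, G.Adj u v ↔ ∃ x : Point k, x.1 = u ∧ (P.1 x).1 = v
  not_badAt : ∀ x, ¬ P.BadAt x

theorem Configuration.mem_multigraph (P : Configuration k) (u v : Fin n) :
    s(u, v) ∈ P.multigraph ↔ ∃ x : Point k, x.1 = u ∧ (P.1 x).1 = v := by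
  simp only [Configuration.multigraph, Multiset.mem_map, Finset.mem_val, P.mem_pairs]
  constructor
  · rintro ⟨_, ⟨x, rfl⟩, h⟩
    rw [Sym2.map_mk, Sym2.eq_iff] at h
    rcases h with ⟨h1, h2⟩ | ⟨h1, h2⟩
    · exact ⟨x, h1, h2⟩
    · exact ⟨P.1 x, h2, by rw [P.apply_apply, h1]⟩
  · rintro ⟨x, rfl, rfl⟩
    exact ⟨_, ⟨x, rfl⟩, rfl⟩

theorem Configuration.realizes_iff (P : Configuration k) (G : SimpleGraph (Fin n)) :
    P.Realizes G ↔ P.IsSimple ∧ P.multigraph.map (Sym2.map Fin.val) = graphEdges G := by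
  classical
  have hinj : Function.Injective (Multiset.map (Sym2.map (Fin.val : Fin n → ℕ))) :=
    Multiset.map_injective (Sym2.map.injective Fin.val_injective)
  rw [graphEdges, hinj.eq_iff]
  constructor
  · intro h
    have hs := P.isSimple_iff.2 h.not_badAt
    refine ⟨hs, (Multiset.Nodup.ext hs.2 (Finset.nodup _)).2 fun e => ?_⟩
    induction e with
    | _ u v =>
      rw [P.mem_multigraph, Finset.mem_val, SimpleGraph.mem_edgeFinset, SimpleGraph.mem_edgeSet,
        h.adj_iff]
  · rintro ⟨hs, h⟩
    refine ⟨fun u v => ?_, P.isSimple_iff.1 hs⟩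
    rw [← P.mem_multigraph, h, Finset.mem_val, SimpleGraph.mem_edgeFinset, SimpleGraph.mem_edgeSet]

theorem Configuration.Realizes.eq_of_fst_eq {P : Configuration k} {G : SimpleGraph (Fin n)}
    (h : P.Realizes G) {x y : Point k} (h1 : y.1 = x.1) (h2 : (P.1 y).1 = (P.1 x).1) : y = x := by
  by_contra hne
  exact h.not_badAt x (.inr ⟨y, hne, h1, h2⟩)

/-- The bijections between the points of the cells and the neighbours. -/
noncomputable def Configuration.Realizes.toEquiv {P : Configuration k} {G : SimpleGraph (Fin n)}
    (h : P.Realizes G) (j : Fin n) : Fin (k j) ≃ G.neighborSet j :=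
  Equiv.ofBijective (fun i => ⟨(P.1 ⟨j, i⟩).1, (h.adj_iff _ _).2 ⟨⟨j, i⟩, rfl, rfl⟩⟩) <| by
    constructor
    · intro i i' hi
      have := h.eq_of_fst_eq (x := ⟨j, i'⟩) (y := ⟨j, i⟩) rfl (Subtype.ext_iff.1 hi)
      simpa using this
    · rintro ⟨v, hv⟩
      obtain ⟨⟨u, i⟩, rfl, hx⟩ := (h.adj_iff _ _).1 hv
      exact ⟨i, Subtype.ext hx⟩

/-- The partner of a point of cell `j` assigned to the neighbour `v` must be the point of cell `v`
assigned to `j`. Symmetry of adjacency makes this an involution. -/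
theorem exists_realizes_toEquiv {G : SimpleGraph (Fin n)}
    (σ : ∀ j, Fin (k j) ≃ G.neighborSet j) :
    ∃ (P : Configuration k) (h : P.Realizes G), h.toEquiv = σ := by
  let τ : Point k → Fin n := fun x => σ x.1 x.2
  have hadj : ∀ x, G.Adj x.1 (τ x) := fun x => (σ x.1 x.2).2
  have hinj : ∀ x y : Point k, x.1 = y.1 → τ x = τ y → x = y := by
    rintro ⟨u, i⟩ ⟨v, j⟩ h h'
    obtain rfl : u = v := h
    have : i = j := (σ u).injective (Subtype.ext h')
    rw [this]
  have hex : ∀ x : Point k, ∃ y : Point k, y.1 = τ x ∧ τ y = x.1 := fun x =>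
    ⟨⟨τ x, (σ (τ x)).symm ⟨x.1, (hadj x).symm⟩⟩, rfl, by simp [τ]⟩
  choose f hf1 hf2 using hex
  let P : Configuration k := ⟨f, fun x => ⟨hinj _ _ (by rw [hf1, hf2]) (by rw [hf2, hf1]),
    fun h => (hadj x).ne (by rw [← hf1, h])⟩⟩
  have hP : ∀ x, P.1 x = f x := fun _ => rfl
  have hR : P.Realizes G := by
    constructor
    · intro u v
      constructor
      · intro h
        refine ⟨⟨u, (σ u).symm ⟨v, h⟩⟩, rfl, ?_⟩
        rw [hP, hf1]
        simp [τ]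
      · rintro ⟨x, rfl, rfl⟩
        rw [hP, hf1]
        exact hadj x
    · rintro x (h | ⟨y, hne, h1, h2⟩)
      · rw [hP, hf1] at h
        exact (hadj x).ne h.symm
      · rw [hP, hP, hf1, hf1] at h2
        exact hne (hinj _ _ h1 h2)
  refine ⟨P, hR, ?_⟩
  funext j
  ext i
  change ((f ⟨j, i⟩).1 : ℕ) = _
  rw [hf1]

/-- The bijections fix the cell of every partner. Without repeated edges, a point is determined by
its cell and the cell of its partner. -/
theorem Configuration.Realizes.eq_of_toEquiv_eq {P P' : Configuration k}
    {G : SimpleGraph (Fin n)} (h : P.Realizes G) (h' : P'.Realizes G)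
    (he : h.toEquiv = h'.toEquiv) : P = P' := by
  have hfst : ∀ x, (P.1 x).1 = (P'.1 x).1 := fun ⟨j, i⟩ => by
    have := congrArg (fun σ => ((σ j) i : Fin n)) he
    exact this
  refine Configuration.ext fun x => ?_
  refine h.eq_of_fst_eq (hfst x) ?_
  rw [P.apply_apply, hfst, P'.apply_apply]

theorem card_realizes {G : SimpleGraph (Fin n)} (hG : G ∈ graphsWithDegrees k)
    [DecidablePred fun P : Configuration k => P.Realizes G] :
    (Finset.univ.filter fun P : Configuration k => P.Realizes G).card = ∏ j, (k j)! := by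
  classical
  have hcard : ∀ j, Nonempty (Fin (k j) ≃ G.neighborSet j) := fun j => by
    refine ⟨(Finite.equivFinOfCardEq ?_).symm⟩
    rw [Nat.card_coe_set_eq, hG j]
  have h1 : Fintype.card (∀ j, Fin (k j) ≃ G.neighborSet j) = ∏ j, (k j)! := by
    rw [Fintype.card_pi]
    refine Finset.prod_congr rfl fun j _ => ?_
    rw [Fintype.card_equiv (hcard j).some, Fintype.card_fin]
  rw [← h1, ← Fintype.card_subtype]
  refine Fintype.card_of_bijective (f := fun P : {P : Configuration k // P.Realizes G} =>
    P.2.toEquiv) ⟨fun P P' h => Subtype.ext (P.2.eq_of_toEquiv_eq P'.2 h), fun σ => ?_⟩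
  obtain ⟨P, h, rfl⟩ := exists_realizes_toEquiv σ
  exact ⟨⟨P, h⟩, rfl⟩

/-- The graph of a configuration. -/
def Configuration.graph (P : Configuration k) : SimpleGraph (Fin n) :=
  SimpleGraph.mk (fun u v => u ≠ v ∧ ∃ x : Point k, x.1 = u ∧ (P.1 x).1 = v)
    ⟨fun u v ⟨hne, x, h1, h2⟩ => ⟨hne.symm, P.1 x, h2, by rw [P.apply_apply, h1]⟩⟩
    ⟨fun u h => h.1 rfl⟩

theorem Configuration.IsSimple.realizes_graph {P : Configuration k} (h : P.IsSimple) :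
    P.Realizes P.graph := by
  have hb := P.isSimple_iff.1 h
  refine ⟨fun u v => ⟨fun h => h.2, ?_⟩, hb⟩
  rintro ⟨x, rfl, rfl⟩
  exact ⟨fun h => hb x (.inl h.symm), x, rfl, rfl⟩

theorem Configuration.Realizes.eq_graph {P : Configuration k} {G : SimpleGraph (Fin n)}
    (h : P.Realizes G) : P.graph = G := by
  ext u v
  rw [h.adj_iff]
  refine ⟨fun h => h.2, ?_⟩
  rintro ⟨x, rfl, rfl⟩
  exact ⟨fun h' => h.not_badAt x (.inl h'.symm), x, rfl, rfl⟩

theorem Configuration.Realizes.mem_graphsWithDegrees {P : Configuration k}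
    {G : SimpleGraph (Fin n)} (h : P.Realizes G) : G ∈ graphsWithDegrees k := fun j => by
  rw [← Nat.card_coe_set_eq, ← Nat.card_congr (h.toEquiv j), Nat.card_eq_fintype_card,
    Fintype.card_fin]

/-- The simple configurations are fibred over their graphs, with all fibres of the same size. -/
theorem card_isSimple (k : Fin n → ℕ) [DecidablePred fun P : Configuration k => P.IsSimple] :
    (Finset.univ.filter fun P : Configuration k => P.IsSimple).card =
      (graphsWithDegrees k).ncard * ∏ j, (k j)! := by
  classical
  have hfin : (graphsWithDegrees k).Finite := Set.toFinite _
  rw [Set.ncard_eq_toFinset_card _ hfin, Finset.card_eq_sum_card_fiberwise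
    (f := Configuration.graph) (t := hfin.toFinset)]
  · rw [← smul_eq_mul, ← Finset.sum_const]
    refine Finset.sum_congr rfl fun G hG => ?_
    rw [← card_realizes (hfin.mem_toFinset.1 hG), Finset.filter_filter]
    congr 1
    ext P
    simp only [Finset.mem_filter, Finset.mem_univ, true_and]
    constructor
    · rintro ⟨h, rfl⟩
      exact h.realizes_graph
    · intro h
      exact ⟨(P.realizes_iff G).1 h |>.1, h.eq_graph⟩
  · intro P hP
    simp only [Finset.coe_filter, Finset.mem_univ, true_and, Set.mem_ofPred_eq] at hP
    simpa using hP.realizes_graph.mem_graphsWithDegrees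

theorem IsGraphical.exists_isSimple (h : IsGraphical k) :
    ∃ P : Configuration k, P.IsSimple := by
  classical
  obtain ⟨G, hG⟩ := h
  have : 0 < (Finset.univ.filter fun P : Configuration k => P.Realizes G).card := by
    rw [card_realizes hG]
    exact Finset.prod_pos fun j _ => Nat.factorial_pos _
  obtain ⟨P, hP⟩ := Finset.card_pos.1 this
  exact ⟨P, ((P.realizes_iff G).1 (by simpa using hP)).1⟩

theorem isUniformSampler (hk : IsGraphical k) (hw : 1 < 2 ^ wordLength n)
    (hn : n < 2 ^ wordLength n) (hM0 : 0 < degreeSum k) (hM : degreeSum k < 2 ^ wordLength n) :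
    IsUniformSampler k := by
  classical
  intro G hG
  rw [haltProb_configurationModel hw hn hM0 hM hk.exists_isSimple, card_isSimple]
  simp_rw [← Configuration.realizes_iff]
  rw [card_realizes hG, Nat.cast_mul]
  have h0 : ((∏ j, (k j)! : ℕ) : ℝ≥0∞) ≠ 0 := by
    exact Nat.cast_ne_zero.2 (Finset.prod_ne_zero_iff.2 fun j _ => Nat.factorial_ne_zero (k j))
  rw [← ENNReal.mul_div_mul_right 1 _ h0 (ENNReal.natCast_ne_top _), one_mul]

end Counting

/-! ### First moments of loops, repeated edges and weights -/

section Switching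

variable {n : ℕ} {k : Fin n → ℕ}

/-! ## Sums over points -/

theorem sum_point (f : Fin n → ℕ) : ∑ x : Point k, f x.1 = ∑ j, k j * f j := by
  rw [Fintype.sum_sigma]
  simp

theorem card_fst_eq (u : Fin n) : (Finset.univ.filter fun y : Point k => y.1 = u).card = k u := by
  rw [Finset.card_filter, sum_point fun j => if j = u then 1 else 0]
  simp

theorem sum_point_degree (k : Fin n → ℕ) : ∑ x : Point k, k x.1 = ∑ j, k j ^ 2 := by
  rw [sum_point]
  simp_rw [sq]

/-! ## Configurations with prescribed pairs -/

namespace Configuration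

open Classical in
-- Exchanging `d` with `d'` injects the configurations with `P c = d` into those with `P c = d'`,
-- and the latter sets are disjoint for different `d'`. Probabilities of prescribed pairs are
-- bounded in this way without exact counts.
theorem card_mul_le_of_exchange (S : Finset (Configuration k)) (T : Finset (Point k))
    (c d : Point k) (h : ∀ d' ∈ T, ∀ P ∈ S, P.1 c = d → P.exchange d d' ∈ S)
    (hc : ∀ d' ∈ T, c ≠ d') (hcd : c ≠ d) :
    T.card * (S.filter fun P => P.1 c = d).card ≤ S.card := by
  have h1 : ∀ d' ∈ T, (S.filter fun P => P.1 c = d).card ≤ (S.filter fun P => P.1 c = d').card := by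
    intro d' hd'
    refine Finset.card_le_card_of_injOn (exchange d d') (fun P hP => ?_) (fun P _ P' _ he => ?_)
    · simp only [Finset.coe_filter, Set.mem_ofPred_eq] at hP ⊢
      refine ⟨h d' hd' P hP.1 hP.2, ?_⟩
      rw [exchange_apply, Equiv.swap_apply_of_ne_of_ne hcd (hc d' hd'), hP.2,
        Equiv.swap_apply_left]
    · rw [← exchange_exchange d d' P, he, exchange_exchange]
  calc T.card * (S.filter fun P => P.1 c = d).card
      = ∑ d' ∈ T, (S.filter fun P => P.1 c = d).card := by simp
    _ ≤ ∑ d' ∈ T, (S.filter fun P => P.1 c = d').card := Finset.sum_le_sum h1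
    _ = (T.biUnion fun d' => S.filter fun P => P.1 c = d').card := by
      rw [Finset.card_biUnion]
      intro d₁ _ d₂ _ hne
      refine Finset.disjoint_left.2 fun P h1 h2 => hne ?_
      rw [← (Finset.mem_filter.1 h1).2, ← (Finset.mem_filter.1 h2).2]
    _ ≤ S.card := Finset.card_le_card (Finset.biUnion_subset.2 fun _ _ => Finset.filter_subset _ _)

open Classical in
theorem card_pair_le (hM : 6 ≤ degreeSum k) {a b : Point k} (hab : a ≠ b) :
    degreeSum k * (Finset.univ.filter fun P : Configuration k => P.1 a = b).card ≤
      2 * Fintype.card (Configuration k) := by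
  have h := card_mul_le_of_exchange (k := k) Finset.univ (Finset.univ.erase a) a b (by simp)
    (fun d' hd' => (Finset.ne_of_mem_erase hd').symm) hab
  rw [Finset.card_erase_of_mem (Finset.mem_univ a), Finset.card_univ, card_point,
    Finset.card_univ] at h
  calc _ ≤ (2 * (degreeSum k - 1)) *
        (Finset.univ.filter fun P : Configuration k => P.1 a = b).card := by
        gcongr
        omega
    _ ≤ _ := by
      rw [mul_assoc]
      gcongr

open Classical in
-- The exchange argument is repeated inside the configurations with `P a = b`. There remain `M - 3`
-- choices of `d'`, and `M ≤ 2 * (M - 3)` because `M ≥ 6`.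
theorem card_two_pairs_le (hM : 6 ≤ degreeSum k) {a b c d : Point k} (hab : a ≠ b)
    (hac : a ≠ c) (had : a ≠ d) (hbc : b ≠ c) (hbd : b ≠ d) (hcd : c ≠ d) :
    degreeSum k ^ 2 *
      (Finset.univ.filter fun P : Configuration k => P.1 a = b ∧ P.1 c = d).card ≤
      4 * Fintype.card (Configuration k) := by
  have h := card_mul_le_of_exchange (k := k) (Finset.univ.filter fun P => P.1 a = b)
    (((Finset.univ.erase a).erase b).erase c) c d (fun d' hd' P hP _ => by
      simp only [Finset.mem_erase, Finset.mem_univ, and_true, Finset.mem_filter, true_and] at hd' hP ⊢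
      rw [exchange_apply, Equiv.swap_apply_of_ne_of_ne had hd'.2.2.symm, hP,
        Equiv.swap_apply_of_ne_of_ne hbd hd'.2.1.symm])
    (fun d' hd' => (Finset.ne_of_mem_erase hd').symm) hcd
  rw [Finset.card_erase_of_mem (by simp [hac.symm, hbc.symm]),
    Finset.card_erase_of_mem (by simp [hab.symm]), Finset.card_erase_of_mem (by simp),
    Finset.card_univ, card_point, Finset.filter_filter] at h
  have h2 := card_pair_le hM hab
  set m := (Finset.univ.filter fun P : Configuration k => P.1 a = b ∧ P.1 c = d).card
  set m' := (Finset.univ.filter fun P : Configuration k => P.1 a = b).card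
  have h3 : degreeSum k * m ≤ 2 * m' := by
    calc degreeSum k * m ≤ (2 * (degreeSum k - 1 - 1 - 1)) * m := by
          gcongr
          omega
      _ ≤ _ := by
        rw [mul_assoc]
        gcongr
  calc degreeSum k ^ 2 * m = degreeSum k * (degreeSum k * m) := by ring
    _ ≤ degreeSum k * (2 * m') := by gcongr
    _ = 2 * (degreeSum k * m') := by ring
    _ ≤ 2 * (2 * Fintype.card (Configuration k)) := by gcongr
    _ = _ := by ring

/-! ## Defects -/

open Classical in
/-- The points in loops and repeated edges. -/
noncomputable def badPoints (P : Configuration k) : Finset (Point k) :=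
  {x | P.BadAt x}

theorem mem_badPoints {P : Configuration k} {x : Point k} : x ∈ P.badPoints ↔ P.BadAt x := by
  simp [badPoints]

/-- The sum of the products of the degrees of the end vertices of the edges, counted twice. -/
def weight (P : Configuration k) : ℕ := ∑ x : Point k, k x.1 * k (P.1 x).1

open Classical in
-- Linearity of expectation: two given points are paired with probability at most `2 / M`.
theorem sum_weight_le (hM : 6 ≤ degreeSum k) :
    degreeSum k * ∑ P : Configuration k, P.weight ≤
      2 * Fintype.card (Configuration k) * (∑ j, k j ^ 2) ^ 2 := by
  have h : ∀ P : Configuration k, P.weight =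
      ∑ x, ∑ z, k x.1 * k z.1 * if P.1 x = z then 1 else 0 := by
    intro P
    simp [weight]
  simp_rw [h]
  rw [Finset.sum_comm, Finset.mul_sum]
  simp_rw [Finset.sum_comm (s := (Finset.univ : Finset (Configuration k)))]
  simp_rw [← Finset.mul_sum, ← Finset.card_filter, Finset.mul_sum]
  calc _ ≤ ∑ x : Point k, ∑ z : Point k,
        2 * Fintype.card (Configuration k) * (k x.1 * k z.1) := by
        refine Finset.sum_le_sum fun x _ => Finset.sum_le_sum fun z _ => ?_
        by_cases hxz : x = z
        · have : (Finset.univ.filter fun P : Configuration k => P.1 x = z) = ∅ := by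
            refine Finset.filter_eq_empty_iff.2 fun P _ => ?_
            rw [hxz]
            exact P.apply_ne z
          simp [this]
        · have := card_pair_le hM hxz
          calc _ = (degreeSum k * (Finset.univ.filter fun P : Configuration k =>
                P.1 x = z).card) * (k x.1 * k z.1) := by ring
            _ ≤ _ := by gcongr
    _ = _ := by
      rw [← sum_point_degree, sq, Finset.sum_mul_sum]
      simp_rw [Finset.mul_sum]

open Classical in
-- A bad point lies in a loop or in one of two parallel pairs. The second sum runs over `((x, y), (P
-- x, P y))`.
theorem card_badPoints_le (P : Configuration k) : P.badPoints.card ≤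
    ∑ p : Point k × Point k, (if p.2.1 = p.1.1 ∧ p.1 ≠ p.2 then 1 else 0) *
      (if P.1 p.1 = p.2 then 1 else 0) +
    ∑ p : (Point k × Point k) × (Point k × Point k),
      (if p.1.2.1 = p.1.1.1 ∧ p.2.2.1 = p.2.1.1 ∧ p.1.1 ≠ p.2.1 ∧ p.1.1 ≠ p.1.2 ∧ p.1.1 ≠ p.2.2 ∧
        p.2.1 ≠ p.1.2 ∧ p.2.1 ≠ p.2.2 ∧ p.1.2 ≠ p.2.2 then 1 else 0) *
      (if P.1 p.1.1 = p.2.1 ∧ P.1 p.1.2 = p.2.2 then 1 else 0) := by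
  rw [Fintype.sum_prod_type, Fintype.sum_prod_type, Fintype.sum_prod_type, ← Finset.sum_add_distrib,
    badPoints, Finset.card_filter]
  refine Finset.sum_le_sum fun x _ => ?_
  split_ifs with hx
  · by_cases hloop : (P.1 x).1 = x.1
    · refine le_add_right ?_
      refine le_trans ?_ (Finset.single_le_sum (fun _ _ => Nat.zero_le _) (Finset.mem_univ (P.1 x)))
      simp [hloop, (P.apply_ne x).symm]
    · obtain ⟨y, hne, h1, h2⟩ := hx.resolve_left hloop
      refine le_add_left ?_
      refine le_trans ?_ (Finset.single_le_sum (fun _ _ => Nat.zero_le _) (Finset.mem_univ y))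
      refine le_trans ?_ (Finset.single_le_sum (fun _ _ => Nat.zero_le _)
        (Finset.mem_univ (P.1 x, P.1 y)))
      -- Coincidences among the four points would make `x` part of a loop, which was treated first,
      -- or contradict `y ≠ x`.
      have h3 : x ≠ P.1 y := fun h => hloop (by rw [h, P.apply_apply, ← h, h1])
      have h4 : P.1 x ≠ y := fun h => hloop (by rw [h, h1])
      have h5 : P.1 x ≠ P.1 y := fun h => hne (P.apply_injective h).symm
      simp [h1, h2, (P.apply_ne x).symm, (P.apply_ne y).symm, hne.symm, h3, h4, h5]
  · exact Nat.zero_le _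

theorem sum_mul_indicator_le {ι : Type*} [Fintype ι] (q : ι → Prop)
    (p : ι → Configuration k → Prop) [DecidablePred q] [∀ i, DecidablePred (p i)] (m c : ℕ)
    (h : ∀ i, q i → m * (Finset.univ.filter (p i)).card ≤ c) :
    m * ∑ P : Configuration k, ∑ i, (if q i then 1 else 0) * (if p i P then 1 else 0) ≤
      c * (Finset.univ.filter q).card := by
  rw [Finset.sum_comm, Finset.mul_sum, Finset.card_filter, Finset.mul_sum]
  refine Finset.sum_le_sum fun i _ => ?_
  rw [← Finset.mul_sum, ← Finset.card_filter]
  split_ifs with hq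
  · simpa using h i hq
  · simp

open Classical in
theorem card_same_cell (k : Fin n → ℕ) :
    (Finset.univ.filter fun p : Point k × Point k => p.2.1 = p.1.1).card = ∑ j, k j ^ 2 := by
  rw [Finset.card_filter, Fintype.sum_prod_type, ← sum_point_degree]
  refine Finset.sum_congr rfl fun x _ => ?_
  rw [← Finset.card_filter]
  exact card_fst_eq x.1

open Classical in
-- At most `B * M` ordered pairs of points share a cell. Loops thus contribute `(B * M) * (2 / M)`
-- on average, and repeated edges `(B * M) ^ 2 * (4 / M ^ 2)`.
theorem sum_card_badPoints_le (hM : 6 ≤ degreeSum k) {B : ℕ} (hB : ∑ j, k j ^ 2 ≤ B * degreeSum k) :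
    ∑ P : Configuration k, P.badPoints.card ≤
      (2 * B + 4 * B ^ 2) * Fintype.card (Configuration k) := by
  refine (Finset.sum_le_sum fun P _ => card_badPoints_le P).trans ?_
  rw [Finset.sum_add_distrib, add_mul]
  have hM0 : 0 < degreeSum k := by omega
  refine add_le_add ?_ ?_
  · have h := sum_mul_indicator_le (k := k) (fun p : Point k × Point k => p.2.1 = p.1.1 ∧ p.1 ≠ p.2)
      (fun p P => P.1 p.1 = p.2) (degreeSum k) (2 * Fintype.card (Configuration k))
      (fun p hp => by convert card_pair_le hM hp.2)
    refine Nat.le_of_mul_le_mul_left (h.trans ?_) hM0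
    calc _ ≤ 2 * Fintype.card (Configuration k) * (B * degreeSum k) := by
          gcongr
          refine le_trans (Finset.card_le_card ?_) ((card_same_cell k).le.trans hB)
          intro p hp
          simp only [Finset.mem_filter, Finset.mem_univ, true_and] at hp ⊢
          exact hp.1
      _ = _ := by ring
  · have h := sum_mul_indicator_le (k := k)
      (fun p : (Point k × Point k) × (Point k × Point k) =>
        p.1.2.1 = p.1.1.1 ∧ p.2.2.1 = p.2.1.1 ∧ p.1.1 ≠ p.2.1 ∧ p.1.1 ≠ p.1.2 ∧ p.1.1 ≠ p.2.2 ∧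
        p.2.1 ≠ p.1.2 ∧ p.2.1 ≠ p.2.2 ∧ p.1.2 ≠ p.2.2)
      (fun p P => P.1 p.1.1 = p.2.1 ∧ P.1 p.1.2 = p.2.2) (degreeSum k ^ 2)
      (4 * Fintype.card (Configuration k))
      (fun p ⟨_, _, h1, h2, h3, h4, h5, h6⟩ => by
        convert card_two_pairs_le hM h1 h2 h3 h4 h5 h6)
    refine Nat.le_of_mul_le_mul_left (h.trans ?_) (pow_pos hM0 2)
    calc _ ≤ 4 * Fintype.card (Configuration k) * ((B * degreeSum k) * (B * degreeSum k)) := by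
          gcongr
          refine le_trans (Finset.card_le_card (t := (Finset.univ.filter
            fun p : Point k × Point k => p.2.1 = p.1.1) ×ˢ (Finset.univ.filter
            fun p : Point k × Point k => p.2.1 = p.1.1)) ?_) ?_
          · intro p hp
            simp only [Finset.mem_filter, Finset.mem_univ, true_and, Finset.mem_product] at hp ⊢
            exact ⟨hp.1, hp.2.1⟩
          · rw [Finset.card_product, card_same_cell]
            gcongr
      _ = _ := by ring

/-- A measure of the distance from being simple. -/
noncomputable def defect (P : Configuration k) : ℕ :=
  degreeSum k * P.badPoints.card + P.weight

theorem sum_defect_le (hM : 6 ≤ degreeSum k) {B : ℕ} (hB : ∑ j, k j ^ 2 ≤ B * degreeSum k) :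
    ∑ P : Configuration k, P.defect ≤
      (2 * B + 6 * B ^ 2) * degreeSum k * Fintype.card (Configuration k) := by
  have h1 := sum_card_badPoints_le hM hB
  have h2 : ∑ P : Configuration k, P.weight ≤
      2 * B ^ 2 * degreeSum k * Fintype.card (Configuration k) := by
    refine Nat.le_of_mul_le_mul_left ((sum_weight_le hM).trans ?_) (show 0 < degreeSum k by omega)
    calc _ ≤ 2 * Fintype.card (Configuration k) * (B * degreeSum k) ^ 2 := by gcongr
      _ = _ := by ring
  simp only [defect]
  rw [Finset.sum_add_distrib, ← Finset.mul_sum]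
  calc _ ≤ degreeSum k * ((2 * B + 4 * B ^ 2) * Fintype.card (Configuration k)) +
        2 * B ^ 2 * degreeSum k * Fintype.card (Configuration k) := by gcongr
    _ = _ := by ring

end Configuration

end Switching

/-! ### Switchings between levels of bad points -/

section Switching

variable {n : ℕ} {k : Fin n → ℕ}

namespace Configuration

/-- Exchanging `b` and `c` replaces the pairs `{b, P b}` and `{c, P c}` without creating new loops
or repeated edges. -/
structure GoodSwitch (P : Configuration k) (b c : Point k) : Prop where
  left : c.1 ≠ (P.1 b).1
  left_new : ∀ y : Point k, y.1 = (P.1 b).1 → (P.1 y).1 ≠ c.1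
  right : (P.1 c).1 ≠ b.1
  right_new : ∀ y : Point k, y.1 = b.1 → (P.1 y).1 ≠ (P.1 c).1
  -- The two new edges could still be parallel to each other. This condition excludes the case that
  -- `b` and `c` share a cell, and `not_loop` the case that both old pairs are loops.
  ne : c.1 ≠ b.1
  not_loop : c.1 ≠ (P.1 c).1

variable {P : Configuration k} {b c : Point k}

theorem exchange_cases (hc : c ≠ P.1 b) (y : Point k) :
    (y = P.1 b ∧ (P.exchange b c).1 y = c) ∨ (y = b ∧ (P.exchange b c).1 y = P.1 c) ∨
    (y = c ∧ (P.exchange b c).1 y = P.1 b) ∨ (y = P.1 c ∧ (P.exchange b c).1 y = b) ∨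
    (y ≠ P.1 b ∧ y ≠ b ∧ y ≠ c ∧ y ≠ P.1 c ∧ (P.exchange b c).1 y = P.1 y) := by
  have hb : b ≠ P.1 c := fun h => hc (P.apply_eq_iff.1 h.symm)
  rw [exchange_apply]
  by_cases h1 : y = P.1 b
  · refine .inl ⟨h1, ?_⟩
    rw [h1, Equiv.swap_apply_of_ne_of_ne (P.apply_ne b) hc.symm, P.apply_apply,
      Equiv.swap_apply_left]
  by_cases h2 : y = b
  · refine .inr (.inl ⟨h2, ?_⟩)
    rw [h2, Equiv.swap_apply_left, Equiv.swap_apply_of_ne_of_ne hb.symm (P.apply_ne c)]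
  by_cases h3 : y = c
  · refine .inr (.inr (.inl ⟨h3, ?_⟩))
    rw [h3, Equiv.swap_apply_right, Equiv.swap_apply_of_ne_of_ne (P.apply_ne b) hc.symm]
  by_cases h4 : y = P.1 c
  · refine .inr (.inr (.inr (.inl ⟨h4, ?_⟩)))
    rw [h4, Equiv.swap_apply_of_ne_of_ne hb.symm (P.apply_ne c), P.apply_apply,
      Equiv.swap_apply_right]
  · refine .inr (.inr (.inr (.inr ⟨h1, h2, h3, h4, ?_⟩)))
    rw [Equiv.swap_apply_of_ne_of_ne h2 h3, Equiv.swap_apply_of_ne_of_ne]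
    · exact fun h => h1 (P.apply_eq_iff.1 h)
    · exact fun h => h4 (P.apply_eq_iff.1 h)

theorem badAt_apply_iff (P : Configuration k) (x : Point k) : P.BadAt (P.1 x) ↔ P.BadAt x := by
  have key : ∀ x, P.BadAt x → P.BadAt (P.1 x) := by
    rintro x (h | ⟨y, hne, h1, h2⟩)
    · exact .inl (by rw [P.apply_apply, h])
    · exact .inr ⟨P.1 y, fun h => hne (P.apply_injective h), h2, by
        rw [P.apply_apply, P.apply_apply, h1]⟩
  exact ⟨fun h => by simpa [P.apply_apply] using key _ h, key x⟩

namespace GoodSwitch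

variable (h : P.GoodSwitch b c)
include h

theorem ne_apply : c ≠ P.1 b := fun h' => h.left (by rw [h'])

theorem exchange_left : (P.exchange b c).1 b = P.1 c := by
  have hb : b ≠ P.1 c := fun h' => h.ne_apply (P.apply_eq_iff.1 h'.symm)
  rw [exchange_apply, Equiv.swap_apply_left, Equiv.swap_apply_of_ne_of_ne hb.symm (P.apply_ne c)]

theorem exchange_right : (P.exchange b c).1 c = P.1 b := by
  rw [exchange_apply, Equiv.swap_apply_right,
    Equiv.swap_apply_of_ne_of_ne (P.apply_ne b) h.ne_apply.symm]

theorem not_badAt_left : ¬ (P.exchange b c).BadAt b := by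
  rintro (h' | ⟨y, hne, h1, h2⟩)
  · rw [h.exchange_left] at h'
    exact h.right h'
  · rw [h.exchange_left] at h2
    rcases exchange_cases h.ne_apply y with ⟨rfl, h3⟩ | ⟨rfl, h3⟩ | ⟨rfl, h3⟩ |
      ⟨rfl, h3⟩ | ⟨-, -, -, -, h3⟩
    · rw [h3] at h2
      exact h.not_loop h2
    · exact hne rfl
    · exact h.ne h1
    · exact h.right h1
    · rw [h3] at h2
      exact h.right_new y h1 h2

theorem not_badAt_right : ¬ (P.exchange b c).BadAt c := by
  rw [← badAt_apply_iff, h.exchange_right]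
  have hPb : (P.exchange b c).1 (P.1 b) = c := by
    rw [apply_eq_iff, h.exchange_right]
  rintro (h' | ⟨y, hne, h1, h2⟩)
  · rw [hPb] at h'
    exact h.left h'
  · rw [hPb] at h2
    rcases exchange_cases h.ne_apply y with ⟨rfl, h3⟩ | ⟨rfl, h3⟩ | ⟨rfl, h3⟩ |
      ⟨rfl, h3⟩ | ⟨-, -, -, -, h3⟩
    · exact hne rfl
    · rw [h3] at h2
      exact h.not_loop h2.symm
    · exact h.left h1
    · rw [h3] at h2
      exact h.ne h2.symm
    · rw [h3] at h2
      exact h.left_new y h1 h2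

/-- The switched points are no longer bad, and neither new edge is parallel to an old one. A
remaining bad point thus has an old witness. -/
theorem badAt_of_badAt {x : Point k} (hx : (P.exchange b c).BadAt x) : P.BadAt x := by
  rcases exchange_cases h.ne_apply x with ⟨rfl, h3⟩ | ⟨rfl, h3⟩ | ⟨rfl, h3⟩ |
      ⟨rfl, h3⟩ | ⟨-, -, -, -, h3⟩
  · rw [← badAt_apply_iff, h3] at hx
    exact absurd hx h.not_badAt_right
  · exact absurd hx h.not_badAt_left
  · exact absurd hx h.not_badAt_right
  · rw [← badAt_apply_iff, h3] at hx
    exact absurd hx h.not_badAt_left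
  · rcases hx with h' | ⟨y, hne, h1, h2⟩
    · exact .inl (by rwa [h3] at h')
    · rw [h3] at h2
      rcases exchange_cases h.ne_apply y with ⟨rfl, h4⟩ | ⟨rfl, h4⟩ | ⟨rfl, h4⟩ |
        ⟨rfl, h4⟩ | ⟨-, -, -, -, h4⟩
      · rw [h4] at h2
        exact absurd h2.symm (h.left_new x h1.symm)
      · rw [h4] at h2
        exact absurd h2.symm (h.right_new x h1.symm)
      · rw [h4] at h2
        refine absurd ?_ (h.left_new (P.1 x) h2.symm)
        rw [P.apply_apply, h1]
      · rw [h4] at h2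
        refine absurd ?_ (h.right_new (P.1 x) h2.symm)
        rw [P.apply_apply, h1]
      · rw [h4] at h2
        exact .inr ⟨y, hne, h1, h2⟩

theorem card_badPoints_lt (hb : P.BadAt b) :
    (P.exchange b c).badPoints.card < P.badPoints.card := by
  refine Finset.card_lt_card (Finset.ssubset_iff_of_subset (fun x hx => ?_) |>.2
    ⟨b, mem_badPoints.2 hb, fun hb' => h.not_badAt_left (mem_badPoints.1 hb')⟩)
  exact mem_badPoints.2 (h.badAt_of_badAt (mem_badPoints.1 hx))

/-- Only four points get new partners, and each contributes at most `Δ ^ 2`. -/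
theorem weight_exchange_le {Δ : ℕ} (hΔ : ∀ j, k j ≤ Δ) :
    (P.exchange b c).weight ≤ P.weight + 4 * Δ ^ 2 := by
  classical
  let T : Finset (Point k) := {P.1 b, b, c, P.1 c}
  have hT : T.card ≤ 4 := Finset.card_le_four
  calc (P.exchange b c).weight
      ≤ ∑ y : Point k, (k y.1 * k (P.1 y).1 + if y ∈ T then Δ ^ 2 else 0) := by
        refine Finset.sum_le_sum fun y _ => ?_
        by_cases hy : y ∈ T
        · rw [if_pos hy, sq]
          exact le_add_left (Nat.mul_le_mul (hΔ _) (hΔ _))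
        · simp only [T, Finset.mem_insert, Finset.mem_singleton, not_or] at hy
          rcases exchange_cases h.ne_apply y with ⟨h', -⟩ | ⟨h', -⟩ | ⟨h', -⟩ |
            ⟨h', -⟩ | ⟨-, -, -, -, h'⟩
          · exact absurd h' hy.1
          · exact absurd h' hy.2.1
          · exact absurd h' hy.2.2.1
          · exact absurd h' hy.2.2.2
          · rw [h']
            exact le_self_add
    _ = P.weight + T.card * Δ ^ 2 := by
        rw [Finset.sum_add_distrib, weight]
        simp
    _ ≤ _ := by gcongr

/-- Losing a bad point lowers the defect by at least `M`, which pays for the growth `4 * Δ ^ 2` of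
the weight. The bound on the defect thus survives repeated switching. -/
theorem defect_exchange_le (hb : P.BadAt b) {Δ : ℕ} (hΔ : ∀ j, k j ≤ Δ)
    (hM : 4 * Δ ^ 2 ≤ degreeSum k) : (P.exchange b c).defect ≤ P.defect := by
  have h1 := h.card_badPoints_lt hb
  have h2 := h.weight_exchange_le hΔ
  rw [defect, defect]
  calc _ ≤ degreeSum k * (P.exchange b c).badPoints.card + (P.weight + degreeSum k) := by
        gcongr
        omega
    _ = degreeSum k * ((P.exchange b c).badPoints.card + 1) + P.weight := by ring
    _ ≤ _ := by
      gcongr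
      omega

/-- The inverse of a switch at a bad point is one of few exchanges. -/
theorem exists_of_badAt (hb : P.BadAt b) :
    ((P.exchange b c).1 c).1 = b.1 ∨ ∃ y : Point k, y.1 = ((P.exchange b c).1 c).1 ∧
      ((P.exchange b c).1 y).1 = b.1 := by
  rw [h.exchange_right]
  rw [← badAt_apply_iff] at hb
  by_cases hloop : (P.1 b).1 = b.1
  · exact .inl hloop
  rcases hb with h' | ⟨y, hne, h1, h2⟩
  · rw [P.apply_apply] at h'
    exact absurd h'.symm hloop
  · rw [P.apply_apply] at h2
    refine .inr ⟨y, h1, ?_⟩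
    -- The parallel edge at `y` is not touched by the switch and remains as a trace of the removed
    -- one.
    rcases exchange_cases h.ne_apply y with ⟨rfl, h4⟩ | ⟨rfl, h4⟩ | ⟨rfl, h4⟩ |
        ⟨rfl, h4⟩ | ⟨-, -, -, -, h4⟩
    · exact absurd rfl hne
    · exact absurd h1.symm hloop
    · exact absurd h1 h.left
    · rw [P.apply_apply] at h2
      exact absurd h2 h.ne
    · rw [h4, h2]

end GoodSwitch

theorem card_fst_le {Δ : ℕ} (hΔ : ∀ j, k j ≤ Δ) (u : Fin n)
    [DecidablePred fun y : Point k => y.1 = u] :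
    (Finset.univ.filter fun y : Point k => y.1 = u).card ≤ Δ := by
  refine le_trans (le_of_eq ?_) (hΔ u)
  convert card_fst_eq (k := k) u

open Classical in
theorem card_neighbours_le (P : Configuration k) {Δ : ℕ} (hΔ : ∀ j, k j ≤ Δ) (u : Fin n) :
    (Finset.univ.filter fun c : Point k => ∃ y : Point k, y.1 = u ∧ (P.1 y).1 = c.1).card ≤
      Δ ^ 2 := by
  calc _ ≤ ((Finset.univ.filter fun y : Point k => y.1 = u).biUnion fun y =>
        Finset.univ.filter fun c : Point k => c.1 = (P.1 y).1).card := by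
        refine Finset.card_le_card fun c hc => ?_
        simp only [Finset.mem_filter, Finset.mem_univ, true_and, Finset.mem_biUnion] at hc ⊢
        obtain ⟨y, h1, h2⟩ := hc
        exact ⟨y, h1, h2.symm⟩
    _ ≤ ∑ y ∈ Finset.univ.filter fun y : Point k => y.1 = u, Δ := by
        refine Finset.card_biUnion_le.trans (Finset.sum_le_sum fun y _ => ?_)
        exact card_fst_le hΔ _
    _ ≤ Δ ^ 2 := by
        rw [Finset.sum_const, smul_eq_mul, sq]
        exact Nat.mul_le_mul_right _ (card_fst_le hΔ u)

theorem card_filter_apply (P : Configuration k) (p : Point k → Prop) [DecidablePred p]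
    [DecidablePred fun c => p (P.1 c)] :
    (Finset.univ.filter fun c => p (P.1 c)).card = (Finset.univ.filter p).card := by
  refine Finset.card_bij' (fun c _ => P.1 c) (fun c _ => P.1 c) ?_ ?_ ?_ ?_ <;>
    simp [P.apply_apply]

open Classical in
-- One term for each condition: three forbid a cell, two forbid the cells of all neighbours, and a
-- loop at `c` makes `c` a bad point.
theorem card_not_goodSwitch_le (P : Configuration k) (b : Point k) {Δ : ℕ} (hΔ : ∀ j, k j ≤ Δ) :
    (Finset.univ.filter fun c => ¬ P.GoodSwitch b c).card ≤
      3 * Δ + 2 * Δ ^ 2 + P.badPoints.card := by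
  let A₁ : Finset (Point k) := {c | c.1 = (P.1 b).1}
  let A₂ : Finset (Point k) := {c | ∃ y : Point k, y.1 = (P.1 b).1 ∧ (P.1 y).1 = c.1}
  let A₃ : Finset (Point k) := {c | (P.1 c).1 = b.1}
  let A₄ : Finset (Point k) := {c | ∃ y : Point k, y.1 = b.1 ∧ (P.1 y).1 = (P.1 c).1}
  let A₅ : Finset (Point k) := {c | c.1 = b.1}
  have h1 : A₁.card ≤ Δ := card_fst_le hΔ _
  have h2 : A₂.card ≤ Δ ^ 2 := P.card_neighbours_le hΔ _
  have h3 : A₃.card ≤ Δ :=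
    (P.card_filter_apply fun c => c.1 = b.1).trans_le (card_fst_le hΔ _)
  have h4 : A₄.card ≤ Δ ^ 2 :=
    (P.card_filter_apply fun c => ∃ y : Point k, y.1 = b.1 ∧ (P.1 y).1 = c.1).trans_le
      (P.card_neighbours_le hΔ _)
  have h5 : A₅.card ≤ Δ := card_fst_le hΔ _
  have hsub : (Finset.univ.filter fun c => ¬ P.GoodSwitch b c) ⊆
      A₁ ∪ (A₂ ∪ (A₃ ∪ (A₄ ∪ (A₅ ∪ P.badPoints)))) := by
    intro c hc
    simp only [Finset.mem_filter, Finset.mem_univ, true_and] at hc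
    simp only [Finset.mem_union, A₁, A₂, A₃, A₄, A₅, Finset.mem_filter, Finset.mem_univ, true_and,
      mem_badPoints]
    by_contra! hall
    obtain ⟨g1, g2, g3, g4, g5, g6⟩ := hall
    exact hc ⟨g1, g2, g3, g4, g5, fun h => g6 (.inl h.symm)⟩
  refine (Finset.card_le_card hsub).trans ?_
  have e1 := Finset.card_union_le A₁ (A₂ ∪ (A₃ ∪ (A₄ ∪ (A₅ ∪ P.badPoints))))
  have e2 := Finset.card_union_le A₂ (A₃ ∪ (A₄ ∪ (A₅ ∪ P.badPoints)))
  have e3 := Finset.card_union_le A₃ (A₄ ∪ (A₅ ∪ P.badPoints))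
  have e4 := Finset.card_union_le A₄ (A₅ ∪ P.badPoints)
  have e5 := Finset.card_union_le A₅ P.badPoints
  omega

open Classical in
-- A former loop leaves `c` free and puts `b` in the cell of `P c`. Otherwise a surviving edge `y`
-- determines the cells of `b` and of `P c`. The latter count is the weight, which is why the defect
-- contains it.
theorem card_reverse_le (P : Configuration k) :
    (Finset.univ.filter fun p : Point k × Point k => (P.1 p.2).1 = p.1.1 ∨
      ∃ y : Point k, y.1 = (P.1 p.2).1 ∧ (P.1 y).1 = p.1.1).card ≤
      ∑ j, k j ^ 2 + P.weight := by
  rw [Finset.filter_or]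
  refine (Finset.card_union_le _ _).trans (add_le_add ?_ ?_)
  · rw [Finset.card_filter, Fintype.sum_prod_type_right, ← sum_point_degree]
    calc _ = ∑ c : Point k, k (P.1 c).1 := by
          refine Finset.sum_congr rfl fun c _ => ?_
          rw [← Finset.card_filter, ← card_fst_eq (k := k) (P.1 c).1]
          congr 1
          ext y
          simp [eq_comm]
      _ ≤ _ := le_of_eq <| Finset.sum_bijective P.1 (Function.bijective_iff_has_inverse.2
          ⟨P.1, P.apply_apply, P.apply_apply⟩) (by simp) (fun _ _ => rfl)
  · calc _ ≤ (Finset.univ.biUnion fun y : Point k =>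
          (Finset.univ.filter fun b : Point k => b.1 = (P.1 y).1) ×ˢ
          (Finset.univ.filter fun c : Point k => (P.1 c).1 = y.1)).card := by
          refine Finset.card_le_card fun p hp => ?_
          simp only [Finset.mem_filter, Finset.mem_univ, true_and, Finset.mem_biUnion,
            Finset.mem_product] at hp ⊢
          obtain ⟨y, h1, h2⟩ := hp
          exact ⟨y, h2.symm, h1.symm⟩
      _ ≤ ∑ y : Point k, k (P.1 y).1 * k y.1 := by
          refine Finset.card_biUnion_le.trans (Finset.sum_le_sum fun y _ => le_of_eq ?_)
          rw [Finset.card_product]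
          congr 1
          · convert card_fst_eq (k := k) (P.1 y).1
          · rw [← card_fst_eq (k := k) y.1]
            convert P.card_filter_apply fun c => c.1 = y.1
      _ = P.weight := by
          rw [weight]
          exact Finset.sum_congr rfl fun y _ => mul_comm _ _

open Classical in
-- Double counting of switchings: at least `M / 2` out of each configuration with a bad point, at
-- most `(B + L) * M` into each configuration with fewer. The extra `1` accounts for configurations
-- that have no bad point.
theorem card_switch_le {B L Δ : ℕ} (hB : ∑ j, k j ^ 2 ≤ B * degreeSum k) (hΔ : ∀ j, k j ≤ Δ)
    (hM : 10 * Δ ^ 2 + 2 * L ≤ degreeSum k) (hM0 : 0 < degreeSum k) (t : ℕ) :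
    (Finset.univ.filter fun P : Configuration k =>
      P.badPoints.card ≤ t + 1 ∧ P.defect ≤ L * degreeSum k).card ≤
    (2 * (B + L) + 1) * (Finset.univ.filter fun P : Configuration k =>
      P.badPoints.card ≤ t ∧ P.defect ≤ L * degreeSum k).card := by
  set C : ℕ → Finset (Configuration k) := fun t => Finset.univ.filter fun P =>
    P.badPoints.card ≤ t ∧ P.defect ≤ L * degreeSum k with hC
  have hmem : ∀ t P, P ∈ C t ↔ P.badPoints.card ≤ t ∧ P.defect ≤ L * degreeSum k := by
    simp [hC]
  change (C (t + 1)).card ≤ (2 * (B + L) + 1) * (C t).card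
  set D := (C (t + 1)).filter fun P => P.badPoints.Nonempty with hD
  -- The forbidden points number at most `5 * Δ ^ 2 + L`, which is at most half of `M` by `hM`.
  have hΔ2 : Δ ≤ Δ ^ 2 := Nat.le_self_pow two_ne_zero Δ
  have hforward : ∀ P ∈ D, degreeSum k ≤ 2 * (Finset.univ.filter fun p : Point k × Point k =>
      P.BadAt p.1 ∧ P.GoodSwitch p.1 p.2).card := by
    intro P hP
    obtain ⟨hP, b, hb⟩ := Finset.mem_filter.1 hP
    have hbad : P.badPoints.card ≤ L := by
      have h1 : degreeSum k * P.badPoints.card ≤ degreeSum k * L := by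
        rw [mul_comm _ L]
        exact le_trans le_self_add ((hmem _ _).1 hP).2
      exact Nat.le_of_mul_le_mul_left h1 hM0
    have h1 := P.card_not_goodSwitch_le b hΔ
    have h2 := Finset.card_filter_add_card_filter_not (s := (Finset.univ : Finset (Point k)))
      (p := fun c => P.GoodSwitch b c)
    rw [Finset.card_univ, card_point] at h2
    have h3 : (Finset.univ.filter fun c => P.GoodSwitch b c).card ≤
        (Finset.univ.filter fun p : Point k × Point k =>
          P.BadAt p.1 ∧ P.GoodSwitch p.1 p.2).card := by
      refine Finset.card_le_card_of_injOn (fun c => (b, c)) (fun c hc => ?_) (fun c _ c' _ h => ?_)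
      · simpa using ⟨mem_badPoints.1 hb, by simpa using hc⟩
      · simpa using h
    omega
  have hbackward : ∀ P ∈ C t, (Finset.univ.filter fun p : Point k × Point k =>
      (P.1 p.2).1 = p.1.1 ∨ ∃ y : Point k, y.1 = (P.1 p.2).1 ∧ (P.1 y).1 = p.1.1).card ≤
      (B + L) * degreeSum k := by
    intro P hP
    have h1 : P.weight ≤ L * degreeSum k := le_trans le_add_self ((hmem _ _).1 hP).2
    rw [add_mul]
    exact P.card_reverse_le.trans (add_le_add hB h1)
  have hcount : ∑ P ∈ D, (Finset.univ.filter fun p : Point k × Point k =>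
      P.BadAt p.1 ∧ P.GoodSwitch p.1 p.2).card ≤ ∑ P ∈ C t, (Finset.univ.filter
      fun p : Point k × Point k => (P.1 p.2).1 = p.1.1 ∨
        ∃ y : Point k, y.1 = (P.1 p.2).1 ∧ (P.1 y).1 = p.1.1).card := by
    rw [← Finset.card_sigma, ← Finset.card_sigma]
    -- The pair `(b, c)` is kept, and an exchange is its own inverse.
    refine Finset.card_le_card_of_injOn (fun q => ⟨q.1.exchange q.2.1 q.2.2, q.2⟩) ?_ ?_
    · rintro ⟨P, b, c⟩ hq
      simp only [Finset.coe_sigma, Set.mem_sigma_iff, Finset.mem_coe, Finset.mem_filter,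
        Finset.mem_univ, true_and, hD] at hq ⊢
      obtain ⟨⟨hP, -⟩, hb, hs⟩ := hq
      have hP' := (hmem _ _).1 hP
      refine ⟨(hmem _ _).2 ⟨?_, ?_⟩, hs.exists_of_badAt hb⟩
      · have := hs.card_badPoints_lt hb
        omega
      · exact (hs.defect_exchange_le hb hΔ (by omega)).trans hP'.2
    · rintro ⟨P, b, c⟩ _ ⟨P', b', c'⟩ _ h
      simp only [Sigma.mk.injEq, heq_eq_eq, Prod.mk.injEq] at h
      obtain ⟨h1, rfl, rfl⟩ := h
      have : P = P' := by
        rw [← exchange_exchange b c P, h1, exchange_exchange]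
      rw [this]
  have hDcard : D.card ≤ 2 * (B + L) * (C t).card := by
    refine Nat.le_of_mul_le_mul_left ?_ hM0
    calc degreeSum k * D.card = ∑ P ∈ D, degreeSum k := by simp [mul_comm]
      _ ≤ 2 * ∑ P ∈ D, (Finset.univ.filter fun p : Point k × Point k =>
          P.BadAt p.1 ∧ P.GoodSwitch p.1 p.2).card := by
          rw [Finset.mul_sum]
          exact Finset.sum_le_sum hforward
      _ ≤ 2 * ∑ P ∈ C t, (B + L) * degreeSum k := by
          gcongr
          exact hcount.trans (Finset.sum_le_sum hbackward)
      _ = _ := by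
          rw [Finset.sum_const, smul_eq_mul]
          ring
  have hsplit : (C (t + 1)).card ≤ D.card + (C t).card := by
    rw [← Finset.card_filter_add_card_filter_not (s := C (t + 1))
      (p := fun P => P.badPoints.Nonempty)]
    refine add_le_add_right (Finset.card_le_card fun P hP => ?_) _
    simp only [Finset.mem_filter, Finset.not_nonempty_iff_eq_empty] at hP
    exact (hmem _ _).2 ⟨by simp [hP.2], ((hmem _ _).1 hP.1).2⟩
  calc _ ≤ _ := hsplit
    _ ≤ 2 * (B + L) * (C t).card + (C t).card := by gcongr
    _ = _ := by ring

open Classical in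
/-- A positive fraction of all configurations is simple. -/
theorem card_le_mul_card_isSimple {B Δ : ℕ} (hB : ∑ j, k j ^ 2 ≤ B * degreeSum k)
    (hΔ : ∀ j, k j ≤ Δ) (hM : 10 * Δ ^ 2 + 4 * (2 * B + 6 * B ^ 2) + 6 ≤ degreeSum k) :
    Fintype.card (Configuration k) ≤
      2 * (2 * (B + 2 * (2 * B + 6 * B ^ 2)) + 1) ^ (2 * (2 * B + 6 * B ^ 2)) *
        (Finset.univ.filter fun P : Configuration k => P.IsSimple).card := by
  -- The average defect is at most `l * M`. The Markov threshold `2 * l * M` allows at most `2 * l`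
  -- bad points, hence `2 * l` levels.
  set l := 2 * B + 6 * B ^ 2 with hl
  have hM0 : 0 < degreeSum k := by omega
  have hdefect := sum_defect_le (by omega) hB
  have hiter : ∀ t, (Finset.univ.filter fun P : Configuration k =>
      P.badPoints.card ≤ t ∧ P.defect ≤ 2 * l * degreeSum k).card ≤
      (2 * (B + 2 * l) + 1) ^ t * (Finset.univ.filter fun P : Configuration k =>
        P.IsSimple).card := by
    intro t
    induction t with
    | zero =>
      rw [pow_zero, one_mul]
      refine Finset.card_le_card fun P hP => ?_
      simp only [Finset.mem_filter, Finset.mem_univ, true_and, Nat.le_zero,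
        Finset.card_eq_zero] at hP ⊢
      refine P.isSimple_iff.2 fun x hx => ?_
      have := mem_badPoints.2 hx
      simp [hP.1] at this
    | succ t ih =>
      refine (card_switch_le hB hΔ (by omega) hM0 t).trans ?_
      calc _ ≤ (2 * (B + 2 * l) + 1) * ((2 * (B + 2 * l) + 1) ^ t *
            (Finset.univ.filter fun P : Configuration k => P.IsSimple).card) := by gcongr
        _ = _ := by ring
  have hmarkov : Fintype.card (Configuration k) ≤ 2 * (Finset.univ.filter
      fun P : Configuration k => P.defect ≤ 2 * l * degreeSum k).card := by
    have h1 := Finset.card_filter_add_card_filter_not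
      (s := (Finset.univ : Finset (Configuration k)))
      (p := fun P => P.defect ≤ 2 * l * degreeSum k)
    rw [Finset.card_univ] at h1
    have h2 : (Finset.univ.filter fun P : Configuration k =>
        ¬ P.defect ≤ 2 * l * degreeSum k).card * (2 * l * degreeSum k + 1) ≤
        l * degreeSum k * Fintype.card (Configuration k) := by
      refine le_trans ?_ hdefect
      rw [← smul_eq_mul]
      refine (Finset.card_nsmul_le_sum _ defect _ fun P hP => ?_).trans
        (Finset.sum_le_sum_of_subset (Finset.filter_subset _ _))
      simp only [Finset.mem_filter] at hP
      omega
    -- Otherwise more than half of the configurations would have defect above twice the bound on the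
    -- average.
    by_contra! hlt
    have h3 : Fintype.card (Configuration k) < 2 * (Finset.univ.filter
        fun P : Configuration k => ¬ P.defect ≤ 2 * l * degreeSum k).card := by omega
    nlinarith [Nat.zero_le (l * degreeSum k)]
  refine hmarkov.trans ((Nat.mul_le_mul_left 2 (le_trans (Finset.card_le_card fun P hP => ?_)
    (hiter (2 * l)))).trans_eq (mul_assoc _ _ _).symm)
  simp only [Finset.mem_filter, Finset.mem_univ, true_and] at hP ⊢
  refine ⟨?_, hP⟩
  have h1 : degreeSum k * P.badPoints.card ≤ degreeSum k * (2 * l) := by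
    rw [mul_comm _ (2 * l)]
    exact le_trans le_self_add hP
  exact Nat.le_of_mul_le_mul_left h1 hM0

end Configuration

end Switching

/-! ### Power-law degrees and the final estimates -/

section Asymptotics

variable {n : ℕ} {k : Fin n → ℕ}

/-! ## Consequences of the degree conditions -/

theorem IsGraphical.degree_lt (h : IsGraphical k) (j : Fin n) : k j < n := by
  obtain ⟨G, hG⟩ := h
  rw [← hG j]
  have hss : G.neighborSet j ⊂ Set.univ :=
    Set.ssubset_univ_iff.2 fun h => G.irrefl (h ▸ Set.mem_univ j : j ∈ G.neighborSet j)
  simpa using Set.ncard_lt_ncard hss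

theorem IsGraphical.degreeSum_le (h : IsGraphical k) : degreeSum k ≤ n ^ 2 := by
  calc degreeSum k ≤ ∑ _j : Fin n, n := Finset.sum_le_sum fun j _ => (h.degree_lt j).le
    _ = n ^ 2 := by simp [sq]

theorem le_degreeSum (hk : ∀ j, 1 ≤ k j) : n ≤ degreeSum k := by
  calc n = ∑ _j : Fin n, 1 := by simp
    _ ≤ degreeSum k := Finset.sum_le_sum fun j _ => hk j

/-- All point numbers fit into a word, since a graphical sequence has sum at most `n ^ 2`. -/
theorem sq_lt_two_pow_wordLength (n : ℕ) : n ^ 2 < 2 ^ wordLength n := by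
  have h : n < 2 ^ (Nat.log 2 n + 1) := Nat.lt_pow_succ_log_self one_lt_two n
  calc n ^ 2 < (2 ^ (Nat.log 2 n + 1)) ^ 2 := by gcongr
    _ = 2 ^ (2 * (Nat.log 2 n + 1)) := by rw [← pow_mul, mul_comm]
    _ ≤ _ := Nat.pow_le_pow_right two_pos (by rw [wordLength]; omega)

theorem one_lt_two_pow_wordLength (n : ℕ) : 1 < 2 ^ wordLength n :=
  Nat.one_lt_two_pow (by rw [wordLength]; omega)

/-- Summation by layers: `k ^ 2` is at most the sum of `2 * i` over `i ≤ k`, and the tail bound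
turns this into a series with exponent `2 - γ`, which converges because `γ > 3`. -/
theorem sum_sq_le_of_powerLaw {γ C : ℝ} (hγ : 3 < γ) (hC : 0 < C) (hlt : ∀ j, k j < n)
    (hk : PowerLawDistributionBounded γ C k) :
    ((∑ j, k j ^ 2 : ℕ) : ℝ) ≤ 2 * C * (∑' i : ℕ, (i : ℝ) ^ (2 - γ)) * n := by
  classical
  have hsq : ∀ j, k j ^ 2 ≤ ∑ i ∈ Finset.range (n + 1), if i ≤ k j then 2 * i else 0 := by
    intro j
    have h1 : ∑ i ∈ Finset.range (n + 1), (if i ≤ k j then 2 * i else 0) =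
        ∑ i ∈ Finset.range (k j + 1), 2 * i := by
      rw [← Finset.sum_filter]
      congr 1
      ext i
      simp only [Finset.mem_filter, Finset.mem_range]
      have := hlt j
      omega
    rw [h1, ← Finset.mul_sum, mul_comm, Finset.sum_range_id_mul_two, Nat.add_sub_cancel]
    nlinarith
  have hcard : ∀ i, (Finset.univ.filter fun j => i ≤ k j).card = {j | i ≤ k j}.ncard := by
    intro i
    rw [← Set.ncard_coe_finset]
    simp
  calc ((∑ j, k j ^ 2 : ℕ) : ℝ)
      ≤ ((∑ j, ∑ i ∈ Finset.range (n + 1), if i ≤ k j then 2 * i else 0 : ℕ) : ℝ) := by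
        exact_mod_cast Finset.sum_le_sum fun j _ => hsq j
    _ = ∑ i ∈ Finset.range (n + 1), 2 * (i : ℝ) * ({j | i ≤ k j}.ncard : ℝ) := by
        rw [Finset.sum_comm, Nat.cast_sum]
        refine Finset.sum_congr rfl fun i _ => ?_
        rw [← Finset.sum_filter, Finset.sum_const, hcard, smul_eq_mul]
        push_cast
        ring
    _ ≤ ∑ i ∈ Finset.range (n + 1), 2 * C * n * (i : ℝ) ^ (2 - γ) := by
        refine Finset.sum_le_sum fun i _ => ?_
        rcases Nat.eq_zero_or_pos i with rfl | hi
        · simp only [Nat.cast_zero, mul_zero, zero_mul]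
          positivity
        · have hi' : (0 : ℝ) < i := by exact_mod_cast hi
          calc 2 * (i : ℝ) * ({j | i ≤ k j}.ncard : ℝ)
              ≤ 2 * (i : ℝ) * (C * n * (i : ℝ) ^ (1 - γ)) := by
                gcongr
                exact hk.2 i hi
            _ = 2 * C * n * ((i : ℝ) ^ (1 : ℝ) * (i : ℝ) ^ (1 - γ)) := by
                rw [Real.rpow_one]
                ring
            _ = _ := by
                rw [← Real.rpow_add hi']
                ring_nf
    _ = 2 * C * n * ∑ i ∈ Finset.range (n + 1), (i : ℝ) ^ (2 - γ) := by rw [Finset.mul_sum]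
    _ ≤ 2 * C * n * ∑' i : ℕ, (i : ℝ) ^ (2 - γ) := by
        gcongr
        refine Summable.sum_le_tsum _ (fun i _ => by positivity) ?_
        exact Real.summable_nat_rpow.2 (by linarith)
    _ = _ := by ring

theorem exists_sum_sq_le {γ C : ℝ} (hγ : 3 < γ) (hC : 0 < C) :
    ∃ B : ℕ, ∀ (n : ℕ) (k : Fin n → ℕ), (∀ j, k j < n) → PowerLawDistributionBounded γ C k →
      ∑ j, k j ^ 2 ≤ B * degreeSum k := by
  refine ⟨⌈2 * C * ∑' i : ℕ, (i : ℝ) ^ (2 - γ)⌉₊, fun n k hlt hk => ?_⟩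
  refine le_trans ?_ (Nat.mul_le_mul_left _ (le_degreeSum hk.1))
  have h := sum_sq_le_of_powerLaw hγ hC hlt hk
  have h2 := Nat.le_ceil (2 * C * ∑' i : ℕ, (i : ℝ) ^ (2 - γ))
  have h3 : ((∑ j, k j ^ 2 : ℕ) : ℝ) ≤
      ((⌈2 * C * ∑' i : ℕ, (i : ℝ) ^ (2 - γ)⌉₊ * n : ℕ) : ℝ) := by
    push_cast at h ⊢
    exact h.trans (by gcongr)
  exact_mod_cast h3

/-- A vertex of degree `d` is counted in its own tail, so `d ^ (γ - 1) ≤ C * n`. As `γ - 1 > 2`,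
this forces `d ^ 2` to be small compared with `n`. -/
theorem exists_sq_degree_le {γ : ℝ} (C : ℝ) (hγ : 3 < γ) :
    ∃ n₀ : ℕ, ∀ n ≥ n₀, ∀ k : Fin n → ℕ, PowerLawDistributionBounded γ C k →
      ∀ j, 20 * k j ^ 2 ≤ n := by
  have hlim : Filter.Tendsto (fun m : ℕ => ((m : ℝ) / 20) ^ ((γ - 3) / 2))
      Filter.atTop Filter.atTop :=
    (tendsto_rpow_atTop (by linarith)).comp
      (tendsto_natCast_atTop_atTop.atTop_div_const (by norm_num))
  obtain ⟨n₀, hn₀⟩ := Filter.eventually_atTop.1 (hlim.eventually_gt_atTop (20 * C))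
  refine ⟨n₀, fun n hn k hk j => ?_⟩
  by_contra! hlt
  have hn0 : 0 < n := j.pos
  have hkj : 1 ≤ k j := hk.1 j
  have hk0 : (0 : ℝ) < k j := by exact_mod_cast hkj
  have hone : (1 : ℝ) ≤ C * n * (k j : ℝ) ^ (1 - γ) := by
    refine le_trans ?_ (hk.2 (k j) hkj)
    have : 0 < {i | k j ≤ k i}.ncard := (Set.ncard_pos).2 ⟨j, by simp⟩
    exact_mod_cast this
  have hpow : (k j : ℝ) ^ (γ - 1) ≤ C * n := by
    have h1 : (k j : ℝ) ^ (1 - γ) * (k j : ℝ) ^ (γ - 1) = 1 := by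
      rw [← Real.rpow_add hk0]
      simp
    calc (k j : ℝ) ^ (γ - 1) = 1 * (k j : ℝ) ^ (γ - 1) := (one_mul _).symm
      _ ≤ C * n * (k j : ℝ) ^ (1 - γ) * (k j : ℝ) ^ (γ - 1) := by gcongr
      _ = C * n := by rw [mul_assoc, h1, mul_one]
  have hx : (0 : ℝ) < (n : ℝ) / 20 := by positivity
  have hle : (n : ℝ) / 20 ≤ (k j : ℝ) ^ (2 : ℝ) := by
    rw [Real.rpow_two, div_le_iff₀ (by norm_num)]
    have : ((n : ℕ) : ℝ) ≤ ((20 * k j ^ 2 : ℕ) : ℝ) := by exact_mod_cast hlt.le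
    push_cast at this
    linarith
  have hbig : C * n < ((n : ℝ) / 20) ^ ((γ - 1) / 2) := by
    have h1 : (γ - 1) / 2 = 1 + (γ - 3) / 2 := by ring
    rw [h1, Real.rpow_add hx, Real.rpow_one]
    calc C * n = (n : ℝ) / 20 * (20 * C) := by ring
      _ < _ := by
        gcongr
        exact hn₀ n hn
  have hfin : ((n : ℝ) / 20) ^ ((γ - 1) / 2) ≤ (k j : ℝ) ^ (γ - 1) := by
    calc ((n : ℝ) / 20) ^ ((γ - 1) / 2) ≤ ((k j : ℝ) ^ (2 : ℝ)) ^ ((γ - 1) / 2) :=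
          Real.rpow_le_rpow hx.le hle (by linarith)
      _ = _ := by
        rw [← Real.rpow_mul hk0.le]
        ring_nf
  linarith

/-! ## The probability of a simple graph is bounded below -/

open Classical in
theorem exists_card_le_mul_card_isSimple {γ C : ℝ} (hγ : 3 < γ) (hC : 0 < C) :
    ∃ A : ℕ, ∀ (n : ℕ) (k : Fin n → ℕ), IsGraphical k →
      PowerLawDistributionBounded γ C k → Fintype.card (Configuration k) ≤
        A * (Finset.univ.filter fun P : Configuration k => P.IsSimple).card := by
  obtain ⟨B, hB⟩ := exists_sum_sq_le hγ hC
  obtain ⟨n₀, hn₀⟩ := exists_sq_degree_le C hγ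
  set c := 4 * (2 * B + 6 * B ^ 2) + 6 with hc
  set A₁ := 2 * (2 * (B + 2 * (2 * B + 6 * B ^ 2)) + 1) ^ (2 * (2 * B + 6 * B ^ 2)) with hA₁
  -- Above this threshold `10 * Δ ^ 2` and `c` are each at most `n / 2`, and `n ≤ M`. Below it `M`
  -- is bounded, and one simple configuration suffices.
  set n₁ := max n₀ (2 * c) with hn₁
  refine ⟨A₁ + (n₁ ^ 2)!, fun n k hk hp => ?_⟩
  rw [add_mul]
  by_cases hn : n₁ ≤ n
  · refine le_add_right (Configuration.card_le_mul_card_isSimple (Δ := Finset.univ.sup k)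
      (hB n k hk.degree_lt hp) (fun j => Finset.le_sup (Finset.mem_univ j)) ?_)
    have h1 : 20 * (Finset.univ.sup k) ^ 2 ≤ n := by
      rcases Nat.eq_zero_or_pos n with rfl | hn0
      · simp
      · obtain ⟨j, -, hj⟩ := Finset.exists_mem_eq_sup Finset.univ
          ⟨(⟨0, hn0⟩ : Fin n), Finset.mem_univ _⟩ k
        rw [hj]
        exact hn₀ n ((le_max_left _ _).trans hn) k hp j
    have h2 : 2 * c ≤ n := (le_max_right _ _).trans hn
    have h3 := le_degreeSum hp.1
    omega
  · refine le_add_left ?_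
    obtain ⟨Q, hQ⟩ := hk.exists_isSimple
    have h1 : 1 ≤ (Finset.univ.filter fun P : Configuration k => P.IsSimple).card :=
      Finset.card_pos.2 ⟨Q, by simpa using hQ⟩
    calc Fintype.card (Configuration k) = (degreeSum k - 1)‼ := card_configuration Q
      _ ≤ (degreeSum k - 1)! := Nat.doubleFactorial_le_factorial _
      _ ≤ (n₁ ^ 2)! := by
        refine Nat.factorial_le ((Nat.sub_le _ _).trans (hk.degreeSum_le.trans ?_))
        exact Nat.pow_le_pow_left (by omega) 2
      _ ≤ _ := Nat.le_mul_of_pos_right _ h1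

/-! ## The number of graphs -/

/-- The factors of `(M - 1)‼` that are at least `D` dominate powers of `D`; the remaining ones are
absorbed in `D ^ D`. -/
theorem pow_half_le_doubleFactorial (D M : ℕ) (hD : 1 ≤ D) :
    D ^ (M / 2) ≤ D ^ D * (M - 1)‼ := by
  induction M using Nat.strong_induction_on with
  | _ M ih =>
    rcases lt_or_ge M 2 with hM | hM
    · rw [Nat.div_eq_of_lt hM, pow_zero]
      exact Nat.mul_pos (pow_pos hD _) (Nat.doubleFactorial_pos _)
    · rcases le_or_gt D (M - 1) with hDM | hDM
      · have h := ih (M - 2) (by omega)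
        rw [doubleFactorial_sub_one hM, show M / 2 = (M - 2) / 2 + 1 by omega, pow_succ]
        calc D ^ ((M - 2) / 2) * D ≤ D ^ D * (M - 2 - 1)‼ * (M - 1) := by gcongr
          _ = _ := by ring
      · calc D ^ (M / 2) ≤ D ^ D := Nat.pow_le_pow_right hD (by omega)
          _ ≤ _ := Nat.le_mul_of_pos_right _ (Nat.doubleFactorial_pos _)

theorem log_factorial_le (m : ℕ) : Real.log (m ! : ℝ) ≤ (m : ℝ) ^ 2 := by
  have h1 : (m ! : ℝ) ≤ (m : ℝ) ^ m := by exact_mod_cast Nat.factorial_le_pow m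
  have h0 : (0 : ℝ) < m ! := by exact_mod_cast Nat.factorial_pos m
  calc Real.log (m ! : ℝ) ≤ Real.log ((m : ℝ) ^ m) := Real.log_le_log h0 h1
    _ = m * Real.log m := Real.log_pow _ _
    _ ≤ m * m := by
      gcongr
      exact Real.log_le_self (Nat.cast_nonneg m)
    _ = _ := (sq _).symm

theorem exists_degreeSum_le_log {γ C : ℝ} (hγ : 3 < γ) (hC : 0 < C) :
    ∃ c : ℝ, ∀ (n : ℕ) (k : Fin n → ℕ), IsGraphical k → PowerLawDistributionBounded γ C k →
      (degreeSum k : ℝ) ≤ Real.log ((graphsWithDegrees k).ncard : ℝ) + c := by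
  classical
  obtain ⟨B, hB⟩ := exists_sum_sq_le hγ hC
  obtain ⟨A, hA⟩ := exists_card_le_mul_card_isSimple hγ hC
  -- Half of `log D` is at least `B + 1`, so `M` remains after `B * M`, the bound for the logarithm
  -- of the factorials, is subtracted.
  set D := ⌈Real.exp (2 * B + 2)⌉₊ with hD
  have hD1 : 1 ≤ D := Nat.one_le_ceil_iff.2 (Real.exp_pos _)
  have hlogD : 2 * (B : ℝ) + 2 ≤ Real.log D := by
    rw [Real.le_log_iff_exp_le (by exact_mod_cast hD1)]
    exact Nat.le_ceil _
  refine ⟨D * Real.log D + Real.log A + (B + 1), fun n k hk hp => ?_⟩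
  obtain ⟨Q, hQ⟩ := hk.exists_isSimple
  have hcard := hA n k hk hp
  rw [card_configuration Q, card_isSimple] at hcard
  have hpow := pow_half_le_doubleFactorial D (degreeSum k) hD1
  set g := (graphsWithDegrees k).ncard with hg
  set F := ∏ j, (k j)! with hF
  have hF0 : 0 < F := Finset.prod_pos fun j _ => Nat.factorial_pos _
  have hpos : 0 < A * (g * F) := lt_of_lt_of_le (Nat.doubleFactorial_pos _) hcard
  have hA0 : 0 < A := Nat.pos_of_mul_pos_right hpos
  have hg0 : 0 < g := Nat.pos_of_mul_pos_right (Nat.pos_of_mul_pos_left hpos)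
  have hlog : (degreeSum k / 2 : ℕ) * Real.log D ≤
      D * Real.log D + (Real.log A + (Real.log g + Real.log F)) := by
    have hA' : (A : ℝ) ≠ 0 := by positivity
    have hg' : (g : ℝ) ≠ 0 := by positivity
    have hF' : (F : ℝ) ≠ 0 := by positivity
    have hD' : (D : ℝ) ≠ 0 := by positivity
    rw [← Real.log_mul hg' hF', ← Real.log_mul hA' (mul_ne_zero hg' hF'), ← Real.log_pow,
      ← Real.log_pow, ← Real.log_mul (pow_ne_zero _ hD') (mul_ne_zero hA' (mul_ne_zero hg' hF'))]
    refine Real.log_le_log (by positivity) ?_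
    exact_mod_cast hpow.trans (Nat.mul_le_mul_left _ hcard)
  have hlogF : Real.log F ≤ B * degreeSum k := by
    rw [hF, Nat.cast_prod, Real.log_prod fun j _ => by
      exact_mod_cast (Nat.factorial_pos (k j)).ne']
    calc ∑ j, Real.log ((k j)! : ℝ) ≤ ∑ j, (k j : ℝ) ^ 2 :=
          Finset.sum_le_sum fun j _ => log_factorial_le _
      _ ≤ _ := by exact_mod_cast hB n k hk.degree_lt hp
  have hhalf : ((degreeSum k : ℝ) - 1) / 2 ≤ (degreeSum k / 2 : ℕ) := by
    have : degreeSum k ≤ 2 * (degreeSum k / 2) + 1 := by omega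
    have h' : (degreeSum k : ℝ) ≤ 2 * ((degreeSum k / 2 : ℕ) : ℝ) + 1 := by exact_mod_cast this
    linarith
  have hlow : ((degreeSum k : ℝ) - 1) * (B + 1) ≤ (degreeSum k / 2 : ℕ) * Real.log D := by
    rcases le_or_gt (degreeSum k : ℝ) 1 with h1 | h1
    · refine le_trans (mul_nonpos_of_nonpos_of_nonneg (by linarith) (by positivity)) ?_
      exact mul_nonneg (Nat.cast_nonneg _) (le_trans (by positivity) hlogD)
    · calc ((degreeSum k : ℝ) - 1) * (B + 1) = ((degreeSum k : ℝ) - 1) / 2 * (2 * B + 2) := by ring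
        _ ≤ _ := by gcongr
  linarith

/-! ## The running time -/

theorem exists_expectedRuntime_le {γ C : ℝ} (hγ : 3 < γ) (hC : 0 < C) :
    ∃ K : ℕ, ∀ (n : ℕ) (k : Fin n → ℕ), 0 < n → IsGraphical k →
      PowerLawDistributionBounded γ C k → expectedRuntime k ≤ ((K * degreeSum k : ℕ) : ℝ≥0∞) := by
  classical
  obtain ⟨A, hA⟩ := exists_card_le_mul_card_isSimple hγ hC
  -- From `n ≤ M` and `1 ≤ M`: `8 + 6 + 13 = 27` for the setup and `69 + 35 = 104` per round, with
  -- at most `A` rounds expected.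
  refine ⟨27 + A * 104, fun n k hn hk hp => ?_⟩
  have hnM := le_degreeSum hp.1
  have hsq := sq_lt_two_pow_wordLength n
  refine (expectedRuntime_le (one_lt_two_pow_wordLength n)
    ((Nat.le_self_pow two_ne_zero n).trans_lt hsq) (hn.trans_le hnM)
    (hk.degreeSum_le.trans_lt hsq) hk.exists_isSimple).trans ?_
  rw [add_mul, Nat.cast_add (27 * degreeSum k)]
  refine add_le_add (Nat.cast_le.2 (by omega)) (ENNReal.div_le_of_le_mul ?_)
  rw [← Nat.cast_mul, ← Nat.cast_mul, Nat.cast_le]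
  calc _ ≤ A * (Finset.univ.filter fun P : Configuration k => P.IsSimple).card *
        (104 * degreeSum k) := Nat.mul_le_mul (hA n k hk hp) (by omega)
    _ = _ := by ring

end Asymptotics

theorem lemma4p7 (γ C : ℝ) (hγ : 3 < γ) (hC : 0 < C) :
    (∀ (n : ℕ) (k : Fin n → ℕ), 0 < n → IsGraphical k → PowerLawDistributionBounded γ C k →
      RoundIsUniform k ∧ IsUniformSampler k) ∧
    (∃ K : ℝ, ∀ (n : ℕ) (k : Fin n → ℕ), 0 < n → IsGraphical k →
      PowerLawDistributionBounded γ C k →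
        expectedRuntime k ≤ ENNReal.ofReal (K * degreeSum k)) ∧
    (∃ Q : Polynomial ℝ, ∀ (n : ℕ) (k : Fin n → ℕ), 0 < n → IsGraphical k →
      PowerLawDistributionBounded γ C k →
        expectedRuntime k ≤
          ENNReal.ofReal (Q.eval (Real.log ((graphsWithDegrees k).ncard : ℝ)))) := by
  obtain ⟨K, hK⟩ := exists_expectedRuntime_le hγ hC
  obtain ⟨c, hc⟩ := exists_degreeSum_le_log hγ hC
  refine ⟨fun n k hn hk hp => ?_, ⟨K, fun n k hn hk hp => ?_⟩,
    ⟨Polynomial.C (K : ℝ) * (Polynomial.X + Polynomial.C c), fun n k hn hk hp => ?_⟩⟩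
  · have hsq := sq_lt_two_pow_wordLength n
    have hn' : n < 2 ^ wordLength n := (Nat.le_self_pow two_ne_zero n).trans_lt hsq
    have hM0 := hn.trans_le (le_degreeSum hp.1)
    have hM := hk.degreeSum_le.trans_lt hsq
    exact ⟨roundIsUniform (one_lt_two_pow_wordLength n) hn' hM0 hM,
      isUniformSampler hk (one_lt_two_pow_wordLength n) hn' hM0 hM⟩
  · refine (hK n k hn hk hp).trans (le_of_eq ?_)
    rw [← Nat.cast_mul, ENNReal.ofReal_natCast]
  · refine (hK n k hn hk hp).trans ?_
    rw [← ENNReal.ofReal_natCast]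
    refine ENNReal.ofReal_le_ofReal ?_
    simp only [Polynomial.eval_mul, Polynomial.eval_C, Polynomial.eval_add, Polynomial.eval_X]
    push_cast
    gcongr
    exact hc n k hk hp
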